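/- Let $q_0>0$, $\sigma,t\in\mathbb R$, and let $\mathbf q_\pm\in\mathbb C^2$ satisfy $\|\mathbf q_\pm\|=q_0$ and $|\mathbf q_+^\dagger\mathbf q_-|<q_0^2$ (non-parallel boundary values). Let $\mathbf q(x,t)\in\mathbb C^2$ be such that, at the given time $t$, $x\mapsto\mathbf q(x,t)$ is of class $C^2$, $\mathbf q\to\mathbf q_\pm$ as $x\to\pm\infty$, $\mathbf q-\mathbf q_\pm\in L^1(\mathbb R^\pm)$ and $\mathbf q_x,\mathbf q_{xx}\in L^1(\mathbb R)$. (This covers every time slice of a solution, with this regularity and decay, of the defocusing-defocusing coupled Hirota equation $\mathrm i\mathbf q_t+\mathbf q_{xx}-2(\|\mathbf q\|^2-q_0^2)\mathbf q+\mathrm i\sigma[\mathbf q_{xxx}-3\|\mathbf q\|^2\mathbf q_x-3(\mathbf q^\dagger\mathbf q_x)\mathbf q]=0$; the equation itself is not needed.) For $z\in\mathbb R\setminus\{0,\pm q_0\}$ put $k=\frac12(z+q_0^2/z)$, $\lambda=\frac12(z-q_0^2/z)$, $\widehat\rho=z^2/(z^2-q_0^2)$, $\mathbf v^\perp=(v_2^*,-v_1^*)^T$,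 $$\mathbf J=\operatorname{diag}(1,-1,-1),\quad \mathbf X=\mathrm ik\mathbf J+\mathrm i\begin{pmatrix}0&-\mathbf q^\dagger\\ \mathbf q&\mathbf 0\end{pmatrix},\quad \widehat{\mathbf Y}_\pm=\begin{pmatrix}\mathrm i\widehat\rho&0&\widehat\rho\,q_0/z\\ \mathrm i\widehat\rho\,\mathbf q_\pm/z&\mathbf q_\pm^\perp/q_0&\widehat\rho\,\mathbf q_\pm/q_0\end{pmatrix},$$ $\delta_1=\lambda x+2\lambda[k+\sigma(3k^2-\lambda^2)]t$, $\delta_2=-kx-(\lambda^2+k^2+4\sigma k^3)t$ and $\mathbf\Delta=\operatorname{diag}(\delta_1,\delta_2,-\delta_1)$. Then there are unique matrix Jost solutions $\psi_\pm(z;x,t)$ with $\partial_x\psi_\pm=\mathbf X\psi_\pm$ and $\psi_\pm=\widehat{\mathbf Y}_\pm\mathrm e^{\mathrm i\mathbf\Delta}+o(1)$ as $x\to\pm\infty$, and a unique scattering matrix $\mathbf H(z)=(h_{ij}(z))$ with $\psi_+=\psi_-\mathbf H$; moreover $\det\mathbf H=1$. Put $\mathbf S=\mathbf H^{-1}=(s_{ij})$,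 $\beta_1(z)=s_{13}(z)/s_{11}(z)$ and $\beta_2(z)=h_{21}(z)/h_{11}(z)$. Below, $z\to\infty$ and $z\to0$ along the real line. The number $(\mathbf q_-^\perp)^\dagger\mathbf q_+$ is nonzero, and the following holds. **Non-orthogonal case**, $\mathbf q_+^\dagger\mathbf q_-\neq0$. The denominators $h_{11}(z)$ and $s_{11}(z)$ do not vanish for $|z|$ large enough and for $z\ne0$ small enough. As $z\to\infty$, $$\beta_1(z)=O\Big(\frac1z\Big),\quad \beta_2(z)=O\Big(\frac1{z^2}\Big),\quad \beta_1\Big(\frac{q_0^2}z\Big)=O\Big(\frac1{z^2}\Big),\quad \beta_2\Big(\frac{q_0^2}z\Big)=\frac{q_0}{\mathrm iz}\,\frac{(\mathbf q_-^\perp)^\dagger\mathbf q_+}{\mathbf q_-^\dagger\mathbf q_+}+O\Big(\frac1{z^2}\Big).$$ As $z\to0$, $$\beta_1(z)=O(z),\quad \beta_1\Big(\frac{q_0^2}z\Big)=O(z),\quad \beta_2\Big(\frac{q_0^2}z\Big)=O(z),\quad \beta_2(z)=\frac z{\mathrm iq_0}\,\frac{(\mathbf q_-^\perp)^\dagger\mathbf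 q_+}{\mathbf q_-^\dagger\mathbf q_+}+O(z^2).$$ **Orthogonal case**, $\mathbf q_+^\dagger\mathbf q_-=0$. Assume in addition that $(1+|x|)(\mathbf q-\mathbf q_\pm)\in L^1(\mathbb R^\pm)$ and that $$\vartheta_1=\int_{\mathbb R}[\mathbf q_+^\dagger\mathbf q(x,t)]\,[\mathbf q^\dagger(x,t)\mathbf q_-]\,\mathrm dx\neq0 .$$ The denominators $h_{11}(z)$ and $s_{11}(z)$ do not vanish for $|z|$ large enough and for $z\ne0$ small enough. As $z\to\infty$, $$\beta_1(z)=O\Big(\frac1z\Big),\quad \beta_1\Big(\frac{q_0^2}z\Big)=O\Big(\frac1z\Big),\quad \beta_2(z)=O\Big(\frac1{z^2}\Big),\quad \beta_2\Big(\frac{q_0^2}z\Big)=\frac{q_0}{\vartheta_1^*}\,(\mathbf q_-^\perp)^\dagger\mathbf q_++O\Big(\frac1z\Big).$$ As $z\to0$, $$\beta_1(z)=O(1),\quad \beta_1\Big(\frac{q_0^2}z\Big)=O(z),\quad \beta_2\Big(\frac{q_0^2}z\Big)=O(z),\quad \beta_2(z)=\frac{q_0}{\vartheta_1^*}\,(\mathbf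 q_-^\perp)^\dagger\mathbf q_++O(z).$$ -/

import Mathlib

open Filter Topology MeasureTheory Asymptotics

noncomputable section

namespace CoupledHirota

/-- Two-component complex vectors with the Hermitian norm; `inner ℂ v w` is `v† w`. -/
abbrev Vec2 := EuclideanSpace ℂ (Fin 2)

/-- Complex `3 × 3` matrices. -/
abbrev Mat3 := Matrix (Fin 3) (Fin 3) ℂ

/-- The orthogonal vector `v^⊥ = (v₂, -v₁)†`. -/
def perp (v : Vec2) : Vec2 := !₂[star (v 1), -star (v 0)]

/-- `J = diag (1, -1, -1)`. -/
def matJ : Mat3 := Matrix.diagonal ![1, -1, -1]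

/-- The potential matrix `Q = [[0, -v†], [v, 0]]` in block form. -/
def matQ (v : Vec2) : Mat3 :=
  !![0, -star (v 0), -star (v 1);
     v 0, 0, 0;
     v 1, 0, 0]

/-- The matrix `X = i k J + i Q` of the spatial part of the Lax pair. -/
def matX (k : ℝ) (v : Vec2) : Mat3 :=
  (Complex.I * (k : ℂ)) • matJ + Complex.I • matQ v

/-- `k(z) = (z + q₀² / z) / 2`. -/
def kz (q0 z : ℝ) : ℝ := (z + q0 ^ 2 / z) / 2

/-- `λ(z) = (z - q₀² / z) / 2`. -/
def lamz (q0 z : ℝ) : ℝ := (z - q0 ^ 2 / z) / 2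

/-- `ρ(z) = z² / (z² - q₀²)`. -/
def rhoHat (q0 z : ℝ) : ℝ := z ^ 2 / (z ^ 2 - q0 ^ 2)

/-- The eigenvector matrix attached to the boundary vector `v`, with columns
`ρ (i, i v / z)`, `(0, v^⊥ / q₀)` and `ρ (q₀ / z, v / q₀)`. -/
def matY (q0 : ℝ) (v : Vec2) (z : ℝ) : Mat3 :=
  !![rhoHat q0 z * Complex.I, 0, rhoHat q0 z * (q0 / z);
     rhoHat q0 z * (Complex.I * v 0 / z), perp v 0 / q0, rhoHat q0 z * (v 0 / q0);
     rhoHat q0 z * (Complex.I * v 1 / z), perp v 1 / q0, rhoHat q0 z * (v 1 / q0)]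

/-- The phase `δ₁ = λ x + 2 λ (k + σ (3 k² - λ²)) t`. -/
def delta1 (q0 σ z x t : ℝ) : ℝ :=
  lamz q0 z * x
    + 2 * lamz q0 z * (kz q0 z + σ * (3 * kz q0 z ^ 2 - lamz q0 z ^ 2)) * t

/-- The phase `δ₂ = -k x - (λ² + k² + 4 σ k³) t`. -/
def delta2 (q0 σ z x t : ℝ) : ℝ :=
  -(kz q0 z) * x - (lamz q0 z ^ 2 + kz q0 z ^ 2 + 4 * σ * kz q0 z ^ 3) * t

/-- `exp (i Δ)` with `Δ = diag (δ₁, δ₂, -δ₁)`. -/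
def expDelta (q0 σ z x t : ℝ) : Mat3 :=
  Matrix.diagonal
    ![Complex.exp (Complex.I * (delta1 q0 σ z x t : ℂ)),
      Complex.exp (Complex.I * (delta2 q0 σ z x t : ℂ)),
      Complex.exp (-(Complex.I * (delta1 q0 σ z x t : ℂ)))]

/-- `ψ`, as a function of `x` at time `t`, is the Jost solution normalised at the end `l`
of the line (`l = atTop` or `l = atBot`) by the boundary vector `v`: it solves
`ψ_x = X ψ` and `ψ = Y e^{iΔ} + o(1)` along `l`. -/
def IsJost (q0 σ : ℝ) (q : ℝ → ℝ → Vec2) (l : Filter ℝ) (v : Vec2) (t z : ℝ)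
    (ψ : ℝ → Mat3) : Prop :=
  (∀ x : ℝ, ∀ i j : Fin 3,
      HasDerivAt (fun y => ψ y i j) ((matX (kz q0 z) (q x t) * ψ x) i j) x) ∧
  (∀ i j : Fin 3,
      Tendsto (fun x => ψ x i j - (matY q0 v z * expDelta q0 σ z x t) i j) l (𝓝 0))

/-- The Jost solution at the end `l` (it exists and is unique for the potentials and the
values of `z` considered). -/
def jost (q0 σ : ℝ) (q : ℝ → ℝ → Vec2) (l : Filter ℝ) (v : Vec2) (t z : ℝ) : ℝ → Mat3 :=
  Classical.epsilon (IsJost q0 σ q l v t z)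

/-- `H` is a scattering matrix: `ψ₊ = ψ₋ H` on the whole line. -/
def IsScattering (q0 σ : ℝ) (q : ℝ → ℝ → Vec2) (qm qp : Vec2) (t z : ℝ) (H : Mat3) : Prop :=
  ∀ x : ℝ, jost q0 σ q atTop qp t z x = jost q0 σ q atBot qm t z x * H

/-- The scattering matrix `H(z)`. -/
def matH (q0 σ : ℝ) (q : ℝ → ℝ → Vec2) (qm qp : Vec2) (t z : ℝ) : Mat3 :=
  Classical.epsilon (IsScattering q0 σ q qm qp t z)

/-- The inverse scattering matrix `S(z) = H(z)⁻¹`. -/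
def matS (q0 σ : ℝ) (q : ℝ → ℝ → Vec2) (qm qp : Vec2) (t z : ℝ) : Mat3 :=
  (matH q0 σ q qm qp t z)⁻¹

/-- The reflection coefficient `β₁ = s₁₃ / s₁₁`. -/
def beta1 (q0 σ : ℝ) (q : ℝ → ℝ → Vec2) (qm qp : Vec2) (t z : ℝ) : ℂ :=
  matS q0 σ q qm qp t z 0 2 / matS q0 σ q qm qp t z 0 0

/-- The reflection coefficient `β₂ = h₂₁ / h₁₁`. -/
def beta2 (q0 σ : ℝ) (q : ℝ → ℝ → Vec2) (qm qp : Vec2) (t z : ℝ) : ℂ :=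
  matH q0 σ q qm qp t z 1 0 / matH q0 σ q qm qp t z 0 0

/-- `ϑ₁ = ∫ (q₊† q) (q† q₋) dx`. -/
def theta1 (q : ℝ → ℝ → Vec2) (qm qp : Vec2) (t : ℝ) : ℂ :=
  ∫ x : ℝ, inner ℂ qp (q x t) * inner ℂ (q x t) qm

/-- The denominators `h₁₁(z)` and `s₁₁(z)` of the reflection coefficients do not vanish
as `z` goes to infinity, nor as `z` goes to zero, along the real line. -/
def DenominatorsNonzero (q0 σ : ℝ) (q : ℝ → ℝ → Vec2) (qm qp : Vec2) (t : ℝ) : Prop :=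
  (∀ᶠ z in Bornology.cobounded ℝ,
    matH q0 σ q qm qp t z 0 0 ≠ 0 ∧ matS q0 σ q qm qp t z 0 0 ≠ 0) ∧
  (∀ᶠ z in 𝓝[≠] (0 : ℝ),
    matH q0 σ q qm qp t z 0 0 ≠ 0 ∧ matS q0 σ q qm qp t z 0 0 ≠ 0)

end CoupledHirota

end

noncomputable section

namespace CoupledHirota

/-! ### Integral bounds, Grönwall, and the change of frame for one column -/

section Estimates

/-! Write p = q(·,t). A column (a, v) of a solution of ψ_x = Xψ is studied, for a large real ζ with
k = k(ζ), through `upC` = a − ⟨p,v⟩/ζ and `loC` = v − (a/ζ)p. In this frame the upper component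
rotates like e^{iλx}. The lower one rotates with frequency −k, corrected by the skew-Hermitian
rank-one term (i/ζ)⟨p,·⟩p. The coupling between them is 1/ζ times an integrable weight. Hence
`energy_le` bounds all normalised solutions uniformly in ζ. A solution whose upper component
vanishes at one end (`LowSol`) has a = O(1/ζ), and an integration by parts against the relative
phase e^{-iζx} makes its upper component at the other end O(1/ζ²): this is
`Pot.norm_limit_upper_le`.

Since k is real, ψ†Jφ does not depend on x for two solutions ψ, φ. This yields uniqueness of the
Jost solutions, the scattering matrix, the relations s₁₁ = h₁₁* and |s₁₃| = |h₃₁|, and the formula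
`JostPair.pairing_eq` for the entries of H. Only h₁₁, h₂₁, h₃₁ are then needed.

For z → ∞ take ζ = z. The first Jost columns are of upper type and the other two are low, so h₁₁ → 1
while h₂₁ and h₃₁ are O(1/z²) (`Setting.scattering_large`).

For z → 0 take ζ = q₀²/z, which keeps k and reverses λ. The types are exchanged: the first column is
a factor of size |z|/q₀² times a low solution with lower part tending to q_± up to phase, and the
third column is of upper type. Evaluating pairings at x = 0 gives h₁₁ → q_-†q_+/q₀² and h₂₁ ≈
−(iz/q₀³)(q_-^⊥)†q_+, and the third column gives h₃₁ = O(z²) (`Setting.scattering_small`,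
`Setting.scattering_zero`). If q_-†q_+ = 0, the next order of the lower parts is computed on each
half-line; the two integrals add up to ϑ₁* and h₁₁ ≈ −(iz/q₀⁴)ϑ₁*
(`Setting.scattering_zero_orthogonal`).

The expansions of β₁ and β₂ follow by division, and those at q₀²/z by substitution. -/

theorem norm_sub_le_setIntegral {E : Type*} [NormedAddCommGroup E] [NormedSpace ℝ E]
    [CompleteSpace E] {s : Set ℝ} (hs : s.OrdConnected) (hsm : MeasurableSet s) {f f' : ℝ → E}
    {m : ℝ → ℝ} (hf : ∀ x, HasDerivAt f (f' x) x) (hm : IntegrableOn m s)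
    (hb : ∀ x ∈ s, ‖f' x‖ ≤ m x) {x y : ℝ} (hx : x ∈ s) (hy : y ∈ s) :
    ‖f x - f y‖ ≤ ∫ u in s, m u := by
  have hf' : f' = deriv f := funext fun x => ((hf x).deriv).symm
  have key : ∀ a b : ℝ, a ∈ s → b ∈ s → a ≤ b → ‖f b - f a‖ ≤ ∫ u in s, m u := by
    intro a b ha hb' hab
    have hsub : Set.Icc a b ⊆ s := hs.out ha hb'
    have hsub' : Set.Ioc a b ⊆ s := Set.Ioc_subset_Icc_self.trans hsub
    have hmI : IntervalIntegrable m volume a b :=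
      (intervalIntegrable_iff_integrableOn_Ioc_of_le hab).2 (hm.mono_set hsub')
    -- No regularity of f' is required: a derivative is measurable, and domination by m does the
    -- rest.
    have hI : IntervalIntegrable f' volume a b := by
      refine hmI.mono_fun' ?_ ?_
      · rw [hf']; exact (aestronglyMeasurable_deriv f _)
      · rw [Set.uIoc_of_le hab]
        exact (ae_restrict_iff' measurableSet_Ioc).2 (ae_of_all _ fun u hu => hb u (hsub' hu))
    rw [← intervalIntegral.integral_eq_sub_of_hasDerivAt (fun u _ => hf u) hI]
    refine (intervalIntegral.norm_integral_le_of_norm_le hab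
      (ae_of_all _ fun u hu => hb u (hsub' hu)) hmI).trans ?_
    rw [intervalIntegral.integral_of_le hab]
    refine setIntegral_mono_set hm ?_ hsub'.eventuallyLE
    exact (ae_restrict_iff' hsm).2 (ae_of_all _ fun u hu => (norm_nonneg _).trans (hb u hu))
  rcases le_total y x with h | h
  · exact key y x hy hx h
  · rw [norm_sub_rev]; exact key x y hx hy h

theorem norm_sub_le_setIntegral_of_tendsto {E : Type*} [NormedAddCommGroup E] [NormedSpace ℝ E]
    [CompleteSpace E] {s : Set ℝ} (hs : s.OrdConnected) (hsm : MeasurableSet s) {f f' : ℝ → E}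
    {m : ℝ → ℝ} (hf : ∀ x, HasDerivAt f (f' x) x) (hm : IntegrableOn m s)
    (hb : ∀ x ∈ s, ‖f' x‖ ≤ m x) {l : Filter ℝ} [l.NeBot] (hl : s ∈ l) {L : E}
    (hL : Tendsto f l (𝓝 L)) {x : ℝ} (hx : x ∈ s) :
    ‖f x - L‖ ≤ ∫ u in s, m u := by
  refine le_of_tendsto ((tendsto_const_nhds.sub hL).norm) ?_
  filter_upwards [hl] with y hy
  exact norm_sub_le_setIntegral hs hsm hf hm hb hx hy

/-- Two-sided Grönwall inequality with an integrable rate. -/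
theorem le_exp_integral_mul {N N' m : ℝ → ℝ} (hN : ∀ x, HasDerivAt N (N' x) x)
    (hN0 : ∀ x, 0 ≤ N x) (hm : Continuous m) (hm0 : ∀ x, 0 ≤ m x) (hmi : Integrable m)
    (hb : ∀ x, |N' x| ≤ m x * N x) (x y : ℝ) : N x ≤ Real.exp (∫ u, m u) * N y := by
  have hM : ∀ z, HasDerivAt (fun w => ∫ u in y..w, m u) (m z) z := fun z =>
    intervalIntegral.integral_hasDerivAt_right (hm.intervalIntegrable _ _)
      (hm.stronglyMeasurableAtFilter _ _) hm.continuousAt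
  have hle : ∀ a b : ℝ, ∫ u in a..b, m u ≤ ∫ u, m u := by
    intro a b
    rcases le_total a b with h | h
    · rw [intervalIntegral.integral_of_le h]
      exact setIntegral_le_integral hmi (ae_of_all _ hm0)
    · rw [intervalIntegral.integral_symm]
      have h1 : 0 ≤ ∫ u in b..a, m u := intervalIntegral.integral_nonneg h fun u _ => hm0 u
      have h2 : 0 ≤ ∫ u, m u := integral_nonneg hm0
      linarith
  rcases le_total y x with h | h
  -- Integrating factor to the right of y; the factor with the opposite sign serves to the left of
  -- y.
  · have hanti : Antitone fun w => N w * Real.exp (-∫ u in y..w, m u) := by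
      refine antitone_of_hasDerivAt_nonpos (fun z => (hN z).mul ((hM z).neg.exp)) fun z => ?_
      have := (abs_le.1 (hb z)).2
      have he := Real.exp_pos (-∫ u in y..z, m u)
      simp only [Pi.zero_apply, Pi.neg_apply]
      nlinarith
    have h1 := hanti h
    simp only [intervalIntegral.integral_same, neg_zero, Real.exp_zero, mul_one] at h1
    have h2 : N x = (N x * Real.exp (-∫ u in y..x, m u)) * Real.exp (∫ u in y..x, m u) := by
      rw [mul_assoc, ← Real.exp_add]; simp
    rw [h2, mul_comm]
    exact mul_le_mul (Real.exp_le_exp.2 (hle _ _)) h1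
      (mul_nonneg (hN0 _) (Real.exp_pos _).le) (Real.exp_pos _).le
  · have hmono : Monotone fun w => N w * Real.exp (∫ u in y..w, m u) := by
      refine monotone_of_hasDerivAt_nonneg (fun z => (hN z).mul ((hM z).exp)) fun z => ?_
      have := (abs_le.1 (hb z)).1
      have he := Real.exp_pos (∫ u in y..z, m u)
      simp only [Pi.zero_apply]
      nlinarith
    have h1 := hmono h
    simp only [intervalIntegral.integral_same, Real.exp_zero, mul_one] at h1
    have h2 : N x = (N x * Real.exp (∫ u in y..x, m u)) * Real.exp (∫ u in x..y, m u) := by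
      rw [mul_assoc, ← Real.exp_add, intervalIntegral.integral_symm x y]; simp
    rw [h2, mul_comm]
    exact mul_le_mul (Real.exp_le_exp.2 (hle _ _)) h1
      (mul_nonneg (hN0 _) (Real.exp_pos _).le) (Real.exp_pos _).le

/-- A column `(a, v)` of a solution of `ψ_x = X ψ` with spectral parameter `k` and potential
`p`. -/
structure IsSol (k : ℝ) (p : ℝ → Vec2) (a : ℝ → ℂ) (v : ℝ → Vec2) : Prop where
  da : ∀ x, HasDerivAt a (Complex.I * k * a x - Complex.I * inner ℂ (p x) (v x)) x
  dv : ∀ x, HasDerivAt v (-(Complex.I * k) • v x + (Complex.I * a x) • p x) x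

/-- The upper component after the change of frame `(1 - R / ζ)`. -/
def upC (ζ : ℝ) (p : ℝ → Vec2) (a : ℝ → ℂ) (v : ℝ → Vec2) (x : ℝ) : ℂ :=
  a x - inner ℂ (p x) (v x) / ζ

/-- The lower component after the change of frame `(1 - R / ζ)`. -/
def loC (ζ : ℝ) (p : ℝ → Vec2) (a : ℝ → ℂ) (v : ℝ → Vec2) (x : ℝ) : Vec2 :=
  v x - (a x / ζ) • p x

theorem kz_add_lamz (q0 ζ : ℝ) : kz q0 ζ + lamz q0 ζ = ζ := by
  unfold kz lamz; ring

theorem kz_eq (q0 ζ : ℝ) : kz q0 ζ = lamz q0 ζ + q0 ^ 2 / ζ := by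
  unfold kz lamz; ring

theorem inner_self_ofReal (v : Vec2) : inner ℂ v v = ((‖v‖ ^ 2 : ℝ) : ℂ) := by
  rw [inner_self_eq_norm_sq_to_K]; norm_cast

/-- The identity k = λ + q₀²/ζ turns the frequency k into λ and replaces the bounded coupling by a
defect that is 1/ζ times q₀² − ‖p‖² and p', both integrable for the potentials considered. -/
theorem hasDerivAt_upC {q0 ζ : ℝ} (hζ : ζ ≠ 0) {p p' : ℝ → Vec2} {a : ℝ → ℂ} {v : ℝ → Vec2}
    (hp : ∀ x, HasDerivAt p (p' x) x) (h : IsSol (kz q0 ζ) p a v) (x : ℝ) :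
    HasDerivAt (upC ζ p a v) (Complex.I * lamz q0 ζ * upC ζ p a v x
      + (1 / ζ) * (Complex.I * (q0 ^ 2 - ‖p x‖ ^ 2 : ℝ) * a x - inner ℂ (p' x) (v x))) x := by
  have h1 := (h.da x).sub (((hp x).inner ℂ (h.dv x)).div_const (ζ : ℂ))
  refine h1.congr_deriv ?_
  simp only [upC, inner_add_right, inner_smul_right, inner_self_ofReal, kz_eq q0 ζ, lamz]
  have : (ζ : ℂ) ≠ 0 := by exact_mod_cast hζ
  push_cast
  field_simp
  ring

/-- The rank-one term is only O(1/ζ) and not integrable in x. It is skew-Hermitian, so it leaves the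
norm alone; near an end it shifts the frequency along p from −k to −λ. -/
theorem hasDerivAt_loC {q0 ζ : ℝ} (hζ : ζ ≠ 0) {p p' : ℝ → Vec2} {a : ℝ → ℂ} {v : ℝ → Vec2}
    (hp : ∀ x, HasDerivAt p (p' x) x) (h : IsSol (kz q0 ζ) p a v) (x : ℝ) :
    HasDerivAt (loC ζ p a v) ((-(Complex.I * kz q0 ζ)) • loC ζ p a v x
      + (Complex.I / ζ * inner ℂ (p x) (loC ζ p a v x)) • p x
      + ((1 / ζ : ℂ) * a x) • ((Complex.I / ζ * (‖p x‖ ^ 2 - q0 ^ 2 : ℝ)) • p x - p' x)) x := by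
  have h1 := (h.dv x).sub (((h.da x).div_const (ζ : ℂ)).smul (hp x))
  refine h1.congr_deriv ?_
  have : (ζ : ℂ) ≠ 0 := by exact_mod_cast hζ
  simp only [loC, inner_sub_right, inner_smul_right, inner_self_ofReal, kz_eq q0 ζ, lamz]
  ext i
  simp only [PiLp.add_apply, PiLp.sub_apply, PiLp.smul_apply, smul_eq_mul]
  push_cast
  field_simp
  ring

end Estimates

/-! ### Uniform bounds from an energy estimate -/

section BoundedSolutions

/-- The oscillating factor `exp (i c x)`. -/
def osc (c x : ℝ) : ℂ := Complex.exp ((c * x : ℝ) * Complex.I)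

@[simp] theorem norm_osc (c x : ℝ) : ‖osc c x‖ = 1 := Complex.norm_exp_ofReal_mul_I _

@[simp] theorem osc_zero (c : ℝ) : osc c 0 = 1 := by simp [osc]

theorem osc_add (c d x : ℝ) : osc (c + d) x = osc c x * osc d x := by
  simp only [osc, ← Complex.exp_add]; congr 1; push_cast; ring

theorem hasDerivAt_osc (c x : ℝ) : HasDerivAt (osc c) (Complex.I * c * osc c x) x := by
  have h : HasDerivAt (fun y : ℝ => ((c * y : ℝ) : ℂ)) ((c : ℝ) : ℂ) x := by
    have := ((hasDerivAt_id x).const_mul c).ofReal_comp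
    simpa using this
  have := (h.mul_const Complex.I).cexp
  refine this.congr_deriv ?_
  simp only [osc]; ring

theorem norm_osc_sub_one_le (c x : ℝ) : ‖osc c x - 1‖ ≤ |c| * |x| := by
  have := Real.norm_exp_I_mul_ofReal_sub_one_le (x := c * x)
  rw [osc, mul_comm, ← abs_mul]; exact this

/-- Global properties of the potential `p`, with derivatives `p₁` and `p₂`. -/
structure Pot (q0 M : ℝ) (p p₁ p₂ : ℝ → Vec2) : Prop where
  hp : ∀ x, HasDerivAt p (p₁ x) x
  hp₁ : ∀ x, HasDerivAt p₁ (p₂ x) x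
  one_le : 1 ≤ M
  q0_pos : 0 < q0
  q0_le : q0 ≤ M
  p_le : ∀ x, ‖p x‖ ≤ M
  p₁_le : ∀ x, ‖p₁ x‖ ≤ M
  int₁ : Integrable p₁
  int₂ : Integrable p₂
  int_sq : Integrable fun x => q0 ^ 2 - ‖p x‖ ^ 2

/-- The weight controlling the coupling of the two blocks. -/
def wt (q0 : ℝ) (p p₁ : ℝ → Vec2) (x : ℝ) : ℝ := |q0 ^ 2 - ‖p x‖ ^ 2| + ‖p₁ x‖

variable {q0 M : ℝ} {p p₁ p₂ : ℝ → Vec2}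

theorem wt_nonneg (x : ℝ) : 0 ≤ wt q0 p p₁ x := by unfold wt; positivity

theorem Pot.wt_continuous (H : Pot q0 M p p₁ p₂) : Continuous (wt q0 p p₁) := by
  have h1 : Continuous p := continuous_iff_continuousAt.2 fun x => (H.hp x).continuousAt
  have h2 : Continuous p₁ := continuous_iff_continuousAt.2 fun x => (H.hp₁ x).continuousAt
  unfold wt; fun_prop

theorem Pot.wt_integrable (H : Pot q0 M p p₁ p₂) : Integrable (wt q0 p p₁) :=
  H.int_sq.norm.add H.int₁.norm

theorem norm_inner_le' (v w : Vec2) : ‖(inner ℂ v w : ℂ)‖ ≤ ‖v‖ * ‖w‖ := norm_inner_le_norm v w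

/-- The frame change differs from the identity by at most 1/2 once |ζ| ≥ 2M, so it can be inverted
with a factor 2. The first bound is the sharper one that makes a small when `upC` is small. -/
theorem norm_le_of_upC_loC {ζ : ℝ} (H : Pot q0 M p p₁ p₂) (hζ : 2 * M ≤ |ζ|) (a : ℝ → ℂ)
    (v : ℝ → Vec2) (x : ℝ) :
    ‖a x‖ ≤ ‖upC ζ p a v x‖ + M * ‖v x‖ / |ζ| ∧
    ‖a x‖ + ‖v x‖ ≤ 2 * (‖upC ζ p a v x‖ + ‖loC ζ p a v x‖) := by
  have hM := H.one_le
  have hz : 0 < |ζ| := by linarith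
  have e1 : a x = upC ζ p a v x + inner ℂ (p x) (v x) / ζ := by simp [upC]
  have e2 : v x = loC ζ p a v x + (a x / ζ) • p x := by simp [loC]
  have n1 : ‖(inner ℂ (p x) (v x) / ζ : ℂ)‖ ≤ M * ‖v x‖ / |ζ| := by
    rw [norm_div, Complex.norm_real, Real.norm_eq_abs]
    gcongr
    exact (norm_inner_le' _ _).trans (by gcongr; exact H.p_le x)
  have n2 : ‖(a x / ζ : ℂ) • p x‖ ≤ M * ‖a x‖ / |ζ| := by
    rw [norm_smul, norm_div, Complex.norm_real, Real.norm_eq_abs, div_mul_eq_mul_div, mul_comm]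
    gcongr
    exact H.p_le x
  have b1 : ‖a x‖ ≤ ‖upC ζ p a v x‖ + M * ‖v x‖ / |ζ| :=
    (congrArg norm e1).le.trans ((norm_add_le _ _).trans (by gcongr))
  have b2 : ‖v x‖ ≤ ‖loC ζ p a v x‖ + M * ‖a x‖ / |ζ| :=
    (congrArg norm e2).le.trans ((norm_add_le _ _).trans (by gcongr))
  refine ⟨b1, ?_⟩
  have c1 : M * ‖v x‖ / |ζ| ≤ ‖v x‖ / 2 := by
    rw [div_le_div_iff₀ hz two_pos]; nlinarith [norm_nonneg (v x)]
  have c2 : M * ‖a x‖ / |ζ| ≤ ‖a x‖ / 2 := by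
    rw [div_le_div_iff₀ hz two_pos]; nlinarith [norm_nonneg (a x)]
  linarith

/-- The coupling terms of the transformed system. -/
theorem norm_upC_coupling_le (a : ℂ) (v : Vec2) (x : ℝ) :
    ‖Complex.I * (q0 ^ 2 - ‖p x‖ ^ 2 : ℝ) * a - inner ℂ (p₁ x) v‖
      ≤ wt q0 p p₁ x * (‖a‖ + ‖v‖) := by
  refine (norm_sub_le _ _).trans ?_
  have h1 : ‖Complex.I * (q0 ^ 2 - ‖p x‖ ^ 2 : ℝ) * a‖ = |q0 ^ 2 - ‖p x‖ ^ 2| * ‖a‖ := by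
    rw [norm_mul, norm_mul, Complex.norm_I, one_mul, Complex.norm_real, Real.norm_eq_abs]
  have h2 := norm_inner_le' (p₁ x) v
  rw [h1, wt]
  nlinarith [norm_nonneg a, norm_nonneg v, norm_nonneg (p₁ x), abs_nonneg (q0 ^ 2 - ‖p x‖ ^ 2)]

theorem norm_loC_coupling_le {ζ : ℝ} (H : Pot q0 M p p₁ p₂) (hζ : 2 * M ≤ |ζ|) (x : ℝ) :
    ‖(Complex.I / ζ * (‖p x‖ ^ 2 - q0 ^ 2 : ℝ)) • p x - p₁ x‖ ≤ wt q0 p p₁ x := by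
  have hM := H.one_le
  have hz : 0 < |ζ| := by linarith
  refine (norm_sub_le _ _).trans ?_
  rw [wt]
  gcongr
  rw [norm_smul, norm_mul, norm_div, Complex.norm_I, Complex.norm_real, Complex.norm_real,
    Real.norm_eq_abs, Real.norm_eq_abs, abs_sub_comm]
  have : 1 / |ζ| * ‖p x‖ ≤ 1 := by
    rw [div_mul_eq_mul_div, one_mul, div_le_one hz]; linarith [H.p_le x]
  calc _ = |q0 ^ 2 - ‖p x‖ ^ 2| * (1 / |ζ| * ‖p x‖) := by ring
    _ ≤ _ := mul_le_of_le_one_right (abs_nonneg _) this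

/-- The squared norm of the transformed column. -/
def energy (ζ : ℝ) (p : ℝ → Vec2) (a : ℝ → ℂ) (v : ℝ → Vec2) (x : ℝ) : ℝ :=
  ‖upC ζ p a v x‖ ^ 2 + ‖loC ζ p a v x‖ ^ 2

/-- The rotations and the rank-one term are skew-Hermitian and drop out of the derivative of the
energy. Only the integrable coupling remains, and Grönwall's inequality gives a factor independent
of ζ. -/
theorem energy_le {ζ : ℝ} (H : Pot q0 M p p₁ p₂) (hζ : 8 * M ≤ |ζ|) {a : ℝ → ℂ} {v : ℝ → Vec2}
    (h : IsSol (kz q0 ζ) p a v) (x y : ℝ) :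
    energy ζ p a v x ≤ Real.exp (∫ u, wt q0 p p₁ u) * energy ζ p a v y := by
  have hM := H.one_le
  have hz : 0 < |ζ| := by linarith
  have hζ0 : ζ ≠ 0 := abs_pos.1 hz
  set A := upC ζ p a v
  set B := loC ζ p a v
  set r₁ : ℝ → ℂ := fun x => Complex.I * (q0 ^ 2 - ‖p x‖ ^ 2 : ℝ) * a x - inner ℂ (p₁ x) (v x)
  set r₂ : ℝ → Vec2 := fun x =>
    a x • ((Complex.I / ζ * (‖p x‖ ^ 2 - q0 ^ 2 : ℝ)) • p x - p₁ x)
  have hd : ∀ x, HasDerivAt (energy ζ p a v)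
      (2 * (1 / ζ * ((star (A x) * r₁ x).re + (inner ℂ (B x) (r₂ x) : ℂ).re))) x := by
    intro x
    have hA := hasDerivAt_upC hζ0 H.hp h x
    have hB := hasDerivAt_loC hζ0 H.hp h x
    have h1 : HasDerivAt (fun y => ‖A y‖ ^ 2) (2 * (1 / ζ * (star (A x) * r₁ x).re)) x := by
      refine hA.norm_sq.congr_deriv ?_
      simp only [A, r₁, Complex.inner, Complex.star_def, Complex.mul_re, Complex.mul_im,
        Complex.add_re, Complex.add_im, Complex.conj_re, Complex.conj_im, Complex.I_re,
        Complex.I_im, Complex.ofReal_re, Complex.ofReal_im]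
      have e : (1 / (ζ : ℂ)) = ((1 / ζ : ℝ) : ℂ) := by push_cast; rfl
      simp only [e, Complex.ofReal_re, Complex.ofReal_im]
      ring
    have h2 : HasDerivAt (fun y => ‖B y‖ ^ 2) (2 * (1 / ζ * (inner ℂ (B x) (r₂ x) : ℂ).re)) x := by
      have e0 : (fun y => ‖B y‖ ^ 2) = fun y => (inner ℂ (B y) (B y) : ℂ).re := by
        funext y; rw [inner_self_ofReal, Complex.ofReal_re]
      have h3 := (Complex.reCLM.hasFDerivAt.comp_hasDerivAt x (hB.inner ℂ hB))
      rw [e0]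
      refine h3.congr_deriv ?_
      simp only [Complex.reCLM_apply]
      set g := inner ℂ (p x) (loC ζ p a v x) with hg
      have hg' : inner ℂ (loC ζ p a v x) (p x) = star g := by
        rw [hg, Complex.star_def, inner_conj_symm]
      have e : ∀ c : Vec2, (inner ℂ c (B x) : ℂ).re = (inner ℂ (B x) c : ℂ).re := fun c => by
        rw [← inner_conj_symm, Complex.conj_re]
      rw [Complex.add_re, e, mul_smul ((1 : ℂ) / ζ)]
      simp only [B, r₂, inner_add_right, inner_smul_right, hg', inner_self_ofReal]
      have e' : (1 / (ζ : ℂ)) = ((1 / ζ : ℝ) : ℂ) := by push_cast; rfl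
      have e'' : (Complex.I / (ζ : ℂ)) = ((1 / ζ : ℝ) : ℂ) * Complex.I := by push_cast; ring
      simp only [e', e'', Complex.star_def, Complex.mul_re, Complex.mul_im,
        Complex.add_re, Complex.conj_re, Complex.conj_im, Complex.I_re,
        Complex.I_im, Complex.ofReal_re, Complex.ofReal_im, Complex.neg_re, Complex.neg_im]
      ring
    refine (h1.add h2).congr_deriv ?_
    ring
  refine le_exp_integral_mul hd (fun x => by unfold energy; positivity) H.wt_continuous
    wt_nonneg H.wt_integrable (fun x => ?_) x y
  have hb := (norm_le_of_upC_loC H (by linarith) a v x).2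
  have n1 : |(star (A x) * r₁ x).re| ≤ ‖A x‖ * (wt q0 p p₁ x * (‖a x‖ + ‖v x‖)) := by
    refine (Complex.abs_re_le_norm _).trans ?_
    rw [norm_mul, norm_star]
    gcongr
    exact norm_upC_coupling_le _ _ _
  have n2 : |(inner ℂ (B x) (r₂ x) : ℂ).re| ≤ ‖B x‖ * (wt q0 p p₁ x * (‖a x‖ + ‖v x‖)) := by
    refine (Complex.abs_re_le_norm _).trans ((norm_inner_le' _ _).trans ?_)
    gcongr
    simp only [r₂, norm_smul]
    have := norm_loC_coupling_le H (by linarith : 2 * M ≤ |ζ|) x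
    have h0 := wt_nonneg (q0 := q0) (p := p) (p₁ := p₁) x
    nlinarith [norm_nonneg (a x), norm_nonneg (v x)]
  rw [abs_mul, abs_mul, abs_div, abs_one, abs_two]
  have h0 := wt_nonneg (q0 := q0) (p := p) (p₁ := p₁) x
  have n3 : |(star (A x) * r₁ x).re + (inner ℂ (B x) (r₂ x) : ℂ).re|
      ≤ wt q0 p p₁ x * (4 * (‖A x‖ ^ 2 + ‖B x‖ ^ 2)) := by
    refine (abs_add_le _ _).trans ((add_le_add n1 n2).trans ?_)
    have : (‖A x‖ + ‖B x‖) * (‖a x‖ + ‖v x‖) ≤ 4 * (‖A x‖ ^ 2 + ‖B x‖ ^ 2) := by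
      have : (‖A x‖ + ‖B x‖) * (‖a x‖ + ‖v x‖) ≤ (‖A x‖ + ‖B x‖) * (2 * (‖A x‖ + ‖B x‖)) := by
        gcongr
      nlinarith [sq_nonneg (‖A x‖ - ‖B x‖)]
    nlinarith
  -- The threshold 8M is chosen for this: with M ≥ 1, the factors 2 · (1/8) · 4 multiply to 1, so
  -- the Grönwall rate is exactly `wt`.
  have n4 : 1 / |ζ| ≤ 1 / 8 := by
    apply one_div_le_one_div_of_le <;> linarith
  have h5 : 0 ≤ wt q0 p p₁ x * (4 * (‖A x‖ ^ 2 + ‖B x‖ ^ 2)) := by positivity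
  calc _ ≤ 2 * (1 / 8 * (wt q0 p p₁ x * (4 * (‖A x‖ ^ 2 + ‖B x‖ ^ 2)))) := by gcongr
    _ = wt q0 p p₁ x * (‖A x‖ ^ 2 + ‖B x‖ ^ 2) := by ring

/-- A solution all of whose components are bounded by `C`. -/
structure BddSol (q0 C ζ : ℝ) (p : ℝ → Vec2) (a : ℝ → ℂ) (v : ℝ → Vec2) : Prop where
  sol : IsSol (kz q0 ζ) p a v
  a_le : ∀ x, ‖a x‖ ≤ C
  v_le : ∀ x, ‖v x‖ ≤ C
  up_le : ∀ x, ‖upC ζ p a v x‖ ≤ C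
  lo_le : ∀ x, ‖loC ζ p a v x‖ ≤ C

/-- Letting the second point of `energy_le` run to the end where the solution is normalised bounds
the energy everywhere by its limit there; C depends on K and the potential but not on ζ. -/
theorem Pot.exists_bddSol (H : Pot q0 M p p₁ p₂) (K : ℝ) :
    ∃ C, 0 < C ∧ ∀ ζ : ℝ, 8 * M ≤ |ζ| → ∀ a v, IsSol (kz q0 ζ) p a v →
      ∀ (l : Filter ℝ) [l.NeBot] (N0 : ℝ), N0 ≤ K → Tendsto (energy ζ p a v) l (𝓝 N0) →
        BddSol q0 C ζ p a v := by
  set E := Real.exp (∫ u, wt q0 p p₁ u)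
  have hE : 0 < E := Real.exp_pos _
  set C := 4 * Real.sqrt (E * |K| + 1)
  have hC : 0 < C := by positivity
  refine ⟨C, hC, fun ζ hζ a v h l _ N0 hN0 hl => ?_⟩
  have hM := H.one_le
  have he : ∀ x, energy ζ p a v x ≤ E * |K| + 1 := by
    intro x
    have h1 : energy ζ p a v x ≤ E * N0 :=
      ge_of_tendsto (hl.const_mul E) (Eventually.of_forall fun y => energy_le H hζ h x y)
    have : E * N0 ≤ E * |K| := by gcongr; exact hN0.trans (le_abs_self K)
    linarith
  have hu : ∀ x, ‖upC ζ p a v x‖ ≤ C / 4 := fun x => by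
    have h2 : ‖upC ζ p a v x‖ ≤ Real.sqrt (E * |K| + 1) := by
      apply Real.le_sqrt_of_sq_le
      have := he x; unfold energy at this
      nlinarith [sq_nonneg ‖loC ζ p a v x‖]
    simp only [C]; linarith
  have hl' : ∀ x, ‖loC ζ p a v x‖ ≤ C / 4 := fun x => by
    have h2 : ‖loC ζ p a v x‖ ≤ Real.sqrt (E * |K| + 1) := by
      apply Real.le_sqrt_of_sq_le
      have := he x; unfold energy at this
      nlinarith [sq_nonneg ‖upC ζ p a v x‖]
    simp only [C]; linarith
  have hs := fun x => (norm_le_of_upC_loC H (by linarith : 2 * M ≤ |ζ|) a v x).2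
  refine ⟨h, fun x => ?_, fun x => ?_, fun x => (hu x).trans (by linarith),
    fun x => (hl' x).trans (by linarith)⟩
  · linarith [hs x, hu x, hl' x, norm_nonneg (v x)]
  · linarith [hs x, hu x, hl' x, norm_nonneg (a x)]

theorem hasDerivAt_osc_mul_upC {ζ : ℝ} (H : Pot q0 M p p₁ p₂) (hζ0 : ζ ≠ 0) {a : ℝ → ℂ}
    {v : ℝ → Vec2} (h : IsSol (kz q0 ζ) p a v) (x : ℝ) :
    HasDerivAt (fun y => osc (-lamz q0 ζ) y * upC ζ p a v y) (osc (-lamz q0 ζ) x * ((1 / ζ)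
      * (Complex.I * (q0 ^ 2 - ‖p x‖ ^ 2 : ℝ) * a x - inner ℂ (p₁ x) (v x)))) x := by
  refine ((hasDerivAt_osc _ x).mul (hasDerivAt_upC hζ0 H.hp h x)).congr_deriv ?_
  push_cast; ring

/-- Once the rotation e^{iλx} is removed, the derivative of the upper component is the coupling
alone, of size `wt`/|ζ|. -/
theorem Pot.norm_osc_mul_upC_sub_le (H : Pot q0 M p p₁ p₂) {C : ℝ} (hC : 0 < C) :
    ∃ C', 0 < C' ∧ ∀ ζ : ℝ, 8 * M ≤ |ζ| → ∀ a v, BddSol q0 C ζ p a v → ∀ x y,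
      ‖osc (-lamz q0 ζ) x * upC ζ p a v x - osc (-lamz q0 ζ) y * upC ζ p a v y‖
        ≤ C' / |ζ| := by
  refine ⟨2 * C * (∫ u, wt q0 p p₁ u) + 1, ?_, fun ζ hζ a v h x y => ?_⟩
  · have : 0 ≤ ∫ u, wt q0 p p₁ u := integral_nonneg wt_nonneg
    positivity
  have hM := H.one_le
  have hz : 0 < |ζ| := by linarith
  have h1 := norm_sub_le_setIntegral (s := Set.univ) Set.ordConnected_univ MeasurableSet.univ
    (m := fun u => wt q0 p p₁ u * (2 * C / |ζ|))
    (hasDerivAt_osc_mul_upC H (abs_pos.1 hz) h.sol)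
    (H.wt_integrable.mul_const _).integrableOn (fun u _ => ?_) (Set.mem_univ x) (Set.mem_univ y)
  · refine h1.trans ?_
    rw [setIntegral_univ, integral_mul_const, le_div_iff₀ hz]
    field_simp
    linarith
  · rw [norm_mul, norm_osc, one_mul, norm_mul, norm_div, norm_one, Complex.norm_real,
      Real.norm_eq_abs]
    have h2 := norm_upC_coupling_le (q0 := q0) (p := p) (p₁ := p₁) (a u) (v u) u
    have h3 : wt q0 p p₁ u * (‖a u‖ + ‖v u‖) ≤ wt q0 p p₁ u * (2 * C) := by
      gcongr
      · exact wt_nonneg u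
      · linarith [h.a_le u, h.v_le u]
    calc _ ≤ 1 / |ζ| * (wt q0 p p₁ u * (2 * C)) := by gcongr; exact h2.trans h3
      _ = _ := by ring

/-- If the upper component vanishes at one end, it is small everywhere. -/
theorem Pot.norm_upper_le (H : Pot q0 M p p₁ p₂) {C : ℝ} (hC : 0 < C) :
    ∃ C', 0 < C' ∧ ∀ ζ : ℝ, 8 * M ≤ |ζ| → ∀ a v, BddSol q0 C ζ p a v →
      ∀ (l : Filter ℝ) [l.NeBot], Tendsto (upC ζ p a v) l (𝓝 0) → ∀ x, ‖a x‖ ≤ C' / |ζ| := by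
  obtain ⟨C', hC', h'⟩ := H.norm_osc_mul_upC_sub_le hC
  refine ⟨C' + M * C, by have := H.one_le; positivity, fun ζ hζ a v h l _ hl x => ?_⟩
  have hM := H.one_le
  have hz : 0 < |ζ| := by linarith
  have hl0 : Tendsto (fun y => osc (-lamz q0 ζ) y * upC ζ p a v y) l (𝓝 0) := by
    rw [tendsto_zero_iff_norm_tendsto_zero] at hl ⊢
    simpa using hl
  have h1 : ‖osc (-lamz q0 ζ) x * upC ζ p a v x - 0‖ ≤ C' / |ζ| :=
    le_of_tendsto ((tendsto_const_nhds.sub hl0).norm)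
      (Eventually.of_forall fun y => h' ζ hζ a v h x y)
  rw [sub_zero, norm_mul, norm_osc, one_mul] at h1
  refine (norm_le_of_upC_loC H (by linarith) a v x).1.trans ?_
  rw [add_div]
  gcongr
  exact h.v_le x

end BoundedSolutions

/-! ### Low solutions: second-order smallness above, asymptotics below -/

section LowSolutions

variable {q0 M : ℝ} {p p₁ p₂ : ℝ → Vec2}

/-- The terms of the equation of the lower component beyond the free evolution. -/
def loRest (q0 ζ : ℝ) (p p₁ : ℝ → Vec2) (a : ℝ → ℂ) (v : ℝ → Vec2) (x : ℝ) : Vec2 :=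
  (Complex.I / ζ * inner ℂ (p x) (loC ζ p a v x)) • p x
      + ((1 / ζ : ℂ) * a x) • ((Complex.I / ζ * (‖p x‖ ^ 2 - q0 ^ 2 : ℝ)) • p x - p₁ x)

theorem norm_loRest_le {ζ C : ℝ} (H : Pot q0 M p p₁ p₂) (hC : 0 < C) (hζ : 8 * M ≤ |ζ|)
    {a : ℝ → ℂ} {v : ℝ → Vec2} (h : BddSol q0 C ζ p a v) (x : ℝ) :
    ‖loRest q0 ζ p p₁ a v x‖ ≤ (M * M * C + C * (q0 ^ 2 + M ^ 2 + M)) / |ζ| := by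
  have hM := H.one_le
  have hz : 0 < |ζ| := by linarith
  unfold loRest
  refine (norm_add_le _ _).trans ?_
  rw [add_div]
  have h1 : ‖(inner ℂ (p x) (loC ζ p a v x) : ℂ)‖ ≤ M * C :=
    (norm_inner_le' _ _).trans (by gcongr; exacts [H.p_le x, h.lo_le x])
  have h2 := norm_loC_coupling_le H (by linarith : 2 * M ≤ |ζ|) x
  have h3 : wt q0 p p₁ x ≤ q0 ^ 2 + M ^ 2 + M := by
    unfold wt
    have h4 : |q0 ^ 2 - ‖p x‖ ^ 2| ≤ q0 ^ 2 + ‖p x‖ ^ 2 := by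
      rw [abs_le]; constructor <;> nlinarith [sq_nonneg q0, sq_nonneg ‖p x‖]
    have h5 : ‖p x‖ ^ 2 ≤ M ^ 2 := by gcongr; exact H.p_le x
    linarith [H.p₁_le x]
  gcongr
  · rw [norm_smul, norm_mul, norm_div, Complex.norm_I, Complex.norm_real, Real.norm_eq_abs]
    calc _ ≤ 1 / |ζ| * (M * C) * M := by gcongr; exact H.p_le x
      _ = _ := by ring
  · rw [norm_smul, norm_mul, norm_div, norm_one, Complex.norm_real, Real.norm_eq_abs]
    calc _ ≤ 1 / |ζ| * C * (q0 ^ 2 + M ^ 2 + M) := by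
          gcongr
          · exact h.a_le x
          · exact h2.trans h3
      _ = _ := by ring

/-- Separates the fast rotation −k, which drives the integration by parts below, from terms of order
1/ζ. -/
theorem hasDerivAt_loC' {ζ : ℝ} (H : Pot q0 M p p₁ p₂) (hζ : ζ ≠ 0) {a : ℝ → ℂ} {v : ℝ → Vec2}
    (h : IsSol (kz q0 ζ) p a v) (x : ℝ) :
    HasDerivAt (loC ζ p a v) ((-(Complex.I * kz q0 ζ)) • loC ζ p a v x
      + loRest q0 ζ p p₁ a v x) x := by
  refine (hasDerivAt_loC hζ H.hp h x).congr_deriv ?_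
  rw [loRest, add_assoc]

/-- The upper component corrected by its leading oscillating part. -/
def upCorr (q0 ζ : ℝ) (p p₁ : ℝ → Vec2) (a : ℝ → ℂ) (v : ℝ → Vec2) (x : ℝ) : ℂ :=
  osc (-lamz q0 ζ) x * (upC ζ p a v x
    + Complex.I / ζ ^ 2 * inner ℂ (p₁ x) (loC ζ p a v x))

/-- Integration by parts in differential form. The first-order term −⟨p₁, loC⟩/ζ carries the phase
e^{-i(λ+k)x} = e^{-iζx}. Differentiating the phase of the correction gives (i/ζ²)(−iζ) = 1/ζ and
cancels it, at the price of one derivative of p₁. -/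
theorem hasDerivAt_upCorr {ζ : ℝ} (H : Pot q0 M p p₁ p₂) (hζ : ζ ≠ 0) {a : ℝ → ℂ}
    {v : ℝ → Vec2} (h : IsSol (kz q0 ζ) p a v) (x : ℝ) :
    HasDerivAt (upCorr q0 ζ p p₁ a v) (osc (-lamz q0 ζ) x *
      (Complex.I / ζ * (q0 ^ 2 - ‖p x‖ ^ 2 : ℝ) * a x - a x / ζ ^ 2 * inner ℂ (p₁ x) (p x)
        + Complex.I / ζ ^ 2 * (inner ℂ (p₂ x) (loC ζ p a v x)
          + inner ℂ (p₁ x) (loRest q0 ζ p p₁ a v x)))) x := by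
  have hz : (ζ : ℂ) ≠ 0 := by exact_mod_cast hζ
  have h1 := (hasDerivAt_osc (-lamz q0 ζ) x).mul ((hasDerivAt_upC hζ H.hp h x).add
    (((H.hp₁ x).inner ℂ (hasDerivAt_loC' H hζ h x)).const_mul (Complex.I / ζ ^ 2)))
  refine h1.congr_deriv ?_
  have e : inner ℂ (p₁ x) (v x)
      = inner ℂ (p₁ x) (loC ζ p a v x) + a x / ζ * inner ℂ (p₁ x) (p x) := by
    rw [← inner_smul_right, ← inner_add_right]; congr 1; simp [loC]
  rw [e]
  simp only [inner_add_right, inner_smul_right, Pi.add_apply]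
  have hk : (kz q0 ζ : ℂ) = ζ - lamz q0 ζ := by
    rw [← Complex.ofReal_sub]; congr 1; linarith [kz_add_lamz q0 ζ]
  rw [hk]
  push_cast
  field_simp
  ring_nf
  simp only [Complex.I_sq]
  ring

/-- A solution whose upper component is of lower order. -/
structure LowSol (q0 C ζ : ℝ) (p : ℝ → Vec2) (a : ℝ → ℂ) (v : ℝ → Vec2) : Prop
    extends BddSol q0 C ζ p a v where
  a_le' : ∀ x, ‖a x‖ ≤ C / |ζ|

theorem BddSol.mono {C C' ζ : ℝ} (hC : C ≤ C') {a : ℝ → ℂ} {v : ℝ → Vec2}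
    (h : BddSol q0 C ζ p a v) : BddSol q0 C' ζ p a v :=
  ⟨h.sol, fun x => (h.a_le x).trans hC, fun x => (h.v_le x).trans hC,
    fun x => (h.up_le x).trans hC, fun x => (h.lo_le x).trans hC⟩

theorem Pot.exists_lowSol (H : Pot q0 M p p₁ p₂) (K : ℝ) :
    ∃ C, 0 < C ∧ ∀ ζ : ℝ, 8 * M ≤ |ζ| → ∀ a v, IsSol (kz q0 ζ) p a v →
      ∀ (l : Filter ℝ) [l.NeBot] (N0 : ℝ), N0 ≤ K → Tendsto (energy ζ p a v) l (𝓝 N0) →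
        Tendsto (upC ζ p a v) l (𝓝 0) → LowSol q0 C ζ p a v := by
  obtain ⟨C, hC, h⟩ := H.exists_bddSol K
  obtain ⟨C', hC', h'⟩ := H.norm_upper_le hC
  refine ⟨max C C', lt_max_of_lt_left hC, fun ζ hζ a v hs l _ N0 hN hE hu => ?_⟩
  have hb := h ζ hζ a v hs l N0 hN hE
  refine ⟨hb.mono (le_max_left _ _), fun x => (h' ζ hζ a v hb l hu x).trans ?_⟩
  gcongr
  exact le_max_right _ _

/-- The coupling of a low solution into the upper component is of second order. -/
theorem Pot.norm_limit_upper_le (H : Pot q0 M p p₁ p₂) {C : ℝ} (hC : 0 < C) :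
    ∃ C', 0 < C' ∧ ∀ ζ : ℝ, 8 * M ≤ |ζ| → ∀ a v, LowSol q0 C ζ p a v →
      ∀ (l l' : Filter ℝ) [l.NeBot] [l'.NeBot], Tendsto p₁ l (𝓝 0) → Tendsto p₁ l' (𝓝 0) →
      Tendsto (upC ζ p a v) l (𝓝 0) → ∀ A : ℂ,
      Tendsto (fun x => osc (-lamz q0 ζ) x * upC ζ p a v x) l' (𝓝 A) → ‖A‖ ≤ C' / |ζ| ^ 2 := by
  set D := M * M * C + C * (q0 ^ 2 + M ^ 2 + M)
  have hM := H.one_le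
  have hD : 0 < D := by positivity
  set m : ℝ → ℝ := fun u => C * wt q0 p p₁ u + C * M * ‖p₁ u‖ + C * ‖p₂ u‖ + D * ‖p₁ u‖
  have hm : Integrable m :=
    (((H.wt_integrable.const_mul C).add (H.int₁.norm.const_mul _)).add
      (H.int₂.norm.const_mul _)).add (H.int₁.norm.const_mul _)
  have hm0 : 0 ≤ ∫ u, m u := integral_nonneg fun u => by
    have := wt_nonneg (q0 := q0) (p := p) (p₁ := p₁) u
    simp only [m, Pi.zero_apply]; positivity
  refine ⟨(∫ u, m u) + 1, by positivity, fun ζ hζ a v h l l' _ _ hp hp' hl A hA => ?_⟩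
  have hz : 0 < |ζ| := by linarith
  have hz1 : 1 ≤ |ζ| := by linarith
  -- The correction vanishes at both ends with p₁, so `upCorr` and the rotated `upC` have the same
  -- limits.
  have hcorr : ∀ f : Filter ℝ, Tendsto p₁ f (𝓝 0) → Tendsto (fun x => osc (-lamz q0 ζ) x *
      (Complex.I / ζ ^ 2 * inner ℂ (p₁ x) (loC ζ p a v x))) f (𝓝 0) := by
    intro f hf
    rw [tendsto_zero_iff_norm_tendsto_zero] at hf ⊢
    refine squeeze_zero (fun _ => norm_nonneg _) (fun x => ?_)
      (by simpa using hf.const_mul (‖Complex.I / ζ ^ 2‖ * C))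
    rw [norm_mul, norm_osc, one_mul, norm_mul, mul_assoc]
    gcongr
    rw [mul_comm]
    exact (norm_inner_le' _ _).trans (by gcongr; exact h.lo_le x)
  have hl0 : Tendsto (fun y => osc (-lamz q0 ζ) y * upC ζ p a v y) l (𝓝 0) := by
    rw [tendsto_zero_iff_norm_tendsto_zero] at hl ⊢
    simpa using hl
  have t1 : Tendsto (upCorr q0 ζ p p₁ a v) l (𝓝 0) := by
    have := hl0.add (hcorr l hp)
    rw [add_zero] at this
    exact this.congr fun x => by rw [upCorr, mul_add]
  have t2 : Tendsto (upCorr q0 ζ p p₁ a v) l' (𝓝 A) := by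
    have := hA.add (hcorr l' hp')
    rw [add_zero] at this
    exact this.congr fun x => by rw [upCorr, mul_add]
  have key : ∀ x, ‖upCorr q0 ζ p p₁ a v x - 0‖ ≤ ∫ u in Set.univ, m u * (1 / |ζ| ^ 2) := fun x =>
    norm_sub_le_setIntegral_of_tendsto Set.ordConnected_univ MeasurableSet.univ
      (hasDerivAt_upCorr H (abs_pos.1 hz) h.sol) (hm.mul_const _).integrableOn
      (fun u _ => ?_) univ_mem t1 (Set.mem_univ x)
  · have h3 : ‖A - 0‖ ≤ ∫ u in Set.univ, m u * (1 / |ζ| ^ 2) :=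
      le_of_tendsto ((t2.sub tendsto_const_nhds).norm) (Eventually.of_forall key)
    rw [sub_zero, setIntegral_univ, integral_mul_const] at h3
    refine h3.trans ?_
    rw [mul_one_div]
    gcongr
    linarith
  · rw [norm_mul, norm_osc, one_mul]
    -- The only term with a single explicit factor 1/ζ; the second factor comes from a = O(1/ζ) for
    -- a low solution.
    have e1 : ‖Complex.I / ζ * (q0 ^ 2 - ‖p u‖ ^ 2 : ℝ) * a u‖
        ≤ C * wt q0 p p₁ u * (1 / |ζ| ^ 2) := by
      rw [norm_mul, norm_mul, norm_div, Complex.norm_I, Complex.norm_real, Complex.norm_real,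
        Real.norm_eq_abs, Real.norm_eq_abs]
      calc _ ≤ 1 / |ζ| * wt q0 p p₁ u * (C / |ζ|) := by
            gcongr
            · exact mul_nonneg (by positivity) (wt_nonneg u)
            · exact le_add_of_nonneg_right (norm_nonneg (p₁ u))
            · exact h.a_le' u
        _ = _ := by field_simp
    have e2 : ‖a u / ζ ^ 2 * inner ℂ (p₁ u) (p u)‖ ≤ C * M * ‖p₁ u‖ * (1 / |ζ| ^ 2) := by
      rw [norm_mul, norm_div, norm_pow, Complex.norm_real, Real.norm_eq_abs]
      calc _ ≤ C / |ζ| ^ 2 * (‖p₁ u‖ * M) := by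
            gcongr
            · exact h.a_le u
            · exact (norm_inner_le' _ _).trans (by gcongr; exact H.p_le u)
        _ = _ := by ring
    have e3 : ‖Complex.I / ζ ^ 2 * (inner ℂ (p₂ u) (loC ζ p a v u)
          + inner ℂ (p₁ u) (loRest q0 ζ p p₁ a v u))‖
        ≤ (C * ‖p₂ u‖ + D * ‖p₁ u‖) * (1 / |ζ| ^ 2) := by
      rw [norm_mul, norm_div, norm_pow, Complex.norm_I, Complex.norm_real, Real.norm_eq_abs,
        mul_comm]
      gcongr
      refine (norm_add_le _ _).trans (add_le_add ?_ ?_)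
      · rw [mul_comm C]
        exact (norm_inner_le' _ _).trans (by gcongr; exact h.lo_le u)
      · rw [mul_comm D]
        refine (norm_inner_le' _ _).trans ?_
        gcongr
        exact (norm_loRest_le H hC hζ h.toBddSol u).trans (div_le_self hD.le hz1)
    calc _ ≤ C * wt q0 p p₁ u * (1 / |ζ| ^ 2) + C * M * ‖p₁ u‖ * (1 / |ζ| ^ 2)
        + (C * ‖p₂ u‖ + D * ‖p₁ u‖) * (1 / |ζ| ^ 2) :=
          (norm_add_le _ _).trans (add_le_add ((norm_sub_le _ _).trans (add_le_add e1 e2)) e3)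
      _ = _ := by simp only [m]; ring

/-- The behaviour of the potential at an end `l` of the half-line `s`. -/
structure PotEnd (q0 : ℝ) (p p₁ : ℝ → Vec2) (s : Set ℝ) (l : Filter ℝ) (b : Vec2) : Prop where
  oc : s.OrdConnected
  ms : MeasurableSet s
  zero_mem : (0 : ℝ) ∈ s
  mem : s ∈ l
  neBot : l.NeBot
  lim : Tendsto p l (𝓝 b)
  lim₁ : Tendsto p₁ l (𝓝 0)
  int : IntegrableOn (fun x => p x - b) s
  norm_b : ‖b‖ = q0

variable {s : Set ℝ} {l : Filter ℝ} {b : Vec2}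

/-- The coupling part of `loRest` tested against a vector. -/
theorem norm_inner_coupling_le {ζ C : ℝ} (H : Pot q0 M p p₁ p₂) (hζ : 8 * M ≤ |ζ|)
    {a : ℝ → ℂ} {v : ℝ → Vec2} (h : LowSol q0 C ζ p a v) (e : Vec2) (x : ℝ) :
    ‖(1 / ζ : ℂ) * a x * inner ℂ e ((Complex.I / ζ * (‖p x‖ ^ 2 - q0 ^ 2 : ℝ)) • p x - p₁ x)‖
      ≤ C * ‖e‖ * wt q0 p p₁ x / |ζ| ^ 2 := by
  have hM := H.one_le
  have hz : 0 < |ζ| := by linarith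
  rw [norm_mul, norm_mul, norm_div, norm_one, Complex.norm_real, Real.norm_eq_abs]
  calc _ ≤ 1 / |ζ| * (C / |ζ|) * (‖e‖ * wt q0 p p₁ x) := by
        gcongr
        · have := (norm_nonneg _).trans (h.a_le' x)
          positivity
        · exact h.a_le' x
        · exact (norm_inner_le' _ _).trans
            (by gcongr; exact norm_loC_coupling_le H (by linarith : 2 * M ≤ |ζ|) x)
    _ = _ := by field_simp

/-- The frequency c is left free: c = λ suits the component along the boundary vector, c = k the
orthogonal ones. -/
theorem hasDerivAt_osc_inner {ζ : ℝ} (H : Pot q0 M p p₁ p₂) (hζ : ζ ≠ 0) {a : ℝ → ℂ}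
    {v : ℝ → Vec2} (h : IsSol (kz q0 ζ) p a v) (c : ℝ) (e : Vec2) (x : ℝ) :
    HasDerivAt (fun y => osc c y * inner ℂ e (loC ζ p a v y))
      (osc c x * (Complex.I * (c - kz q0 ζ : ℝ) * inner ℂ e (loC ζ p a v x)
        + Complex.I / ζ * inner ℂ (p x) (loC ζ p a v x) * inner ℂ e (p x)
        + (1 / ζ : ℂ) * a x
          * inner ℂ e ((Complex.I / ζ * (‖p x‖ ^ 2 - q0 ^ 2 : ℝ)) • p x - p₁ x))) x := by
  have h1 := (hasDerivAt_osc c x).mul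
    ((hasDerivAt_const x e).inner ℂ (hasDerivAt_loC' H hζ h x))
  refine h1.congr_deriv ?_
  rw [loRest]
  simp only [inner_add_right, inner_smul_right, inner_zero_left]
  push_cast
  ring

/-- With p replaced by b, the rank-one term contributes (i/ζ)q₀² = i(k − λ) along b, exactly what
the phase e^{iλx} leaves over. The remainder is controlled by ‖p − b‖/|ζ|, integrable on the
half-line. -/
theorem Pot.norm_inner_lower_sub_le (H : Pot q0 M p p₁ p₂) (E : PotEnd q0 p p₁ s l b) {C : ℝ}
    (hC : 0 < C) :
    ∃ C', 0 < C' ∧ ∀ ζ : ℝ, 8 * M ≤ |ζ| → ∀ a v, LowSol q0 C ζ p a v → ∀ A : ℂ,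
      Tendsto (fun x => osc (lamz q0 ζ) x * inner ℂ b (loC ζ p a v x)) l (𝓝 A) → ∀ x ∈ s,
      ‖osc (lamz q0 ζ) x * inner ℂ b (loC ζ p a v x) - A‖ ≤ C' / |ζ| := by
  have hM := H.one_le
  have hq := H.q0_pos
  set m : ℝ → ℝ := fun u => (q0 * M * C + q0 ^ 2 * C) * ‖p u - b‖ + C * q0 * wt q0 p p₁ u
  have hm : IntegrableOn m s :=
    (E.int.norm.const_mul _).add (H.wt_integrable.integrableOn.const_mul _)
  have hm0 : 0 ≤ ∫ u in s, m u := integral_nonneg fun u => by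
    have := wt_nonneg (q0 := q0) (p := p) (p₁ := p₁) u
    simp only [m, Pi.zero_apply]; positivity
  refine ⟨(∫ u in s, m u) + 1, by positivity, fun ζ hζ a v h A hA x hx => ?_⟩
  have hz : 0 < |ζ| := by linarith
  have hz1 : 1 ≤ |ζ| := by linarith
  have := E.neBot
  have key := norm_sub_le_setIntegral_of_tendsto E.oc E.ms
      (hasDerivAt_osc_inner H (abs_pos.1 hz) h.sol (lamz q0 ζ) b) (hm.mul_const (1 / |ζ|))
      (fun u _ => ?_) E.mem hA hx
  · rw [integral_mul_const, mul_one_div] at key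
    refine key.trans ?_
    gcongr
    linarith
  · have e0 : inner ℂ b (p u) = inner ℂ b (p u - b) + q0 ^ 2 := by
      rw [inner_sub_right, inner_self_ofReal, E.norm_b]; push_cast; ring
    have e1 : inner ℂ (p u) (loC ζ p a v u)
        = inner ℂ (p u - b) (loC ζ p a v u) + inner ℂ b (loC ζ p a v u) := by
      rw [inner_sub_left]; ring
    have hζ0 : (ζ : ℂ) ≠ 0 := by exact_mod_cast abs_pos.1 hz
    have e2 : Complex.I * (lamz q0 ζ - kz q0 ζ : ℝ) * inner ℂ b (loC ζ p a v u)
        + Complex.I / ζ * inner ℂ (p u) (loC ζ p a v u) * inner ℂ b (p u)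
        = Complex.I / ζ * (inner ℂ (p u) (loC ζ p a v u) * inner ℂ b (p u - b)
          + q0 ^ 2 * inner ℂ (p u - b) (loC ζ p a v u)) := by
      rw [e0, e1, kz_eq]; push_cast; field_simp; ring
    rw [norm_mul, norm_osc, one_mul, e2]
    refine (norm_add_le _ _).trans ?_
    have n1 := norm_inner_coupling_le H hζ h b u
    rw [E.norm_b] at n1
    have n2 : ‖inner ℂ (p u) (loC ζ p a v u) * inner ℂ b (p u - b)
        + (q0 : ℂ) ^ 2 * inner ℂ (p u - b) (loC ζ p a v u)‖
        ≤ (q0 * M * C + q0 ^ 2 * C) * ‖p u - b‖ := by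
      refine (norm_add_le _ _).trans ?_
      rw [norm_mul, norm_mul, norm_pow, Complex.norm_real, Real.norm_eq_abs, sq_abs]
      calc _ ≤ (M * C) * (q0 * ‖p u - b‖) + q0 ^ 2 * (‖p u - b‖ * C) := by
            gcongr
            · exact (norm_inner_le' _ _).trans (by gcongr; exacts [H.p_le u, h.lo_le u])
            · exact (norm_inner_le' _ _).trans (by rw [E.norm_b])
            · exact (norm_inner_le' _ _).trans (by gcongr; exact h.lo_le u)
        _ = _ := by ring
    have n3 : C * q0 * wt q0 p p₁ u / |ζ| ^ 2 ≤ C * q0 * wt q0 p p₁ u / |ζ| := by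
      have := wt_nonneg (q0 := q0) (p := p) (p₁ := p₁) u
      gcongr
      nlinarith
    rw [norm_mul, norm_div, Complex.norm_I, Complex.norm_real, Real.norm_eq_abs]
    calc _ ≤ 1 / |ζ| * ((q0 * M * C + q0 ^ 2 * C) * ‖p u - b‖) + C * q0 * wt q0 p p₁ u / |ζ| := by
          gcongr
          exact n1.trans n3
      _ = _ := by simp only [m]; ring

/-- For e orthogonal to b, ⟨e,p⟩ = ⟨e,p − b⟩ is integrable, so the rank-one term acts only as a
perturbation and the frequency stays −k. -/
theorem Pot.norm_inner_perp_sub_le (H : Pot q0 M p p₁ p₂) (E : PotEnd q0 p p₁ s l b)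
    {e : Vec2} (he : inner ℂ e b = 0) {C : ℝ} (hC : 0 < C) :
    ∃ C', 0 < C' ∧ ∀ ζ : ℝ, 8 * M ≤ |ζ| → ∀ a v, LowSol q0 C ζ p a v → ∀ A : ℂ,
      Tendsto (fun x => osc (kz q0 ζ) x * inner ℂ e (loC ζ p a v x)) l (𝓝 A) → ∀ x ∈ s,
      ‖osc (kz q0 ζ) x * inner ℂ e (loC ζ p a v x) - A‖ ≤ C' / |ζ| := by
  have hM := H.one_le
  have hq := H.q0_pos
  set m : ℝ → ℝ := fun u => M * C * ‖e‖ * ‖p u - b‖ + C * ‖e‖ * wt q0 p p₁ u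
  have hm : IntegrableOn m s :=
    (E.int.norm.const_mul _).add (H.wt_integrable.integrableOn.const_mul _)
  have hm0 : 0 ≤ ∫ u in s, m u := integral_nonneg fun u => by
    have := wt_nonneg (q0 := q0) (p := p) (p₁ := p₁) u
    simp only [m, Pi.zero_apply]; positivity
  refine ⟨(∫ u in s, m u) + 1, by positivity, fun ζ hζ a v h A hA x hx => ?_⟩
  have hz : 0 < |ζ| := by linarith
  have hz1 : 1 ≤ |ζ| := by linarith
  have := E.neBot
  have key := norm_sub_le_setIntegral_of_tendsto E.oc E.ms
      (hasDerivAt_osc_inner H (abs_pos.1 hz) h.sol (kz q0 ζ) e) (hm.mul_const (1 / |ζ|))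
      (fun u _ => ?_) E.mem hA hx
  · rw [integral_mul_const, mul_one_div] at key
    refine key.trans ?_
    gcongr
    linarith
  · have e0 : inner ℂ e (p u) = inner ℂ e (p u - b) := by rw [inner_sub_right, he, sub_zero]
    rw [norm_mul, norm_osc, one_mul, sub_self, Complex.ofReal_zero, mul_zero, zero_mul, zero_add,
      e0]
    refine (norm_add_le _ _).trans ?_
    have n1 := norm_inner_coupling_le H hζ h e u
    have n3 : C * ‖e‖ * wt q0 p p₁ u / |ζ| ^ 2 ≤ C * ‖e‖ * wt q0 p p₁ u / |ζ| := by
      have := wt_nonneg (q0 := q0) (p := p) (p₁ := p₁) u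
      gcongr
      nlinarith
    rw [norm_mul, norm_mul, norm_div, Complex.norm_I, Complex.norm_real, Real.norm_eq_abs]
    calc _ ≤ 1 / |ζ| * (M * C) * (‖e‖ * ‖p u - b‖) + C * ‖e‖ * wt q0 p p₁ u / |ζ| := by
          gcongr
          · exact (norm_inner_le' _ _).trans (by gcongr; exacts [H.p_le u, h.lo_le u])
          · exact norm_inner_le' _ _
          · exact n1.trans n3
      _ = _ := by simp only [m]; ring

/-- The component along e vanishes to leading order, and this is its first correction. Its rotated
derivative is (i/ζ)⟨e,p⟩⟨p, e^{ikx}loC⟩ up to second order. Replacing e^{iλx}loC by b costs O(1/ζ),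
and replacing e^{i(k−λ)x} by 1 costs O(|x|/ζ). The factor |x| is what the weighted integrability
absorbs. -/
theorem Pot.norm_inner_orthogonal_le (H : Pot q0 M p p₁ p₂) (E : PotEnd q0 p p₁ s l b)
    (hw : IntegrableOn (fun x : ℝ => (1 + |x|) • (p x - b)) s)
    {e : Vec2} (he : inner ℂ e b = 0) {C : ℝ} (hC : 0 < C) :
    ∃ C', 0 < C' ∧ ∀ ζ : ℝ, 8 * M ≤ |ζ| → ∀ a v, LowSol q0 C ζ p a v →
      Tendsto (fun x => osc (lamz q0 ζ) x • loC ζ p a v x) l (𝓝 b) →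
      (∀ x ∈ s, ‖osc (lamz q0 ζ) x • loC ζ p a v x - b‖ ≤ C / |ζ|) → ∀ g : ℂ,
      Tendsto (fun x => ∫ u in (0 : ℝ)..x, inner ℂ e (p u) * inner ℂ (p u) b) l (𝓝 g) →
      ‖inner ℂ e (loC ζ p a v 0) + Complex.I / ζ * g‖ ≤ C' / |ζ| ^ 2 := by
  have hM := H.one_le
  have hq := H.q0_pos
  set m : ℝ → ℝ := fun u => (‖e‖ * M * C + ‖e‖ * M * q0 ^ 3) * ‖(1 + |u|) • (p u - b)‖
    + C * ‖e‖ * wt q0 p p₁ u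
  have hm : IntegrableOn m s :=
    (hw.norm.const_mul _).add (H.wt_integrable.integrableOn.const_mul _)
  have hm0 : 0 ≤ ∫ u in s, m u := integral_nonneg fun u => by
    have := wt_nonneg (q0 := q0) (p := p) (p₁ := p₁) u
    simp only [m, Pi.zero_apply]; positivity
  refine ⟨(∫ u in s, m u) + 1, by positivity, fun ζ hζ a v h hlim hcl g hg => ?_⟩
  have hz : 0 < |ζ| := by linarith
  have hz1 : 1 ≤ |ζ| := by linarith
  have := E.neBot
  have hpc : Continuous p := continuous_iff_continuousAt.2 fun x => (H.hp x).continuousAt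
  have hG : ∀ x, HasDerivAt (fun x => ∫ u in (0 : ℝ)..x, inner ℂ e (p u) * inner ℂ (p u) b)
      (inner ℂ e (p x) * inner ℂ (p x) b) x := fun x => by
    have hc : Continuous fun u => (inner ℂ e (p u) * inner ℂ (p u) b : ℂ) := by fun_prop
    exact intervalIntegral.integral_hasDerivAt_right (hc.intervalIntegrable _ _)
      (hc.stronglyMeasurableAtFilter _ _) hc.continuousAt
  have hF := fun x => (hasDerivAt_osc_inner H (abs_pos.1 hz) h.sol (kz q0 ζ) e x).sub
    ((hG x).const_mul (Complex.I / ζ))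
  have hosc : ∀ x, osc (kz q0 ζ) x = osc (q0 ^ 2 / ζ) x * osc (lamz q0 ζ) x := fun x => by
    rw [kz_eq, add_comm, osc_add]
  have t0 : Tendsto (fun x => osc (kz q0 ζ) x * inner ℂ e (loC ζ p a v x)) l (𝓝 0) := by
    have h1 : Tendsto (fun x => (inner ℂ e (osc (lamz q0 ζ) x • loC ζ p a v x) : ℂ)) l
        (𝓝 (inner ℂ e b)) := tendsto_const_nhds.inner hlim
    rw [he, tendsto_zero_iff_norm_tendsto_zero] at h1
    rw [tendsto_zero_iff_norm_tendsto_zero]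
    refine h1.congr fun x => ?_
    rw [inner_smul_right, norm_mul, norm_mul, norm_osc, norm_osc]
  have tF := t0.sub (hg.const_mul (Complex.I / ζ))
  have key := norm_sub_le_setIntegral_of_tendsto E.oc E.ms hF (hm.mul_const (1 / |ζ| ^ 2))
      (fun u hu => ?_) E.mem tF E.zero_mem
  · rw [integral_mul_const, mul_one_div] at key
    simp only [Pi.sub_apply, osc_zero, one_mul, intervalIntegral.integral_same, mul_zero, sub_zero,
      zero_sub, sub_neg_eq_add] at key
    refine key.trans ?_
    gcongr
    linarith
  · have e0 : inner ℂ e (p u) = inner ℂ e (p u - b) := by rw [inner_sub_right, he, sub_zero]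
    have e1 : osc (kz q0 ζ) u * (Complex.I * (kz q0 ζ - kz q0 ζ : ℝ) * inner ℂ e (loC ζ p a v u)
        + Complex.I / ζ * inner ℂ (p u) (loC ζ p a v u) * inner ℂ e (p u)
        + (1 / ζ : ℂ) * a u
          * inner ℂ e ((Complex.I / ζ * (‖p u‖ ^ 2 - q0 ^ 2 : ℝ)) • p u - p₁ u))
        - Complex.I / ζ * (inner ℂ e (p u) * inner ℂ (p u) b)
        = Complex.I / ζ * inner ℂ e (p u - b)
          * (osc (q0 ^ 2 / ζ) u * inner ℂ (p u) (osc (lamz q0 ζ) u • loC ζ p a v u - b)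
            + (osc (q0 ^ 2 / ζ) u - 1) * inner ℂ (p u) b)
          + osc (kz q0 ζ) u * ((1 / ζ : ℂ) * a u
          * inner ℂ e ((Complex.I / ζ * (‖p u‖ ^ 2 - q0 ^ 2 : ℝ)) • p u - p₁ u)) := by
      rw [e0, hosc, inner_sub_right (p u), inner_smul_right]
      simp only [sub_self, Complex.ofReal_zero]
      ring
    rw [e1]
    refine (norm_add_le _ _).trans ?_
    rw [norm_mul (osc (kz q0 ζ) u), norm_osc, one_mul]
    have n1 := norm_inner_coupling_le H hζ h e u
    have n2 : ‖osc (q0 ^ 2 / ζ) u * inner ℂ (p u) (osc (lamz q0 ζ) u • loC ζ p a v u - b)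
            + (osc (q0 ^ 2 / ζ) u - 1) * inner ℂ (p u) b‖
        ≤ (M * C + M * q0 ^ 3) * (1 + |u|) / |ζ| := by
      refine (norm_add_le _ _).trans ?_
      rw [norm_mul, norm_osc, one_mul, norm_mul]
      have i1 : ‖(inner ℂ (p u) (osc (lamz q0 ζ) u • loC ζ p a v u - b) : ℂ)‖ ≤ M * (C / |ζ|) :=
        (norm_inner_le' _ _).trans (by gcongr; exacts [H.p_le u, hcl u hu])
      have i2 : ‖(inner ℂ (p u) b : ℂ)‖ ≤ M * q0 :=
        (norm_inner_le' _ _).trans (by rw [E.norm_b]; gcongr; exact H.p_le u)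
      have i3 := norm_osc_sub_one_le (q0 ^ 2 / ζ) u
      rw [abs_div, abs_of_nonneg (sq_nonneg q0)] at i3
      calc _ ≤ M * (C / |ζ|) + q0 ^ 2 / |ζ| * |u| * (M * q0) := by gcongr
        _ = (M * C + M * q0 ^ 3 * |u|) / |ζ| := by ring
        _ ≤ _ := by
          gcongr
          have : 0 ≤ M * C * |u| := by positivity
          have : 0 ≤ M * q0 ^ 3 := by positivity
          nlinarith
    rw [norm_mul, norm_mul, norm_div, Complex.norm_I, Complex.norm_real, Real.norm_eq_abs]
    calc _ ≤ 1 / |ζ| * (‖e‖ * ‖p u - b‖) * ((M * C + M * q0 ^ 3) * (1 + |u|) / |ζ|)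
          + C * ‖e‖ * wt q0 p p₁ u / |ζ| ^ 2 := by
          gcongr
          exact norm_inner_le' _ _
      _ = _ := by
        simp only [m]
        rw [norm_smul, Real.norm_eq_abs, abs_of_nonneg (by positivity : 0 ≤ 1 + |u|)]
        field_simp

end LowSolutions

/-! ### Solutions with prescribed value at infinity -/

section LinearODE

section TailIntegral

variable {V : Type*} [NormedAddCommGroup V] [NormedSpace ℝ V] {g : ℝ → V}

theorem setIntegral_Ioi_eq (hi : ∀ a, IntegrableOn g (Set.Ioi a)) (x : ℝ) :
    ∫ u in Set.Ioi x, g u = (∫ u in Set.Ioi 0, g u) - ∫ u in (0 : ℝ)..x, g u := by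
  rw [← intervalIntegral.integral_Ioi_sub_Ioi' (hi 0) (hi x)]; abel

theorem hasDerivAt_setIntegral_Ioi [CompleteSpace V] (hg : Continuous g)
    (hi : ∀ a, IntegrableOn g (Set.Ioi a)) (x : ℝ) :
    HasDerivAt (fun x => ∫ u in Set.Ioi x, g u) (-g x) x := by
  have h := (intervalIntegral.integral_hasDerivAt_right (hg.intervalIntegrable 0 x)
    (hg.stronglyMeasurableAtFilter _ _) hg.continuousAt).const_sub (∫ u in Set.Ioi 0, g u)
  exact h.congr_of_eventuallyEq (Eventually.of_forall fun y => setIntegral_Ioi_eq hi y)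

theorem tendsto_setIntegral_Ioi (hi : ∀ a, IntegrableOn g (Set.Ioi a)) :
    Tendsto (fun x => ∫ u in Set.Ioi x, g u) atTop (𝓝 0) := by
  have h := (tendsto_const_nhds (x := ∫ u in Set.Ioi 0, g u)).sub
    (intervalIntegral_tendsto_integral_Ioi 0 (hi 0) tendsto_id)
  rw [sub_self] at h
  exact h.congr fun y => (setIntegral_Ioi_eq hi y).symm

end TailIntegral

/-- Solutions of a linearly bounded Lipschitz equation with integrable Lipschitz constant can be
prescribed at `+∞`. -/
theorem exists_solution_tendsto_atTop {V : Type*} [NormedAddCommGroup V] [NormedSpace ℝ V]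
    [CompleteSpace V] {F : ℝ → V → V} {m : ℝ → ℝ} (hF : Continuous fun z : ℝ × V => F z.1 z.2)
    (hF0 : ∀ x, F x 0 = 0) (hlip : ∀ x v w, ‖F x v - F x w‖ ≤ m x * ‖v - w‖)
    (hm : Continuous m) (hm0 : ∀ x, 0 ≤ m x) (hmi : ∀ a, IntegrableOn m (Set.Ioi a)) (v0 : V) :
    ∃ μ : ℝ → V, (∀ x, HasDerivAt μ (F x (μ x)) x) ∧ Tendsto μ atTop (𝓝 v0) := by
  set b : ℝ → ℝ := fun x => ∫ u in Set.Ioi x, m u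
  have hb : ∀ x, HasDerivAt b (-m x) x := hasDerivAt_setIntegral_Ioi hm hmi
  have hbc : Continuous b := continuous_iff_continuousAt.2 fun x => (hb x).continuousAt
  have hbt : Tendsto b atTop (𝓝 0) := tendsto_setIntegral_Ioi hmi
  have hb0 : ∀ x, 0 ≤ b x := fun x => integral_nonneg hm0
  have hE : ∀ x, HasDerivAt (fun x => -(Real.exp (2 * b x) / 2)) (m x * Real.exp (2 * b x)) x :=
    fun x => ((((hb x).const_mul 2).exp.div_const 2).neg).congr_deriv (by ring)
  have hEt : Tendsto (fun x => -(Real.exp (2 * b x) / 2)) atTop (𝓝 (-(1 / 2))) := by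
    have := (((Real.continuous_exp.tendsto _).comp (hbt.const_mul 2)).div_const 2).neg
    simpa using this
  have hEi : ∀ a, IntegrableOn (fun x => m x * Real.exp (2 * b x)) (Set.Ioi a) := fun a =>
    integrableOn_Ioi_deriv_of_nonneg' (fun x _ => hE x)
      (fun x _ => mul_nonneg (hm0 x) (Real.exp_pos _).le) hEt
  have hEI : ∀ a, ∫ x in Set.Ioi a, m x * Real.exp (2 * b x) = (Real.exp (2 * b a) - 1) / 2 := by
    intro a
    rw [integral_Ioi_of_hasDerivAt_of_nonneg' (fun x _ => hE x)
      (fun x _ => mul_nonneg (hm0 x) (Real.exp_pos _).le) hEt]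
    ring
  -- The unknown is sought as e^{2b}ν with ν bounded, b being the tail integral of m. Since ∫_x^∞ m
  -- e^{2b} = (e^{2b(x)} − 1)/2, the integral equation contracts with ratio 1/2 on the whole line,
  -- even if b is unbounded at −∞.
  set G : BoundedContinuousFunction ℝ V → ℝ → V := fun ν y => F y (Real.exp (2 * b y) • ν y)
  have hGc : ∀ ν, Continuous (G ν) := fun ν =>
    hF.comp (continuous_id.prodMk ((Real.continuous_exp.comp (hbc.const_mul 2)).smul ν.continuous))
  have hGd : ∀ ν ν' y, ‖G ν y - G ν' y‖ ≤ m y * Real.exp (2 * b y) * ‖ν - ν'‖ := by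
    intro ν ν' y
    refine (hlip _ _ _).trans ?_
    rw [← smul_sub, norm_smul, Real.norm_eq_abs, abs_of_pos (Real.exp_pos _), mul_assoc]
    have := hm0 y
    gcongr
    exact (ν - ν').norm_coe_le_norm y
  have hG0 : ∀ y, G 0 y = 0 := fun y => by simp [G, hF0]
  have hGb : ∀ ν y, ‖G ν y‖ ≤ m y * Real.exp (2 * b y) * ‖ν‖ := fun ν y => by
    simpa [hG0] using hGd ν 0 y
  have hGi : ∀ ν a, IntegrableOn (G ν) (Set.Ioi a) := fun ν a =>
    ((hEi a).mul_const ‖ν‖).mono' (hGc ν).aestronglyMeasurable (ae_of_all _ (hGb ν))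
  set T0 : BoundedContinuousFunction ℝ V → ℝ → V := fun ν x =>
    Real.exp (-(2 * b x)) • (v0 - ∫ u in Set.Ioi x, G ν u)
  have hTc : ∀ ν, Continuous (T0 ν) := fun ν => by
    have : Continuous fun x => ∫ u in Set.Ioi x, G ν u := continuous_iff_continuousAt.2 fun x =>
      (hasDerivAt_setIntegral_Ioi (hGc ν) (hGi ν) x).continuousAt
    fun_prop
  have hexp : ∀ x, Real.exp (-(2 * b x)) * ((Real.exp (2 * b x) - 1) / 2) ≤ 1 / 2 := fun x => by
    have h1 : Real.exp (-(2 * b x)) * Real.exp (2 * b x) = 1 := by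
      rw [← Real.exp_add]; simp
    have := Real.exp_pos (-(2 * b x))
    nlinarith
  have hTd : ∀ ν ν' x, ‖T0 ν x - T0 ν' x‖ ≤ 1 / 2 * ‖ν - ν'‖ := by
    intro ν ν' x
    have e : T0 ν x - T0 ν' x
        = -(Real.exp (-(2 * b x)) • ∫ u in Set.Ioi x, (G ν u - G ν' u)) := by
      rw [integral_sub (hGi ν x) (hGi ν' x)]
      simp only [T0]
      rw [← smul_sub, ← smul_neg]
      congr 1
      abel
    have h1 : ‖∫ u in Set.Ioi x, (G ν u - G ν' u)‖
        ≤ (Real.exp (2 * b x) - 1) / 2 * ‖ν - ν'‖ := by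
      refine (norm_integral_le_of_norm_le ((hEi x).mul_const _)
        (ae_of_all _ (hGd ν ν'))).trans ?_
      rw [integral_mul_const, hEI]
    rw [e, norm_neg, norm_smul, Real.norm_eq_abs, abs_of_pos (Real.exp_pos _)]
    calc _ ≤ Real.exp (-(2 * b x)) * ((Real.exp (2 * b x) - 1) / 2 * ‖ν - ν'‖) := by gcongr
      _ = Real.exp (-(2 * b x)) * ((Real.exp (2 * b x) - 1) / 2) * ‖ν - ν'‖ := by ring
      _ ≤ _ := by gcongr; exact hexp x
  have hTb : ∀ ν x, ‖T0 ν x‖ ≤ ‖v0‖ + 1 / 2 * ‖ν‖ := by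
    intro ν x
    have h0 : ‖T0 0 x‖ ≤ ‖v0‖ := by
      simp only [T0, hG0, integral_zero, sub_zero, norm_smul, Real.norm_eq_abs, Real.abs_exp]
      refine mul_le_of_le_one_left (norm_nonneg _) (Real.exp_le_one_iff.2 ?_)
      linarith [hb0 x]
    have h1 := hTd ν 0 x
    rw [sub_zero] at h1
    calc ‖T0 ν x‖ = ‖T0 0 x + (T0 ν x - T0 0 x)‖ := by rw [add_sub_cancel]
      _ ≤ _ := (norm_add_le _ _).trans (add_le_add h0 h1)
  set T : BoundedContinuousFunction ℝ V → BoundedContinuousFunction ℝ V := fun ν =>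
    BoundedContinuousFunction.ofNormedAddCommGroup (T0 ν) (hTc ν) _ (hTb ν)
  have hT : ContractingWith (1 / 2) T := by
    refine ⟨by norm_num, LipschitzWith.of_dist_le_mul fun ν ν' => ?_⟩
    rw [BoundedContinuousFunction.dist_le (by positivity)]
    intro x
    rw [dist_eq_norm, dist_eq_norm]
    simpa [T] using hTd ν ν' x
  obtain ⟨ν, hν⟩ : ∃ ν, T ν = ν := ⟨_, hT.fixedPoint_isFixedPt⟩
  have hνx : ∀ x, Real.exp (2 * b x) • ν x = v0 - ∫ u in Set.Ioi x, G ν u := fun x => by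
    have h1 : ν x = T0 ν x := (DFunLike.congr_fun hν x).symm
    rw [h1]
    simp only [T0, smul_smul, ← Real.exp_add, add_neg_cancel, Real.exp_zero, one_smul]
  refine ⟨fun x => Real.exp (2 * b x) • ν x, fun x => ?_, ?_⟩
  · have h1 := (hasDerivAt_setIntegral_Ioi (hGc ν) (hGi ν) x).const_sub v0
    rw [neg_neg] at h1
    exact h1.congr_of_eventuallyEq (Eventually.of_forall hνx)
  · have h1 := (tendsto_const_nhds (x := v0)).sub (tendsto_setIntegral_Ioi (hGi ν))
    rw [sub_zero] at h1
    exact h1.congr fun x => (hνx x).symm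

theorem exists_solution_tendsto_atBot {V : Type*} [NormedAddCommGroup V] [NormedSpace ℝ V]
    [CompleteSpace V] {F : ℝ → V → V} {m : ℝ → ℝ} (hF : Continuous fun z : ℝ × V => F z.1 z.2)
    (hF0 : ∀ x, F x 0 = 0) (hlip : ∀ x v w, ‖F x v - F x w‖ ≤ m x * ‖v - w‖)
    (hm : Continuous m) (hm0 : ∀ x, 0 ≤ m x) (hmi : ∀ a, IntegrableOn m (Set.Iio a)) (v0 : V) :
    ∃ μ : ℝ → V, (∀ x, HasDerivAt μ (F x (μ x)) x) ∧ Tendsto μ atBot (𝓝 v0) := by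
  obtain ⟨μ, h1, h2⟩ := exists_solution_tendsto_atTop (F := fun x v => -F (-x) v)
    (m := fun x => m (-x)) (by fun_prop) (by simp [hF0])
    (fun x v w => by
      rw [← neg_sub', norm_neg]; exact hlip _ _ _)
    (by fun_prop) (fun x => hm0 _) (fun a => by
      have h := hmi (-a)
      rw [← integrable_indicator_iff measurableSet_Iio] at h
      rw [← integrable_indicator_iff measurableSet_Ioi]
      refine h.comp_neg.congr (ae_of_all _ fun x => ?_)
      simp only [Set.indicator, Set.mem_Iio, Set.mem_Ioi, neg_lt_neg_iff]) v0
  refine ⟨fun x => μ (-x), fun x => ?_, h2.comp tendsto_neg_atBot_atTop⟩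
  have h := (h1 (-x)).scomp x (hasDerivAt_neg x)
  refine h.congr_deriv ?_
  simp

end LinearODE

/-! ### Algebra of the Lax matrix and of its eigenvectors -/

section MatrixAlgebra

open scoped Matrix Matrix.Norms.Operator

section Algebra

/-- The diagonal matrix of the free evolution of `expDelta`. -/
def freeGen (q0 z : ℝ) : Mat3 :=
  Matrix.diagonal ![Complex.I * lamz q0 z, -(Complex.I * kz q0 z), -(Complex.I * lamz q0 z)]

/-- The conserved pairing of the Jost solutions. -/
def gram (q0 z : ℝ) : Mat3 :=
  Matrix.diagonal ![(rhoHat q0 z : ℂ), -1, -(rhoHat q0 z : ℂ)]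

/-- The inverse of `gram`. -/
def gramInv (q0 z : ℝ) : Mat3 :=
  Matrix.diagonal ![(rhoHat q0 z : ℂ)⁻¹, -1, -(rhoHat q0 z : ℂ)⁻¹]

variable {q0 σ z t : ℝ} {v : Vec2}

theorem sub_ne_zero_of_ne (h1 : z ≠ q0) (h2 : z ≠ -q0) : z ^ 2 - q0 ^ 2 ≠ 0 := by
  rw [sq_sub_sq]
  exact mul_ne_zero (fun h => h2 (by linarith)) (sub_ne_zero.2 h1)

theorem rhoHat_ne_zero (h0 : z ≠ 0) (h1 : z ≠ q0) (h2 : z ≠ -q0) : rhoHat q0 z ≠ 0 :=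
  div_ne_zero (pow_ne_zero 2 h0) (sub_ne_zero_of_ne h1 h2)

theorem gramInv_mul_gram (h0 : z ≠ 0) (h1 : z ≠ q0) (h2 : z ≠ -q0) :
    gramInv q0 z * gram q0 z = 1 := by
  have h : (rhoHat q0 z : ℂ) ≠ 0 := by exact_mod_cast rhoHat_ne_zero h0 h1 h2
  rw [gramInv, gram, Matrix.diagonal_mul_diagonal, ← Matrix.diagonal_one]
  congr 1
  ext i
  fin_cases i <;> simp [h]

theorem norm_sq_components (v : Vec2) :
    (v 0 * star (v 0) + v 1 * star (v 1) : ℂ) = ((‖v‖ ^ 2 : ℝ) : ℂ) := by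
  rw [EuclideanSpace.norm_eq, Real.sq_sqrt (by positivity)]
  simp only [Fin.sum_univ_two, Complex.star_def, Complex.mul_conj, Complex.normSq_eq_norm_sq]
  push_cast; rfl

theorem matJ_eq : matJ = !![1, 0, 0; 0, -1, 0; 0, 0, -1] := by
  ext i j
  fin_cases i <;> fin_cases j <;> simp [matJ, Matrix.diagonal]

theorem matX_eq (k : ℝ) (v : Vec2) :
    matX k v = !![Complex.I * k, -(Complex.I * star (v 0)), -(Complex.I * star (v 1));
      Complex.I * v 0, -(Complex.I * k), 0; Complex.I * v 1, 0, -(Complex.I * k)] := by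
  rw [matX, matJ_eq, matQ]
  ext i j
  fin_cases i <;> fin_cases j <;> simp

theorem freeGen_eq (q0 z : ℝ) : freeGen q0 z = !![Complex.I * lamz q0 z, 0, 0;
    0, -(Complex.I * kz q0 z), 0; 0, 0, -(Complex.I * lamz q0 z)] := by
  ext i j
  fin_cases i <;> fin_cases j <;> simp [freeGen, Matrix.diagonal]

theorem gram_eq (q0 z : ℝ) : gram q0 z = !![(rhoHat q0 z : ℂ), 0, 0;
    0, -1, 0; 0, 0, -(rhoHat q0 z : ℂ)] := by
  ext i j
  fin_cases i <;> fin_cases j <;> simp [gram, Matrix.diagonal]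

/-- This eigenvector relation makes Y e^{iΔ} an exact solution for the constant potential v. -/
theorem matX_mul_matY (hq0 : 0 < q0) (hv : ‖v‖ = q0) (h0 : z ≠ 0) :
    matX (kz q0 z) v * matY q0 v z = matY q0 v z * freeGen q0 z := by
  have hz : (z : ℂ) ≠ 0 := by exact_mod_cast h0
  have hq : (q0 : ℂ) ≠ 0 := by exact_mod_cast hq0.ne'
  have hn := norm_sq_components v
  rw [hv] at hn
  push_cast at hn
  rw [matX_eq, freeGen_eq, matY]
  generalize (rhoHat q0 z : ℂ) = r
  simp only [perp, kz, lamz, Complex.star_def] at hn ⊢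
  generalize hc0 : (starRingEnd ℂ) (v 0) = c0 at *
  generalize hc1 : (starRingEnd ℂ) (v 1) = c1 at *
  generalize v 0 = a0 at *
  generalize v 1 = a1 at *
  ext i j
  fin_cases i <;> fin_cases j <;>
    simp [Matrix.mul_apply, Fin.sum_univ_three, -mul_eq_mul_left_iff, -mul_eq_mul_right_iff] <;>
    field_simp
  · linear_combination (-2 * r) * hn
  · ring
  · linear_combination (-2 * (z : ℂ) ^ 2 * r) * hn
  all_goals ring

theorem matY_gram (hq0 : 0 < q0) (hv : ‖v‖ = q0) (h0 : z ≠ 0) (h1 : z ≠ q0) (h2 : z ≠ -q0) :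
    (matY q0 v z)ᴴ * matJ * matY q0 v z = gram q0 z := by
  have hz : (z : ℂ) ≠ 0 := by exact_mod_cast h0
  have hq : (q0 : ℂ) ≠ 0 := by exact_mod_cast hq0.ne'
  have hs : (z : ℂ) ^ 2 - (q0 : ℂ) ^ 2 ≠ 0 := by exact_mod_cast sub_ne_zero_of_ne h1 h2
  have hn := norm_sq_components v
  rw [hv] at hn
  push_cast at hn
  have hr : (rhoHat q0 z : ℂ) * (z ^ 2 - q0 ^ 2) = z ^ 2 := by
    rw [rhoHat]; push_cast; field_simp
  rw [gram_eq, matJ_eq, matY]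
  have hcr : (starRingEnd ℂ) (rhoHat q0 z : ℂ) = rhoHat q0 z := Complex.conj_ofReal _
  generalize (rhoHat q0 z : ℂ) = r at *
  simp only [perp, Complex.star_def] at hn ⊢
  ext i j
  fin_cases i <;> fin_cases j <;>
    simp [Matrix.mul_apply, Fin.sum_univ_three, -mul_eq_mul_left_iff, -mul_eq_mul_right_iff] <;>
    (try field_simp) <;> (try rw [hcr])
  · linear_combination (r ^ 2 * (-z ^ 2 + v 0 * (starRingEnd ℂ) (v 0)
      + v 1 * (starRingEnd ℂ) (v 1))) * Complex.I_sq - r ^ 2 * hn + r * hr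
  · ring
  · linear_combination (r ^ 2 * Complex.I) * hn
  · ring
  · linear_combination -hn
  · ring
  · linear_combination (-(r ^ 2 * Complex.I)) * hn
  · ring
  · linear_combination (-((z : ℂ) ^ 2 * r ^ 2)) * hn - q0 ^ 2 * r * hr

theorem det_matY (hq0 : 0 < q0) (hv : ‖v‖ = q0) (h0 : z ≠ 0) (h1 : z ≠ q0) (h2 : z ≠ -q0) :
    (matY q0 v z).det = Complex.I * rhoHat q0 z := by
  have hz : (z : ℂ) ≠ 0 := by exact_mod_cast h0
  have hq : (q0 : ℂ) ≠ 0 := by exact_mod_cast hq0.ne'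
  have hs : (z : ℂ) ^ 2 - (q0 : ℂ) ^ 2 ≠ 0 := by exact_mod_cast sub_ne_zero_of_ne h1 h2
  have hn := norm_sq_components v
  rw [hv] at hn
  push_cast at hn
  have hr : (rhoHat q0 z : ℂ) * (z ^ 2 - q0 ^ 2) = z ^ 2 := by
    rw [rhoHat]; push_cast; field_simp
  rw [Matrix.det_fin_three, matY]
  generalize (rhoHat q0 z : ℂ) = r at *
  simp only [perp, Complex.star_def] at hn ⊢
  simp
  field_simp
  linear_combination (r ^ 2 * (z ^ 2 - q0 ^ 2)) * hn + q0 ^ 2 * r * hr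

/-- For real k, X lies in the Lie algebra of U(1,2); this is the source of the conserved pairing. -/
theorem matX_conjTranspose (k : ℝ) (v : Vec2) : (matX k v)ᴴ * matJ + matJ * matX k v = 0 := by
  rw [matX_eq, matJ_eq]
  ext i j
  fin_cases i <;> fin_cases j <;>
    simp [Matrix.mul_apply, Fin.sum_univ_three]

theorem expDelta_mul_conjTranspose (q0 σ z x t : ℝ) :
    expDelta q0 σ z x t * (expDelta q0 σ z x t)ᴴ = 1 := by
  rw [expDelta, Matrix.diagonal_conjTranspose, Matrix.diagonal_mul_diagonal, ← Matrix.diagonal_one]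
  congr 1
  ext i
  fin_cases i <;> simp [← Complex.exp_conj, ← Complex.exp_add]

theorem norm_expDelta_le (q0 σ z x t : ℝ) : ‖expDelta q0 σ z x t‖ ≤ 1 := by
  rw [expDelta, Matrix.linfty_opNorm_diagonal, pi_norm_le_iff_of_nonneg zero_le_one]
  intro i
  fin_cases i <;> simp [Complex.norm_exp]

theorem norm_expDelta_conjTranspose_le (q0 σ z x t : ℝ) : ‖(expDelta q0 σ z x t)ᴴ‖ ≤ 1 := by
  rw [expDelta, Matrix.diagonal_conjTranspose, Matrix.linfty_opNorm_diagonal,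
    pi_norm_le_iff_of_nonneg zero_le_one]
  intro i
  fin_cases i <;> simp [Complex.norm_exp]

theorem expDelta_gram (q0 σ z x t : ℝ) :
    (expDelta q0 σ z x t)ᴴ * gram q0 z * expDelta q0 σ z x t = gram q0 z := by
  have h := expDelta_mul_conjTranspose q0 σ z x t
  have hc : gram q0 z * expDelta q0 σ z x t = expDelta q0 σ z x t * gram q0 z := by
    rw [gram, expDelta, Matrix.diagonal_mul_diagonal, Matrix.diagonal_mul_diagonal]
    congr 1
    ext i
    exact mul_comm _ _
  rw [mul_assoc, hc, ← mul_assoc, mul_eq_one_comm.1 h, one_mul]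

theorem hasDerivAt_matrix {f : ℝ → Mat3} {f' : Mat3} {x : ℝ} :
    HasDerivAt f f' x ↔ ∀ i j, HasDerivAt (fun y => f y i j) (f' i j) x := by
  have h : HasDerivAt f f' x ↔ ∀ i, HasDerivAt (fun y => f y i) (f' i) x :=
    hasDerivAt_pi (E' := fun _ => Fin 3 → ℂ) (φ := f) (φ' := f')
  rw [h]
  exact forall_congr' fun i => hasDerivAt_pi

theorem hasDerivAt_expDelta (q0 σ z x t : ℝ) :
    HasDerivAt (fun y => expDelta q0 σ z y t) (freeGen q0 z * expDelta q0 σ z x t) x := by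
  have h1 : HasDerivAt (fun y => (delta1 q0 σ z y t : ℂ)) (lamz q0 z) x := by
    have := (((hasDerivAt_id x).const_mul (lamz q0 z)).add_const
      (2 * lamz q0 z * (kz q0 z + σ * (3 * kz q0 z ^ 2 - lamz q0 z ^ 2)) * t)).ofReal_comp
    simpa [delta1] using this
  have h2 : HasDerivAt (fun y => (delta2 q0 σ z y t : ℂ)) (-(kz q0 z : ℂ)) x := by
    have := (((hasDerivAt_id x).const_mul (-kz q0 z)).sub_const
      ((lamz q0 z ^ 2 + kz q0 z ^ 2 + 4 * σ * kz q0 z ^ 3) * t)).ofReal_comp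
    simpa [delta2] using this
  rw [hasDerivAt_matrix]
  intro i j
  rw [expDelta, freeGen, Matrix.diagonal_mul_diagonal]
  by_cases hij : i = j
  · subst hij
    simp only [expDelta, Matrix.diagonal_apply_eq]
    fin_cases i
    · simpa [mul_comm] using (h1.const_mul Complex.I).cexp
    · simpa [mul_comm] using (h2.const_mul Complex.I).cexp
    · simpa [mul_comm] using (h1.const_mul Complex.I).neg.cexp
  · simp only [expDelta, Matrix.diagonal_apply_ne _ hij]
    exact hasDerivAt_const x 0

theorem norm_matX_sub_le (k : ℝ) (v w : Vec2) : ‖matX k v - matX k w‖ ≤ 2 * ‖v - w‖ := by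
  have h0 : ‖v 0 - w 0‖ ≤ ‖v - w‖ := PiLp.norm_apply_le (v - w) 0
  have h1 : ‖v 1 - w 1‖ ≤ ‖v - w‖ := PiLp.norm_apply_le (v - w) 1
  have e : ∀ a b : ℂ, ‖Complex.I * a - Complex.I * b‖ = ‖a - b‖ := fun a b => by
    rw [← mul_sub, norm_mul, Complex.norm_I, one_mul]
  have e' : ∀ a b : ℂ, ‖(starRingEnd ℂ) a - (starRingEnd ℂ) b‖ = ‖a - b‖ := fun a b => by
    rw [← map_sub, RCLike.norm_conj]
  have hn : ‖matX k v - matX k w‖ = ‖fun i => ∑ j, ‖(matX k v - matX k w) i j‖‖ := by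
    rw [Matrix.linfty_opNorm_def, Pi.norm_def]
    congr 2
    ext i
    rw [coe_nnnorm, Real.norm_of_nonneg (by positivity)]
    push_cast
    rfl
  rw [hn, pi_norm_le_iff_of_nonneg (by positivity), matX_eq, matX_eq]
  intro i
  rw [Real.norm_of_nonneg (by positivity), Fin.sum_univ_three]
  fin_cases i
  · simp [e, e', neg_add_eq_sub]
    rw [norm_sub_rev (w 0), norm_sub_rev (w 1)]
    linarith
  · simp [e]
    linarith [norm_nonneg (v - w)]
  · simp [e]
    linarith [norm_nonneg (v - w)]
end Algebra

end MatrixAlgebra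

/-! ### Jost solutions: conserved pairing, uniqueness, existence, determinant -/

section JostSolutions

open scoped Matrix Matrix.Norms.Operator

variable {q0 σ z t : ℝ} {b : Vec2} {q : ℝ → ℝ → Vec2} {l : Filter ℝ}

theorem IsJost.hasDerivAt {ψ : ℝ → Mat3} (h : IsJost q0 σ q l b t z ψ) (x : ℝ) :
    HasDerivAt ψ (matX (kz q0 z) (q x t) * ψ x) x :=
  hasDerivAt_matrix.2 (h.1 x)

theorem tendsto_matrix {α : Type*} {l : Filter α} {f : α → Mat3} {A : Mat3} :
    Tendsto f l (𝓝 A) ↔ ∀ i j, Tendsto (fun y => f y i j) l (𝓝 (A i j)) := by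
  have h : Tendsto f l (𝓝 A) ↔ ∀ i, Tendsto (fun y => f y i) l (𝓝 (A i)) :=
    tendsto_pi_nhds (A := fun _ : Fin 3 => Fin 3 → ℂ)
  rw [h]
  exact forall_congr' fun i => tendsto_pi_nhds

theorem IsJost.tendsto {ψ : ℝ → Mat3} (h : IsJost q0 σ q l b t z ψ) :
    Tendsto (fun x => ψ x - matY q0 b z * expDelta q0 σ z x t) l (𝓝 0) :=
  tendsto_matrix.2 h.2

theorem IsJost.tendsto_mul {ψ : ℝ → Mat3} (h : IsJost q0 σ q l b t z ψ) :
    Tendsto (fun x => ψ x * (expDelta q0 σ z x t)ᴴ) l (𝓝 (matY q0 b z)) := by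
  have h1 : Tendsto (fun x => (ψ x - matY q0 b z * expDelta q0 σ z x t)
      * (expDelta q0 σ z x t)ᴴ) l (𝓝 0) := by
    refine squeeze_zero_norm (fun x => ?_) (tendsto_zero_iff_norm_tendsto_zero.1 h.tendsto)
    exact (norm_mul_le _ _).trans
      (mul_le_of_le_one_right (norm_nonneg _) (norm_expDelta_conjTranspose_le _ _ _ _ _))
  have h2 := h1.add_const (matY q0 b z)
  rw [zero_add] at h2
  refine h2.congr fun x => ?_
  rw [sub_mul, mul_assoc, expDelta_mul_conjTranspose, mul_one, sub_add_cancel]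

/-- Two solutions of the spatial equation have a constant pairing. -/
theorem pairing_const {k : ℝ} {p : ℝ → Vec2} {ψ φ : ℝ → Mat3}
    (hψ : ∀ x, HasDerivAt ψ (matX k (p x) * ψ x) x)
    (hφ : ∀ x, HasDerivAt φ (matX k (p x) * φ x) x) (x y : ℝ) :
    (ψ x)ᴴ * matJ * φ x = (ψ y)ᴴ * matJ * φ y := by
  have hd : ∀ x, HasDerivAt (fun x => (ψ x)ᴴ * matJ * φ x) 0 x := fun x => by
    have h1 : HasDerivAt (fun x => (ψ x)ᴴ) (matX k (p x) * ψ x)ᴴ x := by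
      rw [hasDerivAt_matrix]
      exact fun i j => ((hasDerivAt_matrix.1 (hψ x)) j i).star
    have h2 := (h1.mul_const matJ).mul (hφ x)
    refine h2.congr_deriv ?_
    have := matX_conjTranspose k (p x)
    rw [Matrix.conjTranspose_mul]
    calc _ = (ψ x)ᴴ * ((matX k (p x))ᴴ * matJ + matJ * matX k (p x)) * φ x := by noncomm_ring
      _ = 0 := by rw [this]; simp
  exact is_const_of_deriv_eq_zero (fun x => (hd x).differentiableAt) (fun x => (hd x).deriv) x y

theorem norm_conjTranspose_mul_mul_le (x : ℝ) (A : Mat3) :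
    ‖(expDelta q0 σ z x t)ᴴ * A * expDelta q0 σ z x t‖ ≤ ‖A‖ := by
  have h1 := norm_expDelta_le q0 σ z x t
  have h2 := norm_expDelta_conjTranspose_le q0 σ z x t
  calc _ ≤ ‖(expDelta q0 σ z x t)ᴴ‖ * ‖A‖ * ‖expDelta q0 σ z x t‖ :=
        (norm_mul_le _ _).trans (by gcongr; exact norm_mul_le _ _)
    _ ≤ 1 * ‖A‖ * 1 := by gcongr
    _ = _ := by ring

/-- The pairing is constant, and its value is found at the end l. There conjugation by the unitary
e^{iΔ} fixes the diagonal Gram matrix, so the oscillation of ψ does no harm. -/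
theorem IsJost.gram_eq [l.NeBot] {ψ : ℝ → Mat3} (h : IsJost q0 σ q l b t z ψ) (hq0 : 0 < q0)
    (hb : ‖b‖ = q0) (h0 : z ≠ 0) (h1 : z ≠ q0) (h2 : z ≠ -q0) (x : ℝ) :
    (ψ x)ᴴ * matJ * ψ x = gram q0 z := by
  have ht := h.tendsto_mul
  have hlim : Tendsto (fun y => (ψ y * (expDelta q0 σ z y t)ᴴ)ᴴ * matJ
      * (ψ y * (expDelta q0 σ z y t)ᴴ)) l (𝓝 (gram q0 z)) := by
    rw [← matY_gram hq0 hb h0 h1 h2]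
    exact ((ht.star).mul_const matJ).mul ht
  have hz : Tendsto (fun _ : ℝ => (ψ x)ᴴ * matJ * ψ x - gram q0 z) l (𝓝 0) := by
    have hlim' := tendsto_zero_iff_norm_tendsto_zero.1 (tendsto_sub_nhds_zero_iff.2 hlim)
    refine squeeze_zero_norm (fun y => ?_) hlim'
    refine le_trans (le_of_eq ?_)
      (norm_conjTranspose_mul_mul_le (q0 := q0) (σ := σ) (z := z) (t := t) y _)
    rw [mul_sub, sub_mul, expDelta_gram, pairing_const h.hasDerivAt h.hasDerivAt x y]
    have he := mul_eq_one_comm.1 (expDelta_mul_conjTranspose q0 σ z y t)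
    congr 2
    rw [Matrix.conjTranspose_mul, Matrix.conjTranspose_conjTranspose]
    calc _ = 1 * ((ψ y)ᴴ * matJ * ψ y) * 1 := by simp
      _ = _ := by rw [← he]; noncomm_ring
  exact sub_eq_zero.1 (tendsto_nhds_unique tendsto_const_nhds hz)

theorem IsJost.left_inv [l.NeBot] {ψ : ℝ → Mat3} (h : IsJost q0 σ q l b t z ψ) (hq0 : 0 < q0)
    (hb : ‖b‖ = q0) (h0 : z ≠ 0) (h1 : z ≠ q0) (h2 : z ≠ -q0) (x : ℝ) :
    gramInv q0 z * ((ψ x)ᴴ * matJ) * ψ x = 1 := by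
  rw [mul_assoc, h.gram_eq hq0 hb h0 h1 h2, gramInv_mul_gram h0 h1 h2]

/-- The difference solves the same equation and tends to 0, so its constant pairing with ψ is 0. The
Gram matrix of ψ being invertible, the difference vanishes. -/
theorem IsJost.unique [l.NeBot] {ψ φ : ℝ → Mat3} (h : IsJost q0 σ q l b t z ψ)
    (h' : IsJost q0 σ q l b t z φ) (hq0 : 0 < q0)
    (hb : ‖b‖ = q0) (h0 : z ≠ 0) (h1 : z ≠ q0) (h2 : z ≠ -q0) : φ = ψ := by
  funext x
  have hd : ∀ x, HasDerivAt (fun x => φ x - ψ x)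
      (matX (kz q0 z) (q x t) * (φ x - ψ x)) x := fun x => by
    rw [mul_sub]; exact (h'.hasDerivAt x).sub (h.hasDerivAt x)
  have ht : Tendsto (fun x => φ x - ψ x) l (𝓝 0) := by
    have := h'.tendsto.sub h.tendsto
    rw [sub_zero] at this
    exact this.congr fun x => by abel
  have hlim : Tendsto (fun y => (ψ y * (expDelta q0 σ z y t)ᴴ)ᴴ * matJ
      * (φ y - ψ y)) l (𝓝 0) := by
    have := ((h.tendsto_mul.star).mul_const matJ).mul ht
    rwa [mul_zero] at this
  have hz : Tendsto (fun _ : ℝ => (ψ x)ᴴ * matJ * (φ x - ψ x)) l (𝓝 0) := by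
    refine squeeze_zero_norm (fun y => ?_) (tendsto_zero_iff_norm_tendsto_zero.1 hlim)
    have he := mul_eq_one_comm.1 (expDelta_mul_conjTranspose q0 σ z y t)
    rw [pairing_const h.hasDerivAt hd x y, Matrix.conjTranspose_mul,
      Matrix.conjTranspose_conjTranspose]
    calc _ = ‖(expDelta q0 σ z y t)ᴴ
          * (expDelta q0 σ z y t * (ψ y)ᴴ * matJ * (φ y - ψ y))‖ := by
          congr 1
          calc _ = 1 * ((ψ y)ᴴ * matJ * (φ y - ψ y)) := by rw [one_mul]
            _ = _ := by rw [← he]; noncomm_ring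
      _ ≤ _ := (norm_mul_le _ _).trans (mul_le_of_le_one_left (norm_nonneg _)
          (norm_expDelta_conjTranspose_le _ _ _ _ _))
  have hz' : (ψ x)ᴴ * matJ * (φ x - ψ x) = 0 := tendsto_nhds_unique tendsto_const_nhds hz
  have hi := mul_eq_one_comm.1 (h.left_inv hq0 hb h0 h1 h2 x)
  rw [← sub_eq_zero]
  calc φ x - ψ x = 1 * (φ x - ψ x) := (one_mul _).symm
    _ = ψ x * gramInv q0 z * ((ψ x)ᴴ * matJ * (φ x - ψ x)) := by rw [← hi]; noncomm_ring
    _ = 0 := by rw [hz', mul_zero]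

/-- The free solution `Y e^{iΔ}`, with inverse `e^{-iΔ} Y⁻¹`, reduces the Jost problem to a
perturbation of the trivial equation. -/
theorem exists_isJost_of (hq0 : 0 < q0) (hb : ‖b‖ = q0) (h0 : z ≠ 0) (h1 : z ≠ q0)
    (h2 : z ≠ -q0) {μ : ℝ → Mat3}
    (hμ : ∀ x, HasDerivAt μ ((expDelta q0 σ z x t)ᴴ * (matY q0 b z)⁻¹
      * (matX (kz q0 z) (q x t) - matX (kz q0 z) b) * (matY q0 b z * expDelta q0 σ z x t)
      * μ x) x) (hμl : Tendsto μ l (𝓝 1)) : ∃ ψ, IsJost q0 σ q l b t z ψ := by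
  have hdet : IsUnit (matY q0 b z).det := by
    rw [det_matY hq0 hb h0 h1 h2, isUnit_iff_ne_zero]
    exact mul_ne_zero Complex.I_ne_zero (by exact_mod_cast rhoHat_ne_zero h0 h1 h2)
  refine ⟨fun x => matY q0 b z * expDelta q0 σ z x t * μ x, fun x i j => ?_, fun i j => ?_⟩
  · have hE := (hasDerivAt_expDelta q0 σ z x t).const_mul (matY q0 b z)
    refine hasDerivAt_matrix.1 ((hE.mul (hμ x)).congr_deriv ?_) i j
    have e1 := expDelta_mul_conjTranspose q0 σ z x t
    have e2 := Matrix.mul_nonsing_inv _ hdet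
    have e3 := matX_mul_matY hq0 hb h0
    set E := expDelta q0 σ z x t
    set Y := matY q0 b z
    set X := matX (kz q0 z) (q x t)
    set Xb := matX (kz q0 z) b
    calc Y * (freeGen q0 z * E) * μ x + Y * E * (Eᴴ * Y⁻¹ * (X - Xb) * (Y * E) * μ x)
        = (Y * freeGen q0 z) * E * μ x + Y * (E * Eᴴ) * Y⁻¹ * (X - Xb) * Y * E * μ x := by
          noncomm_ring
      _ = Xb * Y * E * μ x + (X - Xb) * Y * E * μ x := by
          rw [e1, mul_one, e2, one_mul, ← e3]
      _ = X * (Y * E * μ x) := by noncomm_ring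
  · suffices h4 : Tendsto (fun x => matY q0 b z * expDelta q0 σ z x t * μ x
        - matY q0 b z * expDelta q0 σ z x t) l (𝓝 0) from tendsto_matrix.1 h4 i j
    have h3 : Tendsto (fun x => ‖matY q0 b z‖ * ‖μ x - 1‖) l (𝓝 0) := by
      have := (tendsto_zero_iff_norm_tendsto_zero.1 (tendsto_sub_nhds_zero_iff.2 hμl)).const_mul
        ‖matY q0 b z‖
      rwa [mul_zero] at this
    refine squeeze_zero_norm (fun x => ?_) h3
    calc ‖matY q0 b z * expDelta q0 σ z x t * μ x - matY q0 b z * expDelta q0 σ z x t‖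
        = ‖matY q0 b z * expDelta q0 σ z x t * (μ x - 1)‖ := by rw [mul_sub, mul_one]
      _ ≤ ‖matY q0 b z‖ * ‖expDelta q0 σ z x t‖ * ‖μ x - 1‖ :=
          (norm_mul_le _ _).trans (by gcongr; exact norm_mul_le _ _)
      _ ≤ ‖matY q0 b z‖ * 1 * ‖μ x - 1‖ := by gcongr; exact norm_expDelta_le _ _ _ _ _
      _ = _ := by ring

section Existence

/-- The perturbation of the trivial equation satisfied by `e^{-iΔ} Y⁻¹ ψ`. -/
def jostField (q0 σ : ℝ) (q : ℝ → ℝ → Vec2) (b : Vec2) (t z : ℝ) (x : ℝ) (M : Mat3) : Mat3 :=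
  (expDelta q0 σ z x t)ᴴ * (matY q0 b z)⁻¹
      * (matX (kz q0 z) (q x t) - matX (kz q0 z) b) * (matY q0 b z * expDelta q0 σ z x t) * M

theorem continuous_matX (k : ℝ) : Continuous (matX k) := by
  rw [continuous_iff_continuousAt]
  intro v
  refine tendsto_sub_nhds_zero_iff.1 (squeeze_zero_norm (fun w => norm_matX_sub_le k w v) ?_)
  have : Tendsto (fun w : Vec2 => 2 * ‖w - v‖) (𝓝 v) (𝓝 (2 * ‖v - v‖)) :=
    Continuous.tendsto (by fun_prop) v
  simpa using this

theorem continuous_expDelta (q0 σ z t : ℝ) : Continuous fun x => expDelta q0 σ z x t :=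
  continuous_iff_continuousAt.2 fun x => (hasDerivAt_expDelta q0 σ z x t).continuousAt

theorem continuous_jostField (hq : Continuous fun x => q x t) :
    Continuous fun w : ℝ × Mat3 => jostField q0 σ q b t z w.1 w.2 := by
  have h1 := continuous_expDelta q0 σ z t
  have h2 : Continuous fun x => matX (kz q0 z) (q x t) := (continuous_matX _).comp hq
  have h3 : Continuous fun x => (expDelta q0 σ z x t)ᴴ := h1.star
  unfold jostField
  exact ((((h3.comp continuous_fst).mul continuous_const).mul
    ((h2.comp continuous_fst).sub continuous_const)).mul
    (continuous_const.mul (h1.comp continuous_fst))).mul continuous_snd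

theorem norm_jostField_sub_le (x : ℝ) (A B : Mat3) :
    ‖jostField q0 σ q b t z x A - jostField q0 σ q b t z x B‖
      ≤ 2 * ‖(matY q0 b z)⁻¹‖ * ‖matY q0 b z‖ * ‖q x t - b‖ * ‖A - B‖ := by
  have h1 := norm_expDelta_le q0 σ z x t
  have h2 := norm_expDelta_conjTranspose_le q0 σ z x t
  have h3 := norm_matX_sub_le (kz q0 z) (q x t) b
  unfold jostField
  rw [← mul_sub]
  calc _ ≤ ‖(expDelta q0 σ z x t)ᴴ‖ * ‖(matY q0 b z)⁻¹‖
        * ‖matX (kz q0 z) (q x t) - matX (kz q0 z) b‖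
        * (‖matY q0 b z‖ * ‖expDelta q0 σ z x t‖) * ‖A - B‖ := by
        refine (norm_mul_le _ _).trans ?_
        gcongr
        refine (norm_mul_le _ _).trans ?_
        gcongr
        · refine (norm_mul_le _ _).trans ?_
          gcongr
          exact norm_mul_le _ _
        · exact norm_mul_le _ _
    _ ≤ 1 * ‖(matY q0 b z)⁻¹‖ * (2 * ‖q x t - b‖) * (‖matY q0 b z‖ * 1) * ‖A - B‖ := by gcongr
    _ = _ := by ring

theorem integrableOn_Ioi_of_zero {f : ℝ → ℝ} (hf : Continuous f) (h : IntegrableOn f (Set.Ioi 0))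
    (a : ℝ) : IntegrableOn f (Set.Ioi a) := by
  refine ((hf.integrableOn_Icc (a := a) (b := 0)).union h).mono_set fun x hx => ?_
  rcases le_or_gt x 0 with h | h
  · exact Or.inl ⟨le_of_lt hx, h⟩
  · exact Or.inr h

theorem integrableOn_Iio_of_zero {f : ℝ → ℝ} (hf : Continuous f) (h : IntegrableOn f (Set.Iio 0))
    (a : ℝ) : IntegrableOn f (Set.Iio a) := by
  refine ((hf.integrableOn_Icc (a := 0) (b := a)).union h).mono_set fun x hx => ?_
  rcases le_or_gt 0 x with h | h
  · exact Or.inl ⟨h, le_of_lt hx⟩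
  · exact Or.inr h

theorem exists_isJost_atTop (hq0 : 0 < q0) (hb : ‖b‖ = q0) (h0 : z ≠ 0) (h1 : z ≠ q0)
    (h2 : z ≠ -q0) (hq : Continuous fun x => q x t)
    (hi : IntegrableOn (fun x => q x t - b) (Set.Ioi 0)) :
    ∃ ψ, IsJost q0 σ q atTop b t z ψ := by
  have hm : Continuous fun x => 2 * ‖(matY q0 b z)⁻¹‖ * ‖matY q0 b z‖ * ‖q x t - b‖ := by fun_prop
  obtain ⟨μ, hμ, hμl⟩ := exists_solution_tendsto_atTop (continuous_jostField (σ := σ) (q0 := q0)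
    (b := b) (z := z) hq) (fun x => by simp [jostField]) norm_jostField_sub_le hm
    (fun x => by positivity) (integrableOn_Ioi_of_zero hm (hi.norm.const_mul _)) 1
  exact exists_isJost_of hq0 hb h0 h1 h2 hμ hμl

theorem exists_isJost_atBot (hq0 : 0 < q0) (hb : ‖b‖ = q0) (h0 : z ≠ 0) (h1 : z ≠ q0)
    (h2 : z ≠ -q0) (hq : Continuous fun x => q x t)
    (hi : IntegrableOn (fun x => q x t - b) (Set.Iio 0)) :
    ∃ ψ, IsJost q0 σ q atBot b t z ψ := by
  have hm : Continuous fun x => 2 * ‖(matY q0 b z)⁻¹‖ * ‖matY q0 b z‖ * ‖q x t - b‖ := by fun_prop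
  obtain ⟨μ, hμ, hμl⟩ := exists_solution_tendsto_atBot (continuous_jostField (σ := σ) (q0 := q0)
    (b := b) (z := z) hq) (fun x => by simp [jostField]) norm_jostField_sub_le hm
    (fun x => by positivity) (integrableOn_Iio_of_zero hm (hi.norm.const_mul _)) 1
  exact exists_isJost_of hq0 hb h0 h1 h2 hμ hμl

end Existence

/-- Liouville's formula: tr X = −ik is also the logarithmic derivative of det e^{iΔ} = e^{iδ₂}, so
the determinant of ψe^{-iΔ} is constant and equals det Y. -/
theorem IsJost.det_eq [l.NeBot] {ψ : ℝ → Mat3} (h : IsJost q0 σ q l b t z ψ) (hq0 : 0 < q0)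
    (hb : ‖b‖ = q0) (h0 : z ≠ 0) (h1 : z ≠ q0) (h2 : z ≠ -q0) (x : ℝ) :
    (ψ x * (expDelta q0 σ z x t)ᴴ).det = Complex.I * rhoHat q0 z := by
  have hdet : ∀ y, (ψ y * (expDelta q0 σ z y t)ᴴ).det
      = (ψ y).det * star (Complex.exp (Complex.I * (delta2 q0 σ z y t : ℂ))) := by
    intro y
    rw [Matrix.det_mul, Matrix.det_conjTranspose, expDelta, Matrix.det_diagonal]
    congr 2
    have := Complex.exp_ne_zero (Complex.I * (delta1 q0 σ z y t : ℂ))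
    simp only [Fin.prod_univ_three]
    simp [Complex.exp_neg]
    field_simp
  have hd : ∀ y, HasDerivAt (fun y => (ψ y * (expDelta q0 σ z y t)ᴴ).det) 0 y := by
    intro y
    have e := fun i j => h.1 y i j
    have hE := (hasDerivAt_matrix.1 (hasDerivAt_expDelta q0 σ z y t) 1 1).star
    have hD : HasDerivAt (fun y => (ψ y).det) (-(Complex.I * kz q0 z) * (ψ y).det) y := by
      simp only [Matrix.det_fin_three]
      refine (((((((e 0 0).mul (e 1 1)).mul (e 2 2)).sub
        (((e 0 0).mul (e 1 2)).mul (e 2 1))).sub (((e 0 1).mul (e 1 0)).mul (e 2 2))).add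
        (((e 0 1).mul (e 1 2)).mul (e 2 0))).add (((e 0 2).mul (e 1 0)).mul (e 2 1))).sub
        (((e 0 2).mul (e 1 1)).mul (e 2 0)) |>.congr_deriv ?_
      simp only [Matrix.mul_apply, Fin.sum_univ_three, matX_eq]
      simp
      ring
    have h3 := hD.mul hE
    refine (h3.congr_deriv ?_).congr_of_eventuallyEq (Eventually.of_forall fun w => ?_)
    · simp [freeGen, expDelta]
      ring
    · exact (hdet w).trans (by simp [expDelta])
  have hc := fun y => is_const_of_deriv_eq_zero (fun x => (hd x).differentiableAt)
    (fun x => (hd x).deriv) x y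
  have hlim : Tendsto (fun y => (ψ y * (expDelta q0 σ z y t)ᴴ).det) l
      (𝓝 (matY q0 b z).det) := by
    have : Continuous fun A : Mat3 => A.det := continuous_id.matrix_det
    exact (this.tendsto _).comp h.tendsto_mul
  rw [← det_matY hq0 hb h0 h1 h2]
  exact tendsto_nhds_unique (tendsto_const_nhds.congr hc) hlim

end JostSolutions

/-! ### Scattering matrix, its symmetry, and coefficients as pairings -/

section Scattering

open scoped Matrix

variable {q0 σ z t : ℝ} {b : Vec2} {q : ℝ → ℝ → Vec2} {l : Filter ℝ}

/-- The first component of the `j`-th column. -/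
def colA (ψ : ℝ → Mat3) (j : Fin 3) (x : ℝ) : ℂ := ψ x 0 j

/-- The last two components of the `j`-th column. -/
def colV (ψ : ℝ → Mat3) (j : Fin 3) (x : ℝ) : Vec2 := !₂[ψ x 1 j, ψ x 2 j]

/-- The conserved indefinite pairing. -/
def pairing (a : ℂ) (v : Vec2) (a' : ℂ) (v' : Vec2) : ℂ := star a * a' - inner ℂ v v'

theorem inner_eq_components (v w : Vec2) :
    (inner ℂ v w : ℂ) = star (v 0) * w 0 + star (v 1) * w 1 := by
  rw [PiLp.inner_apply, Fin.sum_univ_two]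
  simp [mul_comm]

theorem star_pairing (a : ℂ) (v : Vec2) (a' : ℂ) (v' : Vec2) :
    star (pairing a v a' v') = pairing a' v' a v := by
  simp only [pairing, inner_eq_components, star_sub, star_add, star_mul', star_star]
  ring

theorem hasDerivAt_vec2 {v : ℝ → Vec2} {v' : Vec2} {x : ℝ}
    (h : ∀ i, HasDerivAt (fun y => v y i) (v' i) x) : HasDerivAt v v' x :=
  (PiLp.continuousLinearEquiv 2 ℝ (fun _ : Fin 2 => ℂ)).symm.hasFDerivAt.comp_hasDerivAt x
    (hasDerivAt_pi.2 h)

theorem tendsto_vec2 {α : Type*} {f : Filter α} {v : α → Vec2} {w : Vec2} :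
    Tendsto v f (𝓝 w) ↔ ∀ i, Tendsto (fun y => v y i) f (𝓝 (w i)) := by
  constructor
  · intro h i
    exact ((PiLp.continuous_apply 2 (fun _ : Fin 2 => ℂ) i).tendsto w).comp h
  · intro h
    have h1 : Tendsto (fun y => WithLp.ofLp (v y)) f (𝓝 (WithLp.ofLp w)) := tendsto_pi_nhds.2 h
    exact ((PiLp.continuous_toLp 2 (fun _ : Fin 2 => ℂ)).tendsto _).comp h1

theorem IsJost.isSol {ψ : ℝ → Mat3} (h : IsJost q0 σ q l b t z ψ) (j : Fin 3) :
    IsSol (kz q0 z) (fun x => q x t) (colA ψ j) (colV ψ j) := by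
  constructor
  · intro x
    refine (h.1 x 0 j).congr_deriv ?_
    rw [inner_eq_components]
    simp [Matrix.mul_apply, Fin.sum_univ_three, matX_eq, colA, colV]
    ring
  · intro x
    refine hasDerivAt_vec2 fun i => ?_
    fin_cases i
    · refine (h.1 x 1 j).congr_deriv ?_
      simp [Matrix.mul_apply, Fin.sum_univ_three, matX_eq, colA, colV]
      ring
    · refine (h.1 x 2 j).congr_deriv ?_
      simp [Matrix.mul_apply, Fin.sum_univ_three, matX_eq, colA, colV]
      ring

theorem pairing_col (ψ φ : ℝ → Mat3) (i j : Fin 3) (x : ℝ) :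
    pairing (colA ψ i x) (colV ψ i x) (colA φ j x) (colV φ j x)
      = ((ψ x)ᴴ * matJ * φ x) i j := by
  rw [pairing, inner_eq_components, matJ_eq]
  simp [Matrix.mul_apply, Fin.sum_univ_three, colA, colV]
  ring

/-- The Jost solutions at both ends, as provided by the decay of the potential. -/
structure JostPair (q0 σ : ℝ) (q : ℝ → ℝ → Vec2) (qm qp : Vec2) (t z : ℝ) : Prop where
  q0_pos : 0 < q0
  norm_m : ‖qm‖ = q0
  norm_p : ‖qp‖ = q0
  ne_zero : z ≠ 0
  ne_q0 : z ≠ q0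
  ne_neg : z ≠ -q0
  isJost_m : IsJost q0 σ q atBot qm t z (jost q0 σ q atBot qm t z)
  isJost_p : IsJost q0 σ q atTop qp t z (jost q0 σ q atTop qp t z)

variable {qm qp : Vec2}

/-- The inverse of ψ₋ is its Gram inverse times ψ₋†J, so the only candidate is a constant multiple
of the conserved pairing ψ₋†Jψ₊. -/
theorem JostPair.existsUnique_scattering (h : JostPair q0 σ q qm qp t z) :
    ∃! H, IsScattering q0 σ q qm qp t z H := by
  have hi := h.isJost_m.left_inv h.q0_pos h.norm_m h.ne_zero h.ne_q0 h.ne_neg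
  refine ⟨gramInv q0 z * ((jost q0 σ q atBot qm t z 0)ᴴ * matJ * jost q0 σ q atTop qp t z 0),
    fun x => ?_, fun H hH => ?_⟩
  · rw [pairing_const h.isJost_m.hasDerivAt h.isJost_p.hasDerivAt 0 x]
    calc jost q0 σ q atTop qp t z x = 1 * jost q0 σ q atTop qp t z x := (one_mul _).symm
      _ = _ := by rw [← mul_eq_one_comm.1 (hi x)]; noncomm_ring
  · have e := hH 0
    rw [e]
    calc H = gramInv q0 z * ((jost q0 σ q atBot qm t z 0)ᴴ * matJ)
          * jost q0 σ q atBot qm t z 0 * H := by rw [hi 0, one_mul]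
      _ = _ := by simp only [mul_assoc]

theorem JostPair.isScattering (h : JostPair q0 σ q qm qp t z) :
    IsScattering q0 σ q qm qp t z (matH q0 σ q qm qp t z) :=
  Classical.epsilon_spec h.existsUnique_scattering.exists

theorem JostPair.gram_mul (h : JostPair q0 σ q qm qp t z) (x : ℝ) :
    gram q0 z * matH q0 σ q qm qp t z
      = (jost q0 σ q atBot qm t z x)ᴴ * matJ * jost q0 σ q atTop qp t z x := by
  rw [h.isScattering x, ← h.isJost_m.gram_eq h.q0_pos h.norm_m h.ne_zero h.ne_q0 h.ne_neg x]
  noncomm_ring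

theorem JostPair.det_eq_one (h : JostPair q0 σ q qm qp t z) :
    (matH q0 σ q qm qp t z).det = 1 := by
  have h1 := h.isJost_m.det_eq h.q0_pos h.norm_m h.ne_zero h.ne_q0 h.ne_neg 0
  have h2 := h.isJost_p.det_eq h.q0_pos h.norm_p h.ne_zero h.ne_q0 h.ne_neg 0
  have hr : Complex.I * (rhoHat q0 z : ℂ) ≠ 0 := mul_ne_zero Complex.I_ne_zero
    (by exact_mod_cast rhoHat_ne_zero h.ne_zero h.ne_q0 h.ne_neg)
  rw [h.isScattering 0, Matrix.det_mul, Matrix.det_mul] at h2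
  rw [Matrix.det_mul] at h1
  have h3 : (Complex.I * (rhoHat q0 z : ℂ)) * (matH q0 σ q qm qp t z).det
      = (Complex.I * (rhoHat q0 z : ℂ)) * 1 := by
    rw [mul_one]
    nth_rewrite 2 [← h2]
    rw [← h1]; ring
  exact mul_left_cancel₀ hr h3

/-- Both Jost solutions have the same Gram matrix G, whence H†GH = G. This reduces both reflection
coefficients to the first column of H. -/
theorem JostPair.matS_eq (h : JostPair q0 σ q qm qp t z) :
    matS q0 σ q qm qp t z = gramInv q0 z * (matH q0 σ q qm qp t z)ᴴ * gram q0 z := by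
  refine Matrix.inv_eq_left_inv ?_
  have h1 := h.isJost_p.gram_eq h.q0_pos h.norm_p h.ne_zero h.ne_q0 h.ne_neg 0
  have h2 := h.isJost_m.gram_eq h.q0_pos h.norm_m h.ne_zero h.ne_q0 h.ne_neg 0
  rw [h.isScattering 0, Matrix.conjTranspose_mul] at h1
  rw [← gramInv_mul_gram h.ne_zero h.ne_q0 h.ne_neg]
  nth_rewrite 2 [← h1]
  rw [← h2]
  noncomm_ring

theorem JostPair.matS_zero_zero (h : JostPair q0 σ q qm qp t z) :
    matS q0 σ q qm qp t z 0 0 = star (matH q0 σ q qm qp t z 0 0) := by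
  have hr : (rhoHat q0 z : ℂ) ≠ 0 := by
    exact_mod_cast rhoHat_ne_zero h.ne_zero h.ne_q0 h.ne_neg
  rw [h.matS_eq]
  simp [gram, gramInv]
  field_simp

theorem JostPair.matS_zero_two (h : JostPair q0 σ q qm qp t z) :
    matS q0 σ q qm qp t z 0 2 = -star (matH q0 σ q qm qp t z 2 0) := by
  have hr : (rhoHat q0 z : ℂ) ≠ 0 := by
    exact_mod_cast rhoHat_ne_zero h.ne_zero h.ne_q0 h.ne_neg
  rw [h.matS_eq]
  simp [gram, gramInv]
  field_simp

theorem JostPair.norm_beta1 (h : JostPair q0 σ q qm qp t z) :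
    ‖beta1 q0 σ q qm qp t z‖
      = ‖matH q0 σ q qm qp t z 2 0‖ / ‖matH q0 σ q qm qp t z 0 0‖ := by
  rw [beta1, h.matS_zero_zero, h.matS_zero_two, norm_div, norm_neg, norm_star, norm_star]

/-- The right side is free of x, so an entry of H may be read off at either end or at x = 0,
whichever is best controlled. -/
theorem JostPair.pairing_eq (h : JostPair q0 σ q qm qp t z) (i j : Fin 3) (x : ℝ) :
    pairing (colA (jost q0 σ q atBot qm t z) i x) (colV (jost q0 σ q atBot qm t z) i x)
      (colA (jost q0 σ q atTop qp t z) j x) (colV (jost q0 σ q atTop qp t z) j x)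
      = gram q0 z i i * matH q0 σ q qm qp t z i j := by
  rw [pairing_col, ← h.gram_mul x]
  simp [gram, Matrix.diagonal_mul]

/-- The unimodular factor of the `j`-th column of a Jost solution. -/
def phase (q0 σ z t : ℝ) (j : Fin 3) (x : ℝ) : ℂ := star (expDelta q0 σ z x t j j)

theorem norm_phase (q0 σ z t : ℝ) (j : Fin 3) (x : ℝ) : ‖phase q0 σ z t j x‖ = 1 := by
  rw [phase, norm_star]
  fin_cases j <;> simp [expDelta, Complex.norm_exp]

theorem phase_zero_eq (q0 σ z t x : ℝ) :
    phase q0 σ z t 0 x = phase q0 σ z t 0 0 * osc (-lamz q0 z) x := by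
  simp only [phase, expDelta, Matrix.diagonal_apply_eq, osc, Complex.star_def]
  simp [← Complex.exp_add, delta1, ← Complex.exp_conj]
  ring_nf

theorem phase_one_eq (q0 σ z t x : ℝ) :
    phase q0 σ z t 1 x = phase q0 σ z t 1 0 * osc (kz q0 z) x := by
  simp only [phase, expDelta, Matrix.diagonal_apply_eq, osc, Complex.star_def]
  simp [← Complex.exp_add, delta2, ← Complex.exp_conj]
  ring_nf

theorem phase_two_eq (q0 σ z t x : ℝ) :
    phase q0 σ z t 2 x = phase q0 σ z t 2 0 * osc (lamz q0 z) x := by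
  simp only [phase, expDelta, Matrix.diagonal_apply_eq, osc, Complex.star_def]
  simp [← Complex.exp_add, delta1, ← Complex.exp_conj]
  ring_nf

/-- The lower part of the `j`-th column of `matY`. -/
def vecY (q0 : ℝ) (b : Vec2) (z : ℝ) (j : Fin 3) : Vec2 := !₂[matY q0 b z 1 j, matY q0 b z 2 j]

theorem IsJost.tendsto_entry {ψ : ℝ → Mat3} (h : IsJost q0 σ q l b t z ψ) (i j : Fin 3) :
    Tendsto (fun x => phase q0 σ z t j x * ψ x i j) l (𝓝 (matY q0 b z i j)) := by
  refine (tendsto_matrix.1 h.tendsto_mul i j).congr fun x => ?_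
  rw [expDelta, Matrix.diagonal_conjTranspose, Matrix.mul_diagonal, mul_comm, phase, expDelta,
    Matrix.diagonal_apply_eq, Pi.star_apply]

theorem IsJost.tendsto_colA {ψ : ℝ → Mat3} (h : IsJost q0 σ q l b t z ψ) (j : Fin 3) :
    Tendsto (fun x => phase q0 σ z t j x * colA ψ j x) l (𝓝 (matY q0 b z 0 j)) :=
  h.tendsto_entry 0 j

theorem IsJost.tendsto_colV {ψ : ℝ → Mat3} (h : IsJost q0 σ q l b t z ψ) (j : Fin 3) :
    Tendsto (fun x => phase q0 σ z t j x • colV ψ j x) l (𝓝 (vecY q0 b z j)) := by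
  rw [tendsto_vec2]
  intro i
  fin_cases i
  · exact h.tendsto_entry 1 j
  · exact h.tendsto_entry 2 j

theorem IsJost.tendsto_upC {ψ : ℝ → Mat3} (h : IsJost q0 σ q l b t z ψ) (j : Fin 3) (ζ : ℝ)
    (hq : Tendsto (fun x => q x t) l (𝓝 b)) :
    Tendsto (fun x => phase q0 σ z t j x * upC ζ (fun x => q x t) (colA ψ j) (colV ψ j) x) l
      (𝓝 (matY q0 b z 0 j - inner ℂ b (vecY q0 b z j) / ζ)) := by
  refine ((h.tendsto_colA j).sub ((hq.inner (𝕜 := ℂ) (h.tendsto_colV j)).div_const _)).congr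
    fun x => ?_
  rw [upC, inner_smul_right]
  ring

theorem IsJost.tendsto_loC {ψ : ℝ → Mat3} (h : IsJost q0 σ q l b t z ψ) (j : Fin 3) (ζ : ℝ)
    (hq : Tendsto (fun x => q x t) l (𝓝 b)) :
    Tendsto (fun x => phase q0 σ z t j x • loC ζ (fun x => q x t) (colA ψ j) (colV ψ j) x) l
      (𝓝 (vecY q0 b z j - (matY q0 b z 0 j / ζ) • b)) := by
  refine ((h.tendsto_colV j).sub (((h.tendsto_colA j).div_const _).smul hq)).congr fun x => ?_
  rw [loC, smul_sub, smul_smul, mul_div_assoc]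

theorem tendsto_energy_of_phase {ζ : ℝ} {p : ℝ → Vec2} {a : ℝ → ℂ} {v : ℝ → Vec2} {e : ℝ → ℂ}
    (he : ∀ x, ‖e x‖ = 1) {A : ℂ} {V : Vec2}
    (h1 : Tendsto (fun x => e x * upC ζ p a v x) l (𝓝 A))
    (h2 : Tendsto (fun x => e x • loC ζ p a v x) l (𝓝 V)) :
    Tendsto (energy ζ p a v) l (𝓝 (‖A‖ ^ 2 + ‖V‖ ^ 2)) := by
  refine ((h1.norm.pow 2).add (h2.norm.pow 2)).congr fun x => ?_
  rw [norm_mul, norm_smul, he, one_mul, one_mul, energy]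

theorem tendsto_zero_of_phase {f : ℝ → ℂ} {e : ℝ → ℂ} (he : ∀ x, ‖e x‖ = 1)
    (h1 : Tendsto (fun x => e x * f x) l (𝓝 0)) : Tendsto f l (𝓝 0) := by
  rw [tendsto_zero_iff_norm_tendsto_zero] at h1 ⊢
  refine h1.congr fun x => ?_
  rw [norm_mul, he, one_mul]

theorem inner_perp_self (v : Vec2) : (inner ℂ v (perp v) : ℂ) = 0 := by
  rw [inner_eq_components]; simp [perp]; ring

theorem inner_perp_self' (v : Vec2) : (inner ℂ (perp v) v : ℂ) = 0 := by
  rw [inner_eq_components]; simp [perp]; ring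

theorem norm_perp (v : Vec2) : ‖perp v‖ = ‖v‖ := by
  rw [EuclideanSpace.norm_eq, EuclideanSpace.norm_eq, Fin.sum_univ_two, Fin.sum_univ_two]
  simp [perp, add_comm]

theorem vecY_zero (q0 : ℝ) (b : Vec2) (z : ℝ) :
    vecY q0 b z 0 = (rhoHat q0 z * Complex.I / z : ℂ) • b := by
  ext i; fin_cases i <;> simp [vecY, matY] <;> ring

theorem vecY_one (q0 : ℝ) (b : Vec2) (z : ℝ) :
    vecY q0 b z 1 = (1 / q0 : ℂ) • perp b := by
  ext i; fin_cases i <;> simp [vecY, matY] <;> ring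

theorem vecY_two (q0 : ℝ) (b : Vec2) (z : ℝ) :
    vecY q0 b z 2 = (rhoHat q0 z / q0 : ℂ) • b := by
  ext i; fin_cases i <;> simp [vecY, matY] <;> ring

/-- The pairing with a solution of upper type is read off from the upper component. -/
theorem tendsto_phase_mul_upC {ζ : ℝ} {p : ℝ → Vec2} {a a' : ℝ → ℂ} {v v' : ℝ → Vec2} {e : ℝ → ℂ}
    {A P : ℂ} {C : ℝ} (hA : A ≠ 0) (he : ∀ x, ‖e x‖ = 1) (hp : Tendsto p l (𝓝 b))
    (ha : ∀ x, ‖a x‖ ≤ C) (hv : ∀ x, ‖v x‖ ≤ C)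
    (ha' : Tendsto (fun x => e x * a' x) l (𝓝 A))
    (hv' : Tendsto (fun x => e x • v' x) l (𝓝 ((A / ζ) • b)))
    (hP : ∀ x, pairing (a' x) (v' x) (a x) (v x) = P) :
    Tendsto (fun x => e x * upC ζ p a v x) l (𝓝 (P / star A)) := by
  have hA' : star A ≠ 0 := star_ne_zero.2 hA
  have h1 : Tendsto (fun x => e x * a' x - A) l (𝓝 0) := tendsto_sub_nhds_zero_iff.2 ha'
  -- A column asymptotic to A(1, p/ζ) pairs with (a, v) to A*(a − ⟨p,v⟩/ζ), which is A* times `upC`;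
  -- the errors are tested against bounded a and v.
  have h2 : Tendsto (fun x => e x • v' x - (A / ζ) • p x) l (𝓝 0) := by
    have := hv'.sub (hp.const_smul (A / ζ : ℂ))
    rwa [sub_self] at this
  have h3 : Tendsto (fun x => star (e x * a' x - A) * (e x * a x)
      - inner ℂ (e x • v' x - (A / ζ) • p x) (e x • v x)) l (𝓝 0) := by
    have hb : Tendsto (fun x => ‖e x * a' x - A‖ * C + ‖e x • v' x - (A / ζ : ℂ) • p x‖ * C) l
        (𝓝 0) := by
      have := (h1.norm.mul_const C).add (h2.norm.mul_const C)
      simpa using this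
    refine squeeze_zero_norm (fun x => ?_) hb
    refine (norm_sub_le _ _).trans (add_le_add ?_ ?_)
    · rw [norm_mul, norm_star, norm_mul (e x), he, one_mul]
      gcongr
      exact ha x
    · refine (norm_inner_le' _ _).trans ?_
      rw [norm_smul (e x) (v x), he, one_mul]
      gcongr
      exact hv x
  have h4 := (h3.const_sub P).div_const (star A)
  rw [sub_zero] at h4
  refine h4.congr fun x => ?_
  have hee : star (e x) * e x = 1 := by
    rw [Complex.star_def, mul_comm, Complex.mul_conj, Complex.normSq_eq_norm_sq, he]; norm_num
  rw [div_eq_iff hA', ← hP x]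
  simp only [pairing, upC, inner_sub_left, inner_smul_left, inner_smul_right, star_sub, star_mul',
    Complex.star_def, map_div₀, Complex.conj_ofReal] at hee ⊢
  linear_combination (inner ℂ (v' x) (v x) - (starRingEnd ℂ) (a' x) * a x) * hee

theorem IsSol.smul {k : ℝ} {p : ℝ → Vec2} {a : ℝ → ℂ} {v : ℝ → Vec2} (h : IsSol k p a v) (c : ℂ) :
    IsSol k p (fun x => c * a x) (fun x => c • v x) := by
  constructor
  · intro x
    refine ((h.da x).const_mul c).congr_deriv ?_
    rw [inner_smul_right]; ring
  · intro x
    refine ((h.dv x).const_smul c).congr_deriv ?_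
    rw [smul_add, smul_smul, smul_smul, smul_smul]
    congr 2 <;> ring

theorem upC_smul (ζ : ℝ) (p : ℝ → Vec2) (a : ℝ → ℂ) (v : ℝ → Vec2) (c : ℂ) (x : ℝ) :
    upC ζ p (fun x => c * a x) (fun x => c • v x) x = c * upC ζ p a v x := by
  simp only [upC, inner_smul_right]; ring

theorem loC_smul (ζ : ℝ) (p : ℝ → Vec2) (a : ℝ → ℂ) (v : ℝ → Vec2) (c : ℂ) (x : ℝ) :
    loC ζ p (fun x => c * a x) (fun x => c • v x) x = c • loC ζ p a v x := by
  simp only [loC, smul_sub, smul_smul, mul_div_assoc]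

theorem pairing_smul_left (c a : ℂ) (v : Vec2) (a' : ℂ) (v' : Vec2) :
    pairing (c * a) (c • v) a' v' = star c * pairing a v a' v' := by
  simp only [pairing, inner_smul_left, star_mul', Complex.star_def]; ring

theorem pairing_smul_right (c a : ℂ) (v : Vec2) (a' : ℂ) (v' : Vec2) :
    pairing a v (c * a') (c • v') = c * pairing a v a' v' := by
  simp only [pairing, inner_smul_right]; ring

end Scattering

/-! ### The first column of H as z → ∞ -/

section LargeParameter

open scoped Matrix

/-- The analytic data of the scattering problem at a fixed time. -/
structure Setting (q0 σ t M : ℝ) (q : ℝ → ℝ → Vec2) (qm qp : Vec2) (p₁ p₂ : ℝ → Vec2) :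
    Prop where
  pot : Pot q0 M (fun x => q x t) p₁ p₂
  endp : PotEnd q0 (fun x => q x t) p₁ (Set.Ici 0) atTop qp
  endm : PotEnd q0 (fun x => q x t) p₁ (Set.Iic 0) atBot qm
  jp : ∀ z, z ≠ 0 → z ≠ q0 → z ≠ -q0 → JostPair q0 σ q qm qp t z

section Limits

variable {q0 σ z t : ℝ} {b : Vec2} {q : ℝ → ℝ → Vec2} {l : Filter ℝ} {ψ : ℝ → Mat3}

theorem IsJost.tendsto_upC_zero (h : IsJost q0 σ q l b t z ψ) (hb : ‖b‖ = q0) (ζ : ℝ)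
    (hq : Tendsto (fun x => q x t) l (𝓝 b)) :
    Tendsto (fun x => phase q0 σ z t 0 x * upC ζ (fun x => q x t) (colA ψ 0) (colV ψ 0) x) l
      (𝓝 (rhoHat q0 z * Complex.I * (1 - q0 ^ 2 / (z * ζ)))) := by
  convert h.tendsto_upC 0 ζ hq using 2
  rw [vecY_zero, inner_smul_right, inner_self_ofReal, hb]
  simp [matY]
  ring

theorem IsJost.tendsto_loC_zero (h : IsJost q0 σ q l b t z ψ) (ζ : ℝ)
    (hq : Tendsto (fun x => q x t) l (𝓝 b)) :
    Tendsto (fun x => phase q0 σ z t 0 x • loC ζ (fun x => q x t) (colA ψ 0) (colV ψ 0) x) l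
      (𝓝 ((rhoHat q0 z * Complex.I * (1 / z - 1 / ζ) : ℂ) • b)) := by
  convert h.tendsto_loC 0 ζ hq using 2
  rw [vecY_zero, ← sub_smul]
  simp [matY]
  ring_nf

theorem IsJost.tendsto_upC_one (h : IsJost q0 σ q l b t z ψ) (ζ : ℝ)
    (hq : Tendsto (fun x => q x t) l (𝓝 b)) :
    Tendsto (fun x => phase q0 σ z t 1 x * upC ζ (fun x => q x t) (colA ψ 1) (colV ψ 1) x) l
      (𝓝 0) := by
  convert h.tendsto_upC 1 ζ hq using 2
  rw [vecY_one, inner_smul_right, inner_perp_self]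
  simp [matY]

theorem IsJost.tendsto_loC_one (h : IsJost q0 σ q l b t z ψ) (ζ : ℝ)
    (hq : Tendsto (fun x => q x t) l (𝓝 b)) :
    Tendsto (fun x => phase q0 σ z t 1 x • loC ζ (fun x => q x t) (colA ψ 1) (colV ψ 1) x) l
      (𝓝 ((1 / q0 : ℂ) • perp b)) := by
  convert h.tendsto_loC 1 ζ hq using 2
  rw [vecY_one]
  simp [matY]

theorem IsJost.tendsto_upC_two (h : IsJost q0 σ q l b t z ψ) (hb : ‖b‖ = q0) (ζ : ℝ)
    (hq : Tendsto (fun x => q x t) l (𝓝 b)) :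
    Tendsto (fun x => phase q0 σ z t 2 x * upC ζ (fun x => q x t) (colA ψ 2) (colV ψ 2) x) l
      (𝓝 (rhoHat q0 z * (q0 / z - q0 ^ 2 / (q0 * ζ)))) := by
  convert h.tendsto_upC 2 ζ hq using 2
  rw [vecY_two, inner_smul_right, inner_self_ofReal, hb]
  simp [matY]
  ring

theorem IsJost.tendsto_loC_two (h : IsJost q0 σ q l b t z ψ) (ζ : ℝ)
    (hq : Tendsto (fun x => q x t) l (𝓝 b)) :
    Tendsto (fun x => phase q0 σ z t 2 x • loC ζ (fun x => q x t) (colA ψ 2) (colV ψ 2) x) l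
      (𝓝 ((rhoHat q0 z * (1 / q0 - q0 / (z * ζ)) : ℂ) • b)) := by
  convert h.tendsto_loC 2 ζ hq using 2
  rw [vecY_two, ← sub_smul]
  simp [matY]
  ring_nf

end Limits

variable {q0 σ t M : ℝ} {q : ℝ → ℝ → Vec2} {qm qp : Vec2} {p₁ p₂ : ℝ → Vec2}

theorem tendsto_of_const_mul {l : Filter ℝ} {c A : ℂ} {f : ℝ → ℂ} (hc : ‖c‖ = 1)
    (h : Tendsto (fun x => c * f x) l (𝓝 A)) : Tendsto f l (𝓝 (star c * A)) := by
  refine (h.const_mul (star c)).congr fun x => ?_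
  have : star c * c = 1 := by
    rw [Complex.star_def, mul_comm, Complex.mul_conj, Complex.normSq_eq_norm_sq, hc]; norm_num
  rw [← mul_assoc, this, one_mul]

theorem norm_star_mul_of_norm_one {c : ℂ} (hc : ‖c‖ = 1) (A : ℂ) : ‖star c * A‖ = ‖A‖ := by
  rw [norm_mul, norm_star, hc, one_mul]

/-- The scattering coefficients of the first column for large `z`. -/
theorem Setting.scattering_large (S : Setting q0 σ t M q qm qp p₁ p₂) :
    ∃ C, 0 < C ∧ ∃ Z, 0 < Z ∧ ∀ z : ℝ, Z ≤ |z| →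
      ‖matH q0 σ q qm qp t z 0 0 - 1‖ ≤ C / |z| ∧
      ‖matH q0 σ q qm qp t z 1 0‖ ≤ C / |z| ^ 2 ∧
      ‖matH q0 σ q qm qp t z 2 0‖ ≤ C / |z| ^ 2 := by
  -- The limiting energies of all three columns used below equal 1.
  obtain ⟨C₁, hC₁, hb⟩ := S.pot.exists_bddSol 1
  obtain ⟨C₂, hC₂, hup⟩ := S.pot.norm_osc_mul_upC_sub_le hC₁
  obtain ⟨C₃, hC₃, hlow⟩ := S.pot.exists_lowSol 1
  obtain ⟨C₄, hC₄, hcp⟩ := S.pot.norm_limit_upper_le hC₃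
  have hq0 := S.pot.q0_pos
  have hM := S.pot.one_le
  refine ⟨C₂ + 2 * C₄, by positivity, 8 * M, by positivity, fun z hz => ?_⟩
  have hqM := S.pot.q0_le
  have hz0 : 0 < |z| := by linarith
  have hzne : z ≠ 0 := abs_pos.1 hz0
  have h1 : z ≠ q0 := fun h => by rw [h, abs_of_pos hq0] at hz; linarith
  have h2 : z ≠ -q0 := fun h => by rw [h, abs_neg, abs_of_pos hq0] at hz; linarith
  have J := S.jp z hzne h1 h2
  have hzc : (z : ℂ) ≠ 0 := by exact_mod_cast hzne
  have hqc : (q0 : ℂ) ≠ 0 := by exact_mod_cast hq0.ne'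
  have hs : (z : ℂ) ^ 2 - (q0 : ℂ) ^ 2 ≠ 0 := by exact_mod_cast sub_ne_zero_of_ne h1 h2
  have hr : (rhoHat q0 z : ℂ) = z ^ 2 / (z ^ 2 - q0 ^ 2) := by rw [rhoHat]; push_cast; rfl
  have hr0 : (rhoHat q0 z : ℂ) ≠ 0 := by exact_mod_cast rhoHat_ne_zero hzne h1 h2
  have hrle : ‖(rhoHat q0 z : ℂ)‖ ≤ 2 := by
    have h3 : (8 * q0) ^ 2 ≤ z ^ 2 := by
      rw [← sq_abs z]; gcongr; linarith
    rw [Complex.norm_real, Real.norm_eq_abs, rhoHat, abs_div, abs_of_nonneg (sq_nonneg z),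
      abs_of_pos (by nlinarith), div_le_iff₀ (by nlinarith)]
    nlinarith
  have hph : ∀ j x, ‖phase q0 σ z t j x‖ = 1 := fun j x => norm_phase _ _ _ _ _ _
  set ψm := jost q0 σ q atBot qm t z
  set ψp := jost q0 σ q atTop qp t z
  have e1 : (1 - (q0 : ℂ) ^ 2 / (z * z)) * rhoHat q0 z = 1 := by rw [hr]; field_simp
  have u0 := J.isJost_p.tendsto_upC_zero J.norm_p z S.endp.lim
  have l0 := J.isJost_p.tendsto_loC_zero z S.endp.lim
  have u1 := J.isJost_m.tendsto_upC_one z S.endm.lim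
  have l1 := J.isJost_m.tendsto_loC_one z S.endm.lim
  have u2 := J.isJost_m.tendsto_upC_two J.norm_m z S.endm.lim
  have l2 := J.isJost_m.tendsto_loC_two z S.endm.lim
  rw [show (rhoHat q0 z : ℂ) * Complex.I * (1 - q0 ^ 2 / (z * z)) = Complex.I by
    linear_combination Complex.I * e1] at u0
  rw [sub_self, mul_zero, zero_smul] at l0
  rw [show (rhoHat q0 z : ℂ) * (q0 / z - q0 ^ 2 / (q0 * z)) = 0 by field_simp; simp] at u2
  rw [show (rhoHat q0 z : ℂ) * (1 / q0 - q0 / (z * z)) = 1 / q0 by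
    rw [show (1 / q0 - q0 / (z * z) : ℂ) = 1 / q0 * (1 - q0 ^ 2 / (z * z)) by field_simp]
    linear_combination (1 / (q0 : ℂ)) * e1] at l2
  have n1 : ‖(1 / q0 : ℂ) • perp qm‖ = 1 := by
    rw [norm_smul, norm_perp, J.norm_m, norm_div, norm_one, Complex.norm_real,
      Real.norm_of_nonneg hq0.le]
    field_simp
  have n2 : ‖(1 / q0 : ℂ) • qm‖ = 1 := by
    rw [norm_smul, J.norm_m, norm_div, norm_one, Complex.norm_real, Real.norm_of_nonneg hq0.le]
    field_simp
  have B0 := hb z hz _ _ (J.isJost_p.isSol 0) atTop _ (by simp)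
    (tendsto_energy_of_phase (hph 0) u0 l0)
  have L1 := hlow z hz _ _ (J.isJost_m.isSol 1) atBot _ (by rw [n1]; simp)
    (tendsto_energy_of_phase (hph 1) u1 l1) (tendsto_zero_of_phase (hph 1) u1)
  have L2 := hlow z hz _ _ (J.isJost_m.isSol 2) atBot _ (by rw [n2]; simp)
    (tendsto_energy_of_phase (hph 2) u2 l2) (tendsto_zero_of_phase (hph 2) u2)
  have hA : matY q0 qp z 0 0 = rhoHat q0 z * Complex.I := by simp [matY]
  have hA' : matY q0 qm z 0 0 = rhoHat q0 z * Complex.I := by simp [matY]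
  have hAne : (rhoHat q0 z : ℂ) * Complex.I ≠ 0 := mul_ne_zero hr0 Complex.I_ne_zero
  have hstarA : star ((rhoHat q0 z : ℂ) * Complex.I) = -(rhoHat q0 z * Complex.I) := by
    simp
  have ap := J.isJost_p.tendsto_colA 0
  have vp := J.isJost_p.tendsto_colV 0
  have am := J.isJost_m.tendsto_colA 0
  have vm := J.isJost_m.tendsto_colV 0
  rw [hA] at ap
  rw [hA'] at am
  rw [vecY_zero] at vp vm
  -- The first column of ψ₊ is of upper type at +∞, so its pairing with a low column of ψ₋ reads off
  -- the upper component of the latter at the end where it is not normalised. The pairing appears in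
  -- reversed order, hence the conjugate.
  have key : ∀ j : Fin 3, LowSol q0 C₃ z (fun x => q x t) (colA ψm j) (colV ψm j) →
      Tendsto (upC z (fun x => q x t) (colA ψm j) (colV ψm j)) atBot (𝓝 0) →
      ‖gram q0 z j j * matH q0 σ q qm qp t z j 0‖ ≤ ‖(rhoHat q0 z : ℂ)‖ * (C₄ / |z| ^ 2) := by
    intro j hL hu
    have T := tendsto_phase_mul_upC (ζ := z) hAne (hph 0) S.endp.lim hL.a_le hL.v_le ap vp
      (fun x => (star_pairing _ _ _ _).symm.trans (congrArg star (J.pairing_eq j 0 x)))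
    have T' := tendsto_of_const_mul (hph 0 0) (T.congr fun x => by rw [phase_zero_eq, mul_assoc])
    have := hcp z hz _ _ hL atBot atTop S.endm.lim₁ S.endp.lim₁ hu _ T'
    rw [norm_star_mul_of_norm_one (hph 0 0), norm_div, norm_star, norm_star,
      norm_mul (rhoHat q0 z : ℂ) Complex.I, Complex.norm_I, mul_one,
      div_le_iff₀ (norm_pos_iff.2 hr0)] at this
    linarith
  refine ⟨?_, ?_, ?_⟩
  -- Here the roles are reversed: h₁₁ is the rotated upper component of the first column of ψ₊ at
  -- −∞, compared with its normalisation at +∞.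
  · have T := tendsto_phase_mul_upC (ζ := z) hAne (hph 0) S.endm.lim B0.a_le B0.v_le am vm
      (fun x => J.pairing_eq 0 0 x)
    have T1 := tendsto_of_const_mul (hph 0 0) (T.congr fun x => by rw [phase_zero_eq, mul_assoc])
    have T2 := tendsto_of_const_mul (hph 0 0) (u0.congr fun x => by rw [phase_zero_eq, mul_assoc])
    have h3 : ∀ x, _ ≤ C₂ / |z| := fun x => le_of_tendsto ((tendsto_const_nhds.sub T2).norm)
      (Eventually.of_forall fun y => hup z hz _ _ B0 x y)
    have h4 := le_of_tendsto ((T1.sub tendsto_const_nhds).norm) (Eventually.of_forall h3)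
    rw [← mul_sub, norm_star_mul_of_norm_one (hph 0 0), hstarA] at h4
    have e2 : gram q0 z 0 0 * matH q0 σ q qm qp t z 0 0 / -(rhoHat q0 z * Complex.I) - Complex.I
        = Complex.I * (matH q0 σ q qm qp t z 0 0 - 1) := by
      simp only [gram, Matrix.diagonal_apply_eq, Matrix.cons_val_zero]
      have hI := Complex.I_ne_zero
      field_simp
      rw [Complex.I_sq]; ring
    rw [e2, norm_mul, Complex.norm_I, one_mul] at h4
    refine h4.trans ?_
    gcongr
    linarith
  · have h3 := key 1 L1 (tendsto_zero_of_phase (hph 1) u1)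
    simp only [gram, Matrix.diagonal_apply_eq, Matrix.cons_val, norm_mul, norm_neg, norm_one,
      one_mul] at h3
    refine h3.trans ?_
    rw [mul_div_assoc']
    gcongr
    nlinarith
  · have h3 := key 2 L2 (tendsto_zero_of_phase (hph 2) u2)
    simp only [gram, Matrix.diagonal_apply_eq, Matrix.cons_val, norm_mul, norm_neg] at h3
    refine (le_of_mul_le_mul_left h3 (norm_pos_iff.2 hr0)).trans ?_
    gcongr
    linarith

end LargeParameter

/-! ### The first column of H as z → 0, through ζ = q₀²/z -/

section SmallParameter

open scoped Matrix

/-- Pythagoras in the orthogonal basis b, b^⊥ of ℂ². -/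
theorem norm_inner_sq_add (b w : Vec2) :
    ‖(inner ℂ b w : ℂ)‖ ^ 2 + ‖(inner ℂ (perp b) w : ℂ)‖ ^ 2 = ‖b‖ ^ 2 * ‖w‖ ^ 2 := by
  have h : ∀ c : ℂ, ((‖c‖ ^ 2 : ℝ) : ℂ) = c * star c := fun c => by
    rw [Complex.star_def, Complex.mul_conj, Complex.normSq_eq_norm_sq]
  apply Complex.ofReal_injective
  rw [Complex.ofReal_add, Complex.ofReal_mul, h, h, ← norm_sq_components b, ← norm_sq_components w,
    inner_eq_components, inner_eq_components]
  simp [perp]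
  ring

theorem norm_mul_le_inner_add (b w : Vec2) :
    ‖b‖ * ‖w‖ ≤ ‖(inner ℂ b w : ℂ)‖ + ‖(inner ℂ (perp b) w : ℂ)‖ := by
  have h := norm_inner_sq_add b w
  refine le_of_sq_le_sq ?_ (by positivity)
  nlinarith [mul_nonneg (norm_nonneg (inner ℂ b w : ℂ)) (norm_nonneg (inner ℂ (perp b) w : ℂ))]

theorem norm_inner_sub_inner_le (x y x' y' : Vec2) :
    ‖(inner ℂ x y - inner ℂ x' y' : ℂ)‖ ≤ ‖x - x'‖ * ‖y‖ + ‖x'‖ * ‖y - y'‖ := by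
  have e : (inner ℂ x y - inner ℂ x' y' : ℂ) = inner ℂ (x - x') y + inner ℂ x' (y - y') := by
    rw [inner_sub_left, inner_sub_right]; ring
  rw [e]
  exact (norm_add_le _ _).trans (add_le_add (norm_inner_le' _ _) (norm_inner_le' _ _))

theorem norm_osc_mul (c x : ℝ) (w : ℂ) : ‖osc c x * w‖ = ‖w‖ := by
  rw [norm_mul, norm_osc, one_mul]

section Ends

variable {q0 M : ℝ} {p p₁ p₂ : ℝ → Vec2} {s : Set ℝ} {l : Filter ℝ} {b : Vec2}

/-- The components along b and b^⊥ are estimated separately. The latter rotates with k instead of λ,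
but its limit is 0, so only its modulus matters. -/
theorem Pot.norm_lower_sub_le (H : Pot q0 M p p₁ p₂) (E : PotEnd q0 p p₁ s l b) {C : ℝ}
    (hC : 0 < C) :
    ∃ C', 0 < C' ∧ ∀ ζ : ℝ, 8 * M ≤ |ζ| → ∀ a v, LowSol q0 C ζ p a v →
      Tendsto (fun x => osc (lamz q0 ζ) x • loC ζ p a v x) l (𝓝 b) → ∀ x ∈ s,
      ‖osc (lamz q0 ζ) x • loC ζ p a v x - b‖ ≤ C' / |ζ| := by
  obtain ⟨C₁, hC₁, h₁⟩ := H.norm_inner_lower_sub_le E hC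
  obtain ⟨C₂, hC₂, h₂⟩ := H.norm_inner_perp_sub_le E (inner_perp_self' b) hC
  have hq := H.q0_pos
  refine ⟨(C₁ + C₂) / q0, by positivity, fun ζ hζ a v h hl x hx => ?_⟩
  have t1 : Tendsto (fun x => osc (lamz q0 ζ) x * inner ℂ b (loC ζ p a v x)) l
      (𝓝 (inner ℂ b b)) :=
    ((tendsto_const_nhds (x := b)).inner (𝕜 := ℂ) hl).congr fun x => inner_smul_right _ _ _
  have t2 : Tendsto (fun x => osc (kz q0 ζ) x * inner ℂ (perp b) (loC ζ p a v x)) l (𝓝 0) := by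
    have := (tendsto_const_nhds (x := perp b)).inner (𝕜 := ℂ) hl
    rw [inner_perp_self', tendsto_zero_iff_norm_tendsto_zero] at this
    rw [tendsto_zero_iff_norm_tendsto_zero]
    refine this.congr fun x => ?_
    rw [inner_smul_right, norm_osc_mul, norm_osc_mul]
  have b1 := h₁ ζ hζ a v h _ t1 x hx
  have b2 := h₂ ζ hζ a v h _ t2 x hx
  rw [sub_zero, norm_osc_mul] at b2
  have b3 := norm_mul_le_inner_add b (osc (lamz q0 ζ) x • loC ζ p a v x - b)
  rw [inner_sub_right, inner_smul_right, inner_sub_right, inner_smul_right, inner_perp_self',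
    sub_zero, norm_osc_mul, E.norm_b] at b3
  rw [div_div, mul_comm q0, ← div_div, le_div_iff₀ hq, add_div]
  linarith

theorem Pot.norm_lower_sub_perp_le (H : Pot q0 M p p₁ p₂) (E : PotEnd q0 p p₁ s l b) {C : ℝ}
    (hC : 0 < C) :
    ∃ C', 0 < C' ∧ ∀ ζ : ℝ, 8 * M ≤ |ζ| → ∀ a v, LowSol q0 C ζ p a v → ∀ c : ℂ,
      Tendsto (fun x => osc (kz q0 ζ) x • loC ζ p a v x) l (𝓝 (c • perp b)) →
      ‖loC ζ p a v 0 - c • perp b‖ ≤ C' / |ζ| := by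
  obtain ⟨C₁, hC₁, h₁⟩ := H.norm_inner_lower_sub_le E hC
  obtain ⟨C₂, hC₂, h₂⟩ := H.norm_inner_perp_sub_le E (inner_perp_self' b) hC
  have hq := H.q0_pos
  refine ⟨(C₁ + C₂) / q0, by positivity, fun ζ hζ a v h c hl => ?_⟩
  have t2 : Tendsto (fun x => osc (kz q0 ζ) x * inner ℂ (perp b) (loC ζ p a v x)) l
      (𝓝 (inner ℂ (perp b) (c • perp b))) :=
    ((tendsto_const_nhds (x := perp b)).inner (𝕜 := ℂ) hl).congr fun x => inner_smul_right _ _ _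
  have t1 : Tendsto (fun x => osc (lamz q0 ζ) x * inner ℂ b (loC ζ p a v x)) l (𝓝 0) := by
    have := (tendsto_const_nhds (x := b)).inner (𝕜 := ℂ) hl
    rw [inner_smul_right, inner_perp_self, mul_zero, tendsto_zero_iff_norm_tendsto_zero] at this
    rw [tendsto_zero_iff_norm_tendsto_zero]
    refine this.congr fun x => ?_
    rw [inner_smul_right, norm_osc_mul, norm_osc_mul]
  have b1 := h₁ ζ hζ a v h _ t1 0 E.zero_mem
  have b2 := h₂ ζ hζ a v h _ t2 0 E.zero_mem
  rw [sub_zero, norm_osc_mul] at b1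
  rw [osc_zero, one_mul] at b2
  have b3 := norm_mul_le_inner_add b (loC ζ p a v 0 - c • perp b)
  rw [inner_sub_right, inner_smul_right, inner_perp_self, mul_zero, sub_zero, inner_sub_right,
    E.norm_b] at b3
  rw [div_div, mul_comm q0, ← div_div, le_div_iff₀ hq, add_div]
  linarith

/-- The pairing of two low solutions is carried by the lower components. -/
theorem norm_pairing_add_le {C ζ : ℝ} (H : Pot q0 M p p₁ p₂) (hζ : 8 * M ≤ |ζ|) {a a' : ℝ → ℂ}
    {v v' : ℝ → Vec2} (h : LowSol q0 C ζ p a v) (h' : LowSol q0 C ζ p a' v') (x : ℝ) :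
    ‖pairing (a x) (v x) (a' x) (v' x) + inner ℂ (loC ζ p a v x) (loC ζ p a' v' x)‖
      ≤ C ^ 2 * (1 + 2 * M) / |ζ| ^ 2 := by
  have hM := H.one_le
  have hz : 0 < |ζ| := by linarith
  have hC : 0 ≤ C := (norm_nonneg _).trans (h.a_le x)
  have e2 : v x = loC ζ p a v x + (a x / ζ) • p x := by simp [loC]
  have e : pairing (a x) (v x) (a' x) (v' x) + inner ℂ (loC ζ p a v x) (loC ζ p a' v' x)
      = star (a x) * a' x - star (a x / ζ) * inner ℂ (p x) (v' x)
        - a' x / ζ * inner ℂ (loC ζ p a v x) (p x) := by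
    have : inner ℂ (loC ζ p a v x) (loC ζ p a' v' x)
        = inner ℂ (loC ζ p a v x) (v' x) - a' x / ζ * inner ℂ (loC ζ p a v x) (p x) := by
      conv_lhs => rw [loC.eq_1 ζ p a' v' x, inner_sub_right, inner_smul_right]
    rw [this, pairing]
    nth_rewrite 1 [e2]
    rw [inner_add_left, inner_smul_left, Complex.star_def]
    ring
  rw [e]
  have n1 : ‖star (a x) * a' x‖ ≤ C ^ 2 / |ζ| ^ 2 := by
    rw [norm_mul, norm_star]
    calc _ ≤ C / |ζ| * (C / |ζ|) := by gcongr; exacts [h.a_le' x, h'.a_le' x]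
      _ = _ := by ring
  have n2 : ‖star (a x / ζ) * inner ℂ (p x) (v' x)‖ ≤ C ^ 2 * M / |ζ| ^ 2 := by
    rw [norm_mul, norm_star, norm_div, Complex.norm_real, Real.norm_eq_abs]
    calc _ ≤ C / |ζ| / |ζ| * (M * C) := by
          gcongr
          · exact h.a_le' x
          · exact (norm_inner_le' _ _).trans (by gcongr; exacts [H.p_le x, h'.v_le x])
      _ = _ := by ring
  have n3 : ‖a' x / ζ * inner ℂ (loC ζ p a v x) (p x)‖ ≤ C ^ 2 * M / |ζ| ^ 2 := by
    rw [norm_mul, norm_div, Complex.norm_real, Real.norm_eq_abs]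
    calc _ ≤ C / |ζ| / |ζ| * (C * M) := by
          gcongr
          · exact h'.a_le' x
          · exact (norm_inner_le' _ _).trans (by gcongr; exacts [h.lo_le x, H.p_le x])
      _ = _ := by ring
  refine (norm_sub_le _ _).trans ((add_le_add ((norm_sub_le _ _).trans (add_le_add n1 n2))
    n3).trans (le_of_eq ?_))
  ring

theorem LowSol.mono {C C' ζ : ℝ} (hC : C ≤ C') {a : ℝ → ℂ} {v : ℝ → Vec2}
    (h : LowSol q0 C ζ p a v) : LowSol q0 C' ζ p a v :=
  ⟨h.toBddSol.mono hC, fun x => (h.a_le' x).trans (by gcongr)⟩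

end Ends

/-- Since the equation in x depends on z through k only, a Jost solution at small z is a solution
for the large parameter q₀²/z. -/
theorem kz_inv (q0 z : ℝ) (hq : q0 ≠ 0) : kz q0 (q0 ^ 2 / z) = kz q0 z := by
  unfold kz
  by_cases hz : z = 0
  · simp [hz]
  · field_simp; ring

theorem lamz_inv (q0 z : ℝ) (hq : q0 ≠ 0) : lamz q0 (q0 ^ 2 / z) = -lamz q0 z := by
  unfold lamz
  by_cases hz : z = 0
  · simp [hz]
  · field_simp; ring

/-- The time parts of δ₁ and δ₂ may each blow up as z → 0, but their negative powers of z cancel in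
the difference, which is O(z). So time does not enter the leading coefficient of h₂₁. -/
theorem norm_phase_ratio_sub_one_le {q0 σ z t : ℝ} (hq : 0 < q0) (hz : z ≠ 0) (hzq : |z| ≤ q0) :
    ‖star (phase q0 σ z t 0 0) * phase q0 σ z t 1 0 - 1‖
      ≤ |t| * (q0 + |σ| * (4 * q0 ^ 2)) * |z| := by
  have e : star (phase q0 σ z t 0 0) * phase q0 σ z t 1 0
      = osc (t * (z ^ 2 + σ * (z ^ 3 + 3 * z * q0 ^ 2))) 1 := by
    have e1 : delta1 q0 σ z 0 t - delta2 q0 σ z 0 t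
        = t * (z ^ 2 + σ * (z ^ 3 + 3 * z * q0 ^ 2)) := by
      unfold delta1 delta2 kz lamz; field_simp; ring
    rw [mul_comm, ← e1]
    simp only [phase, expDelta, Matrix.diagonal_apply_eq, osc, Complex.star_def]
    simp [← Complex.exp_add, ← Complex.exp_conj]
    ring_nf
  rw [e]
  refine (norm_osc_sub_one_le _ _).trans ?_
  rw [abs_one, mul_one, abs_mul]
  have h1 : |z ^ 2| ≤ q0 * |z| := by
    rw [abs_pow, sq]; gcongr
  have h2 : |z ^ 3 + 3 * z * q0 ^ 2| ≤ 4 * q0 ^ 2 * |z| := by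
    have e3 : z ^ 3 + 3 * z * q0 ^ 2 = (z ^ 2 + 3 * q0 ^ 2) * z := by ring
    rw [e3, abs_mul, abs_of_nonneg (by positivity)]
    gcongr
    have : z ^ 2 ≤ q0 ^ 2 := by rw [← sq_abs z]; gcongr
    linarith
  have h3 : |z ^ 2 + σ * (z ^ 3 + 3 * z * q0 ^ 2)| ≤ q0 * |z| + |σ| * (4 * q0 ^ 2 * |z|) :=
    calc _ ≤ |z ^ 2| + |σ| * |z ^ 3 + 3 * z * q0 ^ 2| := by
          rw [← abs_mul]; exact abs_add_le _ _
      _ ≤ _ := by gcongr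
  calc |t| * |z ^ 2 + σ * (z ^ 3 + 3 * z * q0 ^ 2)|
      ≤ |t| * (q0 * |z| + |σ| * (4 * q0 ^ 2 * |z|)) := by gcongr
    _ = _ := by ring

variable {q0 σ t M : ℝ} {q : ℝ → ℝ → Vec2} {qm qp : Vec2} {p₁ p₂ : ℝ → Vec2}

/-- For small `z`, the first columns of the Jost solutions are multiples of normalised low
solutions for the parameter `q0 ^ 2 / z`, which carry the scattering coefficients. -/
structure SmallSol (q0 σ : ℝ) (q : ℝ → ℝ → Vec2) (qm qp : Vec2) (t C z : ℝ)
    (am ap : ℝ → ℂ) (vm vp : ℝ → Vec2) : Prop where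
  low_m : LowSol q0 C (q0 ^ 2 / z) (fun x => q x t) am vm
  low_p : LowSol q0 C (q0 ^ 2 / z) (fun x => q x t) ap vp
  lim_m : Tendsto (fun x => osc (lamz q0 (q0 ^ 2 / z)) x •
    loC (q0 ^ 2 / z) (fun x => q x t) am vm x) atBot (𝓝 qm)
  lim_p : Tendsto (fun x => osc (lamz q0 (q0 ^ 2 / z)) x •
    loC (q0 ^ 2 / z) (fun x => q x t) ap vp x) atTop (𝓝 qp)
  near_m : ∀ x ∈ Set.Iic (0 : ℝ), ‖osc (lamz q0 (q0 ^ 2 / z)) x •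
    loC (q0 ^ 2 / z) (fun x => q x t) am vm x - qm‖ ≤ C / |q0 ^ 2 / z|
  near_p : ∀ x ∈ Set.Ici (0 : ℝ), ‖osc (lamz q0 (q0 ^ 2 / z)) x •
    loC (q0 ^ 2 / z) (fun x => q x t) ap vp x - qp‖ ≤ C / |q0 ^ 2 / z|
  h00 : matH q0 σ q qm qp t z 0 0
    = (z ^ 2 - q0 ^ 2) / q0 ^ 4 * pairing (am 0) (vm 0) (ap 0) (vp 0)

/-- In the frame of ζ = q₀²/z the first and second columns are low and the third is of upper type.
So h₃₁ is a limit of an upper component, whereas h₁₁ and h₂₁ are inner products of lower parts at x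
= 0. -/
theorem Setting.scattering_small (S : Setting q0 σ t M q qm qp p₁ p₂) :
    ∃ C, 0 < C ∧ ∀ z : ℝ, z ≠ 0 → |z| ≤ q0 ^ 2 / (8 * M) →
      8 * M ≤ |q0 ^ 2 / z| ∧ (∃ am ap vm vp, SmallSol q0 σ q qm qp t C z am ap vm vp) ∧
      ‖matH q0 σ q qm qp t z 2 0‖ ≤ C * |z| ^ 2 ∧
      ‖matH q0 σ q qm qp t z 1 0
        - -(Complex.I * z / q0 ^ 3) * inner ℂ (perp qm) qp‖ ≤ C * |z| ^ 2 := by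
  -- The limiting energies are q₀² for the normalised first columns and 1 for the second column.
  obtain ⟨C₁, hC₁, hlow⟩ := S.pot.exists_lowSol (1 + q0 ^ 2)
  obtain ⟨C₂, hC₂, hcp⟩ := S.pot.norm_limit_upper_le hC₁
  obtain ⟨C₃, hC₃, hnp⟩ := S.pot.norm_lower_sub_le S.endp hC₁
  obtain ⟨C₄, hC₄, hnm⟩ := S.pot.norm_lower_sub_le S.endm hC₁
  obtain ⟨C₅, hC₅, hgm⟩ := S.pot.norm_lower_sub_perp_le S.endm hC₁
  have hq0 := S.pot.q0_pos
  have hM := S.pot.one_le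
  have hqM := S.pot.q0_le
  set C₆ := 1 / q0 ^ 2 * (|t| * (q0 + |σ| * (4 * q0 ^ 2)) * q0
    + (C₁ ^ 2 * (1 + 2 * M) + C₅ * C₁ + C₃) / q0 ^ 2)
  have hC₆ : 0 ≤ C₆ := by positivity
  refine ⟨C₁ + C₂ / q0 ^ 5 + C₃ + C₄ + C₆, by positivity, fun z hz hzs => ?_⟩
  have hz0 : 0 < |z| := abs_pos.2 hz
  have hζ : 8 * M ≤ |q0 ^ 2 / z| := by
    rw [abs_div, abs_of_nonneg (sq_nonneg q0), le_div_iff₀ hz0]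
    rwa [le_div_iff₀ (by positivity), mul_comm] at hzs
  have hzq : |z| ≤ q0 / 8 := by
    refine hzs.trans ?_
    rw [div_le_div_iff₀ (by positivity) (by norm_num)]
    nlinarith
  have h1 : z ≠ q0 := fun h => by rw [h, abs_of_pos hq0] at hzq; linarith
  have h2 : z ≠ -q0 := fun h => by rw [h, abs_neg, abs_of_pos hq0] at hzq; linarith
  have J := S.jp z hz h1 h2
  have hζi : 1 / |q0 ^ 2 / z| = |z| / q0 ^ 2 := by
    rw [abs_div, abs_of_nonneg (sq_nonneg q0), one_div_div]
  set ζ := q0 ^ 2 / z with hζdef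
  have hζ0 : 0 < |ζ| := by linarith
  have hzc : (z : ℂ) ≠ 0 := by exact_mod_cast hz
  have hqc : (q0 : ℂ) ≠ 0 := by exact_mod_cast hq0.ne'
  have hζc : (ζ : ℂ) = q0 ^ 2 / z := by rw [hζdef]; push_cast; rfl
  have hs : (z : ℂ) ^ 2 - (q0 : ℂ) ^ 2 ≠ 0 := by exact_mod_cast sub_ne_zero_of_ne h1 h2
  have hr : (rhoHat q0 z : ℂ) = z ^ 2 / (z ^ 2 - q0 ^ 2) := by rw [rhoHat]; push_cast; rfl
  have hr0 : (rhoHat q0 z : ℂ) ≠ 0 := by exact_mod_cast rhoHat_ne_zero hz h1 h2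
  have hph : ∀ j x, ‖phase q0 σ z t j x‖ = 1 := fun j x => norm_phase _ _ _ _ _ _
  have hphs : ∀ j, star (phase q0 σ z t j 0) * phase q0 σ z t j 0 = 1 := fun j => by
    rw [Complex.star_def, mul_comm, Complex.mul_conj, Complex.normSq_eq_norm_sq, hph]; norm_num
  have hkz : kz q0 ζ = kz q0 z := kz_inv q0 z hq0.ne'
  have hlz : lamz q0 ζ = -lamz q0 z := lamz_inv q0 z hq0.ne'
  set ψm := jost q0 σ q atBot qm t z
  set ψp := jost q0 σ q atTop qp t z
  set θ := phase q0 σ z t 0 0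
  have hθ : θ ≠ 0 := norm_ne_zero_iff.1 (by rw [hph]; norm_num)
  have hθs : star θ ≠ 0 := star_ne_zero.2 hθ
  -- The limit of the rotated lower part of the first column is −(iz/q₀²)b. Dividing by this factor
  -- and by the conjugate of the phase at x = 0 makes the limit exactly b.
  set κ : ℂ := -(Complex.I * z / q0 ^ 2) * star θ with hκ
  have hI := Complex.I_ne_zero
  have hκ0 : κ ≠ 0 :=
    mul_ne_zero (neg_ne_zero.2 (div_ne_zero (mul_ne_zero hI hzc) (pow_ne_zero 2 hqc))) hθs
  have hnκ : ‖κ‖ = |z| / q0 ^ 2 := by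
    rw [hκ, norm_mul, norm_star, hph, norm_neg, norm_div, norm_mul, Complex.norm_I, norm_pow,
      Complex.norm_real, Complex.norm_real, Real.norm_eq_abs, Real.norm_of_nonneg hq0.le]
    ring
  set f : (ℝ → Mat3) → ℝ → ℂ := fun ψ x => κ⁻¹ * colA ψ 0 x
  set g : (ℝ → Mat3) → ℝ → Vec2 := fun ψ x => κ⁻¹ • colV ψ 0 x
  have zζ : (z : ℂ) * ζ = q0 ^ 2 := by rw [hζc]; field_simp
  have hc0 : (rhoHat q0 z * Complex.I * (1 / z - 1 / ζ) : ℂ) = -(Complex.I * z / q0 ^ 2) := by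
    rw [hζc, hr]; field_simp; ring
  have hup0 : (rhoHat q0 z * Complex.I * (1 - q0 ^ 2 / (z * ζ)) : ℂ) = 0 := by
    rw [zζ]; field_simp; simp
  have norm_aux : ∀ (l : Filter ℝ) [l.NeBot] (b : Vec2) (ψ : ℝ → Mat3),
      IsJost q0 σ q l b t z ψ → ‖b‖ = q0 → Tendsto (fun x => q x t) l (𝓝 b) →
      LowSol q0 C₁ ζ (fun x => q x t) (f ψ) (g ψ) ∧
      Tendsto (upC ζ (fun x => q x t) (f ψ) (g ψ)) l (𝓝 0) ∧
      Tendsto (fun x => osc (lamz q0 ζ) x • loC ζ (fun x => q x t) (f ψ) (g ψ) x) l (𝓝 b) := by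
    intro l _ b ψ hψ hb hl
    have u := hψ.tendsto_upC_zero hb ζ hl
    have w := hψ.tendsto_loC_zero ζ hl
    rw [hup0] at u
    rw [hc0] at w
    have u' : Tendsto (upC ζ (fun x => q x t) (f ψ) (g ψ)) l (𝓝 0) := by
      have := (tendsto_zero_of_phase (hph 0) u).const_mul κ⁻¹
      rw [mul_zero] at this
      exact this.congr fun x => (upC_smul _ _ _ _ _ _).symm
    have w' : Tendsto (fun x => osc (lamz q0 ζ) x • loC ζ (fun x => q x t) (f ψ) (g ψ) x) l
        (𝓝 b) := by
      have h3 := w.const_smul (star θ * κ⁻¹)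
      have e1 : (star θ * κ⁻¹) * -(Complex.I * z / q0 ^ 2) = 1 := by
        rw [hκ]; field_simp
      rw [smul_smul, e1, one_smul] at h3
      refine h3.congr fun x => ?_
      rw [show loC ζ (fun x => q x t) (f ψ) (g ψ) x = _ from loC_smul _ _ _ _ _ _, smul_smul,
        smul_smul, phase_zero_eq, hlz]
      congr 1
      linear_combination (κ⁻¹ * osc (-lamz q0 z) x) * hphs 0
    have hsol : IsSol (kz q0 ζ) (fun x => q x t) (f ψ) (g ψ) := by
      rw [hkz]; exact (hψ.isSol 0).smul κ⁻¹
    refine ⟨hlow ζ hζ _ _ hsol l _ ?_ (tendsto_energy_of_phase (e := osc (lamz q0 ζ))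
      (fun x => norm_osc _ x) (A := 0) ?_ w') u', u', w'⟩
    · rw [hb]; simp
    · rw [tendsto_zero_iff_norm_tendsto_zero] at u' ⊢
      exact u'.congr fun x => (norm_osc_mul _ _ _).symm
  obtain ⟨Lm, um, wm⟩ := norm_aux atBot qm ψm J.isJost_m J.norm_m S.endm.lim
  obtain ⟨Lp, up, wp⟩ := norm_aux atTop qp ψp J.isJost_p J.norm_p S.endp.lim
  have hcol : ∀ ψ x, colA ψ 0 x = κ * f ψ x ∧ colV ψ 0 x = κ • g ψ x := fun ψ x => by
    constructor
    · simp only [f]; field_simp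
    · simp only [g, smul_smul]; rw [mul_inv_cancel₀ hκ0, one_smul]
  refine ⟨hζ, ⟨f ψm, f ψp, g ψm, g ψp, ?_⟩, ?_, ?_⟩
  · refine ⟨Lm.mono ?_, Lp.mono ?_, wm, wp, fun x hx => (hnm ζ hζ _ _ Lm wm x hx).trans ?_,
      fun x hx => (hnp ζ hζ _ _ Lp wp x hx).trans ?_, ?_⟩
    · linarith [(by positivity : 0 ≤ C₂ / q0 ^ 5)]
    · linarith [(by positivity : 0 ≤ C₂ / q0 ^ 5)]
    · gcongr; linarith [(by positivity : 0 ≤ C₂ / q0 ^ 5)]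
    · gcongr; linarith [(by positivity : 0 ≤ C₂ / q0 ^ 5)]
    · have h3 := J.pairing_eq 0 0 0
      have hκκ : star κ * κ = z ^ 2 / q0 ^ 4 := by
        rw [Complex.star_def, mul_comm, Complex.mul_conj, Complex.normSq_eq_norm_sq, hnκ]
        push_cast
        rw [div_pow, ← Complex.ofReal_pow, sq_abs]
        push_cast
        ring
      rw [(hcol _ 0).1, (hcol _ 0).2, (hcol _ 0).1, (hcol _ 0).2, pairing_smul_left,
        pairing_smul_right, ← mul_assoc, hκκ] at h3
      simp only [gram, Matrix.diagonal_apply_eq, Matrix.cons_val_zero] at h3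
      rw [hr] at h3
      have h4 : matH q0 σ q qm qp t z 0 0 = (z ^ 2 - q0 ^ 2) / z ^ 2
          * (z ^ 2 / (z ^ 2 - q0 ^ 2) * matH q0 σ q qm qp t z 0 0) := by field_simp
      rw [h4, ← h3]
      field_simp
      rfl
  -- Since z ζ = q₀², the third column of Y is A(1, b/ζ) with A = ρq₀/z. Pairing with it reads off,
  -- at −∞, the upper component of the low column of ψ₊.
  · have hA : matY q0 qm z 0 2 = rhoHat q0 z * (q0 / z) := by simp [matY]
    have hAne : (rhoHat q0 z : ℂ) * (q0 / z) ≠ 0 := mul_ne_zero hr0 (div_ne_zero hqc hzc)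
    have am := J.isJost_m.tendsto_colA 2
    have vm := J.isJost_m.tendsto_colV 2
    rw [hA] at am
    rw [vecY_two, show (rhoHat q0 z / q0 : ℂ) = rhoHat q0 z * (q0 / z) / ζ by
      rw [hζc]; field_simp] at vm
    have hP : ∀ x, pairing (colA ψm 2 x) (colV ψm 2 x) (f ψp x) (g ψp x)
        = κ⁻¹ * (gram q0 z 2 2 * matH q0 σ q qm qp t z 2 0) := fun x => by
      rw [← J.pairing_eq 2 0 x, ← pairing_smul_right]
    have T := tendsto_phase_mul_upC (ζ := ζ) hAne (hph 2) S.endm.lim Lp.a_le Lp.v_le am vm hP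
    have T' := tendsto_of_const_mul (hph 2 0) (T.congr fun x => by rw [phase_two_eq, mul_assoc])
    have h3 : lamz q0 z = -lamz q0 ζ := by rw [hlz, neg_neg]
    rw [h3] at T'
    have h4 := hcp ζ hζ _ _ Lp atTop atBot S.endp.lim₁ S.endm.lim₁ up _ T'
    rw [norm_star_mul_of_norm_one (hph 2 0)] at h4
    have h5 : ‖κ⁻¹ * (gram q0 z 2 2 * matH q0 σ q qm qp t z 2 0)
        / star ((rhoHat q0 z : ℂ) * (q0 / z))‖ = ‖matH q0 σ q qm qp t z 2 0‖ * q0 := by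
      simp only [gram, Matrix.diagonal_apply_eq, Matrix.cons_val]
      rw [norm_div, norm_star, norm_mul, norm_mul, norm_mul, norm_inv, hnκ, norm_neg, norm_div,
        Complex.norm_real z, Complex.norm_real q0, Real.norm_eq_abs z, Real.norm_of_nonneg hq0.le]
      have : ‖(rhoHat q0 z : ℂ)‖ ≠ 0 := norm_ne_zero_iff.2 hr0
      field_simp
    rw [h5, ← le_div_iff₀ hq0] at h4
    have h6 : C₂ / |ζ| ^ 2 / q0 = C₂ / q0 ^ 5 * |z| ^ 2 := by
      rw [show C₂ / |ζ| ^ 2 = C₂ * (1 / |ζ|) ^ 2 by field_simp, hζi]; field_simp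
    rw [h6] at h4
    refine h4.trans ?_
    gcongr
    linarith
  · set a1 : ℝ → ℂ := fun x => phase q0 σ z t 1 0 * colA ψm 1 x
    set v1 : ℝ → Vec2 := fun x => phase q0 σ z t 1 0 • colV ψm 1 x
    have u := J.isJost_m.tendsto_upC_one ζ S.endm.lim
    have w := J.isJost_m.tendsto_loC_one ζ S.endm.lim
    have u' : Tendsto (upC ζ (fun x => q x t) a1 v1) atBot (𝓝 0) := by
      have := (tendsto_zero_of_phase (hph 1) u).const_mul (phase q0 σ z t 1 0)
      rw [mul_zero] at this
      exact this.congr fun x => (upC_smul _ _ _ _ _ _).symm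
    have w' : Tendsto (fun x => osc (kz q0 ζ) x • loC ζ (fun x => q x t) a1 v1 x) atBot
        (𝓝 ((1 / q0 : ℂ) • perp qm)) := by
      refine w.congr fun x => ?_
      rw [show loC ζ (fun x => q x t) a1 v1 x = _ from loC_smul _ _ _ _ _ _, smul_smul, hkz,
        phase_one_eq, mul_comm]
    have hsol : IsSol (kz q0 ζ) (fun x => q x t) a1 v1 := by
      rw [hkz]; exact (J.isJost_m.isSol 1).smul _
    have n1 : ‖(1 / q0 : ℂ) • perp qm‖ = 1 := by
      rw [norm_smul, norm_perp, J.norm_m, norm_div, norm_one, Complex.norm_real,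
        Real.norm_of_nonneg hq0.le]
      field_simp
    have L1 := hlow ζ hζ _ _ hsol atBot _ (by rw [n1]; simp; positivity)
      (tendsto_energy_of_phase (e := osc (kz q0 ζ)) (fun x => norm_osc _ x) (A := 0) (by
        rw [tendsto_zero_iff_norm_tendsto_zero] at u' ⊢
        exact u'.congr fun x => (norm_osc_mul _ _ _).symm) w') u'
    have b1 := hgm ζ hζ _ _ L1 _ w'
    have b2 := hnp ζ hζ _ _ Lp wp 0 (Set.mem_Ici.2 le_rfl)
    rw [osc_zero, one_smul] at b2
    have b3 := norm_pairing_add_le S.pot hζ L1 Lp 0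
    set P := pairing (a1 0) (v1 0) (f ψp 0) (g ψp 0)
    set c : ℂ := inner ℂ ((1 / q0 : ℂ) • perp qm) qp with hc
    have hcle : ‖c‖ ≤ q0 := (norm_inner_le' _ _).trans (by rw [n1, J.norm_p, one_mul])
    have hP : matH q0 σ q qm qp t z 1 0
        = Complex.I * z / q0 ^ 2 * (star θ * phase q0 σ z t 1 0 * P) := by
      have h3 := J.pairing_eq 1 0 0
      rw [(hcol ψp 0).1, (hcol ψp 0).2, pairing_smul_right] at h3
      simp only [gram, Matrix.diagonal_apply_eq, Matrix.cons_val] at h3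
      have h4 : P = star (phase q0 σ z t 1 0)
          * pairing (colA ψm 1 0) (colV ψm 1 0) (f ψp 0) (g ψp 0) := pairing_smul_left _ _ _ _ _
      rw [h4]
      have h5 : matH q0 σ q qm qp t z 1 0
        = -(κ * pairing (colA ψm 1 0) (colV ψm 1 0) (f ψp 0) (g ψp 0)) := by
        rw [h3]; ring
      rw [h5, hκ]
      linear_combination (-(Complex.I * z / q0 ^ 2 * star θ
        * pairing (colA ψm 1 0) (colV ψm 1 0) (f ψp 0) (g ψp 0))) * hphs 1
    -- At x = 0 each lower part is within O(1/ζ) of its boundary value, q_-^⊥/q₀ and q_+; the minus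
    -- sign is that of J on the lower block.
    have b4 : ‖P + c‖ ≤ (C₁ ^ 2 * (1 + 2 * M) + C₅ * C₁ + C₃) / |ζ| := by
      have e : P + c = (P + inner ℂ (loC ζ (fun x => q x t) a1 v1 0)
          (loC ζ (fun x => q x t) (f ψp) (g ψp) 0))
          - (inner ℂ (loC ζ (fun x => q x t) a1 v1 0) (loC ζ (fun x => q x t) (f ψp) (g ψp) 0)
            - c) := by ring
      rw [e, add_assoc, add_div]
      refine (norm_sub_le _ _).trans (add_le_add (b3.trans ?_) ?_)
      · gcongr
        nlinarith
      · refine (norm_inner_sub_inner_le _ _ _ _).trans ?_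
        rw [n1, one_mul, add_div]
        gcongr
        rw [mul_div_right_comm]
        gcongr
        exact Lp.lo_le 0
    have b5 := norm_phase_ratio_sub_one_le (σ := σ) (t := t) hq0 hz (by linarith : |z| ≤ q0)
    have e : matH q0 σ q qm qp t z 1 0 - -(Complex.I * z / q0 ^ 3) * inner ℂ (perp qm) qp
        = Complex.I * z / q0 ^ 2 * (star θ * phase q0 σ z t 1 0 * (P + c)
          - (star θ * phase q0 σ z t 1 0 - 1) * c) := by
      have : c = 1 / q0 * inner ℂ (perp qm) qp := by
        rw [hc, inner_smul_left]; simp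
      rw [hP, this]
      field_simp
      ring
    have n3 : ‖Complex.I * z / q0 ^ 2‖ = |z| * (1 / q0 ^ 2) := by
      rw [norm_div, norm_mul, Complex.norm_I, norm_pow, Complex.norm_real, Complex.norm_real,
        Real.norm_eq_abs, Real.norm_of_nonneg hq0.le]
      ring
    rw [e, norm_mul, n3]
    have n4 : ‖star θ * phase q0 σ z t 1 0 * (P + c)
          - (star θ * phase q0 σ z t 1 0 - 1) * c‖
        ≤ (C₁ ^ 2 * (1 + 2 * M) + C₅ * C₁ + C₃) * (|z| / q0 ^ 2)
          + |t| * (q0 + |σ| * (4 * q0 ^ 2)) * |z| * q0 := by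
      refine (norm_sub_le _ _).trans (add_le_add ?_ ?_)
      · rw [norm_mul, norm_mul, norm_star, hph, hph, one_mul, one_mul, ← hζi, mul_one_div]
        exact b4
      · rw [norm_mul]
        gcongr
    calc _ ≤ |z| * (1 / q0 ^ 2) * ((C₁ ^ 2 * (1 + 2 * M) + C₅ * C₁ + C₃) * (|z| / q0 ^ 2)
          + |t| * (q0 + |σ| * (4 * q0 ^ 2)) * |z| * q0) := by gcongr
      _ = C₆ * |z| ^ 2 := by simp only [C₆]; ring
      _ ≤ _ := by
        gcongr
        linarith [(by positivity : 0 ≤ C₂ / q0 ^ 5)]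

end SmallParameter

/-! ### Leading behaviour of h₁₁ at zero -/

section LeadingCoefficient

open scoped Matrix

variable {q0 σ t M : ℝ} {q : ℝ → ℝ → Vec2} {qm qp : Vec2} {p₁ p₂ : ℝ → Vec2}

theorem SmallSol.norm_pairing_add_inner_le (S : Setting q0 σ t M q qm qp p₁ p₂) {C z : ℝ}
    {am ap : ℝ → ℂ} {vm vp : ℝ → Vec2} (hC : 0 < C) (hζ : 8 * M ≤ |q0 ^ 2 / z|)
    (h : SmallSol q0 σ q qm qp t C z am ap vm vp) :
    ‖pairing (am 0) (vm 0) (ap 0) (vp 0) + inner ℂ qm qp‖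
      ≤ (C ^ 2 * (1 + 2 * M) + C * C + q0 * C) / |q0 ^ 2 / z| := by
  have hM := S.pot.one_le
  have b1 := norm_pairing_add_le S.pot hζ h.low_m h.low_p 0
  have b2 := h.near_m 0 (Set.mem_Iic.2 le_rfl)
  have b3 := h.near_p 0 (Set.mem_Ici.2 le_rfl)
  rw [osc_zero, one_smul] at b2 b3
  set ζ := q0 ^ 2 / z
  set x := loC ζ (fun x => q x t) am vm 0
  set y := loC ζ (fun x => q x t) ap vp 0
  have e : pairing (am 0) (vm 0) (ap 0) (vp 0) + inner ℂ qm qp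
      = (pairing (am 0) (vm 0) (ap 0) (vp 0) + inner ℂ x y) - (inner ℂ x y - inner ℂ qm qp) := by
    ring
  rw [e, add_assoc, add_div]
  refine (norm_sub_le _ _).trans (add_le_add (b1.trans ?_) ?_)
  · have hζ1 : 1 ≤ |ζ| := by linarith
    gcongr
    nlinarith
  · refine (norm_inner_sub_inner_le _ _ _ _).trans ?_
    rw [S.endm.norm_b, add_div, mul_div_right_comm, mul_div_assoc q0]
    have := S.pot.q0_pos
    gcongr
    exact h.low_p.lo_le 0

theorem one_div_abs_sq_div (q0 z : ℝ) : 1 / |q0 ^ 2 / z| = |z| / q0 ^ 2 := by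
  rw [abs_div, abs_of_nonneg (sq_nonneg q0), one_div_div]

theorem div_abs_sq_div (q0 z K : ℝ) : K / |q0 ^ 2 / z| = K / q0 ^ 2 * |z| := by
  rw [← mul_one_div, one_div_abs_sq_div]; ring

theorem div_abs_sq_div_sq (q0 z K : ℝ) : K / |q0 ^ 2 / z| ^ 2 = K / q0 ^ 4 * |z| ^ 2 := by
  rw [← mul_one_div, ← one_div_pow, one_div_abs_sq_div]; ring

theorem Pot.abs_le_q0 (H : Pot q0 M (fun x => q x t) p₁ p₂) {z : ℝ}
    (hz : |z| ≤ q0 ^ 2 / (8 * M)) : |z| ≤ q0 := by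
  have hM := H.one_le
  have hq := H.q0_pos
  refine hz.trans ?_
  rw [div_le_iff₀ (by positivity)]
  nlinarith [H.q0_le]

/-- The normalised pairing P is −q_-†q_+ up to O(z), and its prefactor (z² − q₀²)/q₀⁴ is −1/q₀² up
to O(z²). -/
theorem Setting.scattering_zero (S : Setting q0 σ t M q qm qp p₁ p₂) :
    ∃ C, 0 < C ∧ ∀ z : ℝ, z ≠ 0 → |z| ≤ q0 ^ 2 / (8 * M) →
      ‖matH q0 σ q qm qp t z 0 0 - inner ℂ qm qp / q0 ^ 2‖ ≤ C * |z| := by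
  obtain ⟨C, hC, h⟩ := S.scattering_small
  have hM := S.pot.one_le
  have hq := S.pot.q0_pos
  have hqc : (q0 : ℂ) ≠ 0 := by exact_mod_cast hq.ne'
  set K := C ^ 2 * (1 + 2 * M) + C * C + q0 * C
  have hK : 0 < K := by positivity
  refine ⟨q0 / q0 ^ 4 * (K + q0 * q0) + 1 / q0 ^ 2 * (K / q0 ^ 2), by positivity,
    fun z hz hzs => ?_⟩
  obtain ⟨hζ, ⟨am, ap, vm, vp, hs⟩, -, -⟩ := h z hz hzs
  have b := hs.norm_pairing_add_inner_le S hC hζ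
  set P := pairing (am 0) (vm 0) (ap 0) (vp 0)
  set i : ℂ := inner ℂ qm qp
  have hi : ‖i‖ ≤ q0 * q0 := (norm_inner_le' _ _).trans (by rw [S.endm.norm_b, S.endp.norm_b])
  have hP : ‖P‖ ≤ K + q0 * q0 := by
    have : P = (P + i) - i := by ring
    rw [this]
    refine (norm_sub_le _ _).trans (add_le_add (b.trans ?_) hi)
    exact div_le_self hK.le (by linarith)
  rw [div_abs_sq_div] at b
  have e : matH q0 σ q qm qp t z 0 0 - i / q0 ^ 2
      = (z ^ 2 / q0 ^ 4 : ℂ) * P - (1 / q0 ^ 2 : ℂ) * (P + i) := by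
    rw [hs.h00]; field_simp; ring
  have n1 : ‖(z ^ 2 / q0 ^ 4 : ℂ)‖ = |z| * |z| / q0 ^ 4 := by
    rw [norm_div, norm_pow, norm_pow, Complex.norm_real, Complex.norm_real, Real.norm_eq_abs,
      Real.norm_of_nonneg hq.le, sq]
  have n2 : ‖(1 / q0 ^ 2 : ℂ)‖ = 1 / q0 ^ 2 := by
    rw [norm_div, norm_pow, norm_one, Complex.norm_real, Real.norm_of_nonneg hq.le]
  rw [e]
  refine (norm_sub_le _ _).trans ?_
  rw [norm_mul, norm_mul, n1, n2]
  have hz0 := S.pot.abs_le_q0 hzs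
  calc _ ≤ q0 * |z| / q0 ^ 4 * (K + q0 * q0) + 1 / q0 ^ 2 * (K / q0 ^ 2 * |z|) := by gcongr
    _ = _ := by ring

theorem integrableOn_inner_mul_inner {p : ℝ → Vec2} {s : Set ℝ} (hp : Continuous p)
    (hM : ∀ x, ‖p x‖ ≤ M) {e b : Vec2} (he : (inner ℂ e b : ℂ) = 0)
    (hi : IntegrableOn (fun x => p x - b) s) (d : Vec2) :
    IntegrableOn (fun x => (inner ℂ e (p x) * inner ℂ (p x) d : ℂ)) s := by
  refine (hi.norm.const_mul (‖e‖ * (M * ‖d‖))).mono' (by fun_prop) (ae_of_all _ fun x => ?_)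
  have h1 : (inner ℂ e (p x) : ℂ) = inner ℂ e (p x - b) := by rw [inner_sub_right, he, sub_zero]
  rw [norm_mul, h1]
  have hM0 : 0 ≤ M := (norm_nonneg _).trans (hM 0)
  calc _ ≤ ‖e‖ * ‖p x - b‖ * (M * ‖d‖) := by
        gcongr
        · exact norm_inner_le' _ _
        · exact (norm_inner_le' _ _).trans (by gcongr; exact hM x)
    _ = _ := by ring

theorem Setting.continuous (S : Setting q0 σ t M q qm qp p₁ p₂) : Continuous fun x => q x t :=
  continuous_iff_continuousAt.2 fun x => (S.pot.hp x).continuousAt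

/-- The half-line integrals entering the orthogonal case add up to `ϑ₁`. -/
theorem Setting.exists_theta1 (S : Setting q0 σ t M q qm qp p₁ p₂)
    (ho : (inner ℂ qm qp : ℂ) = 0) : ∃ gp gm : ℂ,
      Tendsto (fun x => ∫ u in (0 : ℝ)..x, (inner ℂ qm (q u t) * inner ℂ (q u t) qp : ℂ)) atTop
        (𝓝 gp) ∧
      Tendsto (fun x => ∫ u in (0 : ℝ)..x, (inner ℂ qp (q u t) * inner ℂ (q u t) qm : ℂ)) atBot
        (𝓝 gm) ∧
      star (theta1 q qm qp t) = gp - star gm := by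
  have ho' : (inner ℂ qp qm : ℂ) = 0 := inner_eq_zero_symm.1 ho
  have ip : IntegrableOn (fun u => (inner ℂ qm (q u t) * inner ℂ (q u t) qp : ℂ)) (Set.Ioi 0) :=
    (integrableOn_inner_mul_inner S.continuous S.pot.p_le ho S.endp.int qp).mono_set
      Set.Ioi_subset_Ici_self
  have im : IntegrableOn (fun u => (inner ℂ qp (q u t) * inner ℂ (q u t) qm : ℂ)) (Set.Iic 0) :=
    integrableOn_inner_mul_inner S.continuous S.pot.p_le ho' S.endm.int qm
  have hs : ∀ u, (inner ℂ qm (q u t) * inner ℂ (q u t) qp : ℂ)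
      = star (inner ℂ qp (q u t) * inner ℂ (q u t) qm : ℂ) := fun u => by
    rw [star_mul, Complex.star_def, inner_conj_symm, inner_conj_symm]
  have im' : IntegrableOn (fun u => (inner ℂ qm (q u t) * inner ℂ (q u t) qp : ℂ))
      (Set.Iic 0) := by
    refine im.norm.mono' ?_ (ae_of_all _ fun u => by rw [hs, norm_star])
    have := S.continuous
    fun_prop
  -- The integral from 0 to x is taken backwards as x → −∞, hence the sign. Conjugation swaps q_+
  -- and q_-, so the two half-lines fit together into ϑ₁*.
  refine ⟨_, -∫ u in Set.Iic (0 : ℝ), (inner ℂ qp (q u t) * inner ℂ (q u t) qm : ℂ),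
    intervalIntegral_tendsto_integral_Ioi 0 ip tendsto_id, ?_, ?_⟩
  · refine (intervalIntegral_tendsto_integral_Iic 0 im tendsto_id).neg.congr fun x => ?_
    rw [id, intervalIntegral.integral_symm, neg_neg]
  · rw [theta1, star_neg, sub_neg_eq_add, Complex.star_def, ← integral_conj, ← integral_conj,
      add_comm]
    simp_rw [← Complex.star_def, ← hs]
    rw [← setIntegral_union (Set.Iic_disjoint_Ioi le_rfl) measurableSet_Ioi im' ip,
      Set.Iic_union_Ioi, setIntegral_univ]

/-- The limit of h₁₁ is now 0, so the inner product of the lower parts at x = 0 is needed to order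
1/ζ, one correction coming from each half-line. -/
theorem Setting.scattering_zero_orthogonal (S : Setting q0 σ t M q qm qp p₁ p₂)
    (ho : (inner ℂ qm qp : ℂ) = 0)
    (hwp : IntegrableOn (fun x : ℝ => (1 + |x|) • (q x t - qp)) (Set.Ici 0))
    (hwm : IntegrableOn (fun x : ℝ => (1 + |x|) • (q x t - qm)) (Set.Iic 0)) :
    ∃ C, 0 < C ∧ ∀ z : ℝ, z ≠ 0 → |z| ≤ q0 ^ 2 / (8 * M) →
      ‖matH q0 σ q qm qp t z 0 0 - -(Complex.I * z / q0 ^ 4) * star (theta1 q qm qp t)‖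
        ≤ C * |z| ^ 2 := by
  have ho' : (inner ℂ qp qm : ℂ) = 0 := inner_eq_zero_symm.1 ho
  obtain ⟨gp, gm, hgp, hgm, hθ⟩ := S.exists_theta1 ho
  obtain ⟨C, hC, h⟩ := S.scattering_small
  obtain ⟨C₁, hC₁, hp⟩ := S.pot.norm_inner_orthogonal_le S.endp hwp ho hC
  obtain ⟨C₂, hC₂, hm⟩ := S.pot.norm_inner_orthogonal_le S.endm hwm ho' hC
  have hM := S.pot.one_le
  have hq := S.pot.q0_pos
  have hqc : (q0 : ℂ) ≠ 0 := by exact_mod_cast hq.ne'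
  set K := C ^ 2 * (1 + 2 * M) + C * C + q0 * C
  have hK : 0 < K := by positivity
  set K' := C ^ 2 * (1 + 2 * M) + (C ^ 2 + C₁ + C₂)
  have hK' : 0 < K' := by positivity
  refine ⟨K / q0 ^ 4 + 1 / q0 ^ 2 * (K' / q0 ^ 4), by positivity, fun z hz hzs => ?_⟩
  obtain ⟨hζ, ⟨am, ap, vm, vp, hs⟩, -, -⟩ := h z hz hzs
  have b := hs.norm_pairing_add_inner_le S hC hζ
  have b1 := norm_pairing_add_le S.pot hζ hs.low_m hs.low_p 0
  have b2 := hs.near_m 0 (Set.mem_Iic.2 le_rfl)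
  have b3 := hs.near_p 0 (Set.mem_Ici.2 le_rfl)
  have b4 := hp _ hζ _ _ hs.low_p hs.lim_p hs.near_p gp hgp
  have b5 := hm _ hζ _ _ hs.low_m hs.lim_m hs.near_m gm hgm
  rw [osc_zero, one_smul] at b2 b3
  have hzc : (z : ℂ) ≠ 0 := by exact_mod_cast hz
  have hIζ : Complex.I / ((q0 ^ 2 / z : ℝ) : ℂ) = Complex.I * z / q0 ^ 2 := by
    push_cast; field_simp
  rw [hIζ] at b4 b5
  rw [ho, add_zero] at b
  set ζ := q0 ^ 2 / z with hζdef
  set P := pairing (am 0) (vm 0) (ap 0) (vp 0)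
  set x := loC ζ (fun x => q x t) am vm 0
  set y := loC ζ (fun x => q x t) ap vp 0
  have hX : ‖(inner ℂ x y : ℂ) + Complex.I * z / q0 ^ 2 * star (theta1 q qm qp t)‖
      ≤ (C ^ 2 + C₁ + C₂) / |ζ| ^ 2 := by
    -- Because ⟨q_-,q_+⟩ = 0, ⟨x,y⟩ splits into ⟨x − q_-, y − q_+⟩, which is second order, plus the
    -- two cross terms ⟨q_-,y⟩ and ⟨x,q_+⟩.
    have e : (inner ℂ x y : ℂ) + Complex.I * z / q0 ^ 2 * star (theta1 q qm qp t)
        = inner ℂ (x - qm) (y - qp) + (inner ℂ qm y + Complex.I * z / q0 ^ 2 * gp)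
          + star (inner ℂ qp x + Complex.I * z / q0 ^ 2 * gm : ℂ) := by
      have : star (inner ℂ qp x : ℂ) = inner ℂ x qp := by
        rw [Complex.star_def, inner_conj_symm]
      rw [star_add, this, star_mul, hθ]
      simp only [inner_sub_left, inner_sub_right, ho]
      simp
      ring
    rw [e, add_div, add_div]
    refine (norm_add_le _ _).trans (add_le_add ((norm_add_le _ _).trans (add_le_add ?_ b4)) ?_)
    · refine (norm_inner_le' _ _).trans ?_
      calc _ ≤ C / |ζ| * (C / |ζ|) := by gcongr
        _ = _ := by ring
    · rw [norm_star]; exact b5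
  have hY : ‖P - Complex.I * z / q0 ^ 2 * star (theta1 q qm qp t)‖ ≤ K' / |ζ| ^ 2 := by
    have e : P - Complex.I * z / q0 ^ 2 * star (theta1 q qm qp t) = (P + inner ℂ x y)
        - (inner ℂ x y + Complex.I * z / q0 ^ 2 * star (theta1 q qm qp t)) := by ring
    rw [e, add_div]
    exact (norm_sub_le _ _).trans (add_le_add b1 hX)
  have hP : ‖P‖ ≤ K := b.trans (div_le_self hK.le (by linarith))
  rw [hζdef, div_abs_sq_div_sq] at hY
  have e : matH q0 σ q qm qp t z 0 0 - -(Complex.I * z / q0 ^ 4) * star (theta1 q qm qp t)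
      = (z ^ 2 / q0 ^ 4 : ℂ) * P
        - (1 / q0 ^ 2 : ℂ) * (P - Complex.I * z / q0 ^ 2 * star (theta1 q qm qp t)) := by
    rw [hs.h00]; field_simp; ring
  have n1 : ‖(z ^ 2 / q0 ^ 4 : ℂ)‖ = |z| ^ 2 / q0 ^ 4 := by
    rw [norm_div, norm_pow, norm_pow, Complex.norm_real, Complex.norm_real, Real.norm_eq_abs,
      Real.norm_of_nonneg hq.le]
  have n2 : ‖(1 / q0 ^ 2 : ℂ)‖ = 1 / q0 ^ 2 := by
    rw [norm_div, norm_pow, norm_one, Complex.norm_real, Real.norm_of_nonneg hq.le]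
  rw [e]
  refine (norm_sub_le _ _).trans ?_
  rw [norm_mul, norm_mul, n1, n2]
  calc _ ≤ |z| ^ 2 / q0 ^ 4 * K + 1 / q0 ^ 2 * (K' / q0 ^ 4 * |z| ^ 2) := by gcongr
    _ = _ := by ring

end LeadingCoefficient

/-! ### From the hypotheses to the analytic data; inversion of the parameter -/

section Potential

theorem integrableOn_sq_sub_sq {p : ℝ → Vec2} {s : Set ℝ} {q0 M : ℝ} {b : Vec2} (hp : Continuous p)
    (hM : ∀ x, ‖p x‖ ≤ M) (hb : ‖b‖ = q0) (hi : IntegrableOn (fun x => p x - b) s) :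
    IntegrableOn (fun x => q0 ^ 2 - ‖p x‖ ^ 2) s := by
  refine (hi.norm.const_mul (q0 + M)).mono' (by fun_prop) (ae_of_all _ fun x => ?_)
  have e : q0 ^ 2 - ‖p x‖ ^ 2 = (q0 + ‖p x‖) * (‖b‖ - ‖p x‖) := by rw [hb]; ring
  have h0 : 0 ≤ q0 := hb ▸ norm_nonneg b
  rw [e, norm_mul, Real.norm_of_nonneg (by positivity), Real.norm_eq_abs]
  have h1 := hM x
  have h2 : 0 ≤ M := (norm_nonneg _).trans h1
  gcongr
  · rw [norm_sub_rev]; exact abs_norm_sub_norm_le _ _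

/-- Integrability of q_x and q_xx forces q_x → 0 at both ends and bounds q and q_x by L¹ norms; M is
a sum large enough for all the bounds. -/
theorem exists_setting {q0 σ t : ℝ} (hq0 : 0 < q0) {q : ℝ → ℝ → Vec2} {qm qp : Vec2}
    (hqm : ‖qm‖ = q0) (hqp : ‖qp‖ = q0) (hsmooth : ContDiff ℝ 2 (fun x => q x t))
    (hlimp : Tendsto (fun x => q x t) atTop (𝓝 qp))
    (hlimm : Tendsto (fun x => q x t) atBot (𝓝 qm))
    (hintp : IntegrableOn (fun x => q x t - qp) (Set.Ioi 0))
    (hintm : IntegrableOn (fun x => q x t - qm) (Set.Iio 0))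
    (hint1 : Integrable (deriv (fun x => q x t)))
    (hint2 : Integrable (deriv (deriv (fun x => q x t)))) :
    ∃ M, Setting q0 σ t M q qm qp (deriv fun x => q x t) (deriv (deriv fun x => q x t)) := by
  set p : ℝ → Vec2 := fun x => q x t
  have hp : ∀ x, HasDerivAt p (deriv p x) x := fun x =>
    (hsmooth.differentiable (by norm_num) x).hasDerivAt
  have hp₁ : ∀ x, HasDerivAt (deriv p) (deriv (deriv p) x) x := fun x =>
    ((contDiff_succ_iff_deriv (n := 1)).1 hsmooth).2.2.differentiable one_ne_zero x |>.hasDerivAt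
  have hc : Continuous p := hsmooth.continuous
  have l1 : Tendsto (deriv p) atTop (𝓝 0) :=
    tendsto_zero_of_hasDerivAt_of_integrableOn_Ioi (a := 0) (fun x _ => hp₁ x)
      hint2.integrableOn hint1.integrableOn
  have l2 : Tendsto (deriv p) atBot (𝓝 0) :=
    tendsto_zero_of_hasDerivAt_of_integrableOn_Iic (a := 0) (fun x _ => hp₁ x)
      hint2.integrableOn hint1.integrableOn
  have hi1 : ∀ x, ‖p x - qp‖ ≤ ∫ u in Set.univ, ‖deriv p u‖ := fun x =>
    norm_sub_le_setIntegral_of_tendsto Set.ordConnected_univ MeasurableSet.univ hp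
      hint1.norm.integrableOn (fun _ _ => le_rfl) univ_mem hlimp (Set.mem_univ x)
  have hi2 : ∀ x, ‖deriv p x - 0‖ ≤ ∫ u in Set.univ, ‖deriv (deriv p) u‖ := fun x =>
    norm_sub_le_setIntegral_of_tendsto Set.ordConnected_univ MeasurableSet.univ hp₁
      hint2.norm.integrableOn (fun _ _ => le_rfl) univ_mem l1 (Set.mem_univ x)
  set A := ∫ u in Set.univ, ‖deriv p u‖
  set B := ∫ u in Set.univ, ‖deriv (deriv p) u‖
  have hA : 0 ≤ A := (norm_nonneg _).trans (hi1 0)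
  have hB : 0 ≤ B := (norm_nonneg _).trans (hi2 0)
  have hpM : ∀ x, ‖p x‖ ≤ 1 + q0 + A + B := fun x => by
    have h : ‖p x‖ ≤ ‖p x - qp‖ + ‖qp‖ := by
      simpa using norm_add_le (p x - qp) qp
    linarith [hi1 x]
  have ip : IntegrableOn (fun x => p x - qp) (Set.Ici 0) :=
    (integrableOn_Ici_iff_integrableOn_Ioi).2 hintp
  have im : IntegrableOn (fun x => p x - qm) (Set.Iic 0) :=
    (integrableOn_Iic_iff_integrableOn_Iio).2 hintm
  refine ⟨1 + q0 + A + B, ⟨hp, hp₁, by linarith, hq0, by linarith, hpM, fun x => ?_, hint1, hint2,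
    ?_⟩, ⟨Set.ordConnected_Ici, measurableSet_Ici, Set.mem_Ici.2 le_rfl, Ici_mem_atTop 0,
      inferInstance, hlimp, l1, ip, hqp⟩, ⟨Set.ordConnected_Iic, measurableSet_Iic,
      Set.mem_Iic.2 le_rfl, Iic_mem_atBot 0, inferInstance, hlimm, l2, im, hqm⟩,
      fun z h0 h1 h2 => ⟨hq0, hqm, hqp, h0, h1, h2,
        Classical.epsilon_spec (exists_isJost_atBot hq0 hqm h0 h1 h2 hc hintm),
        Classical.epsilon_spec (exists_isJost_atTop hq0 hqp h0 h1 h2 hc hintp)⟩⟩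
  · have := hi2 x
    rw [sub_zero] at this
    linarith
  · rw [← integrableOn_univ, ← Set.Iic_union_Ici (a := (0 : ℝ))]
    exact (integrableOn_sq_sub_sq hc hpM hqm im).union (integrableOn_sq_sub_sq hc hpM hqp ip)

theorem inner_perp_ne_zero {q0 : ℝ} (hq0 : 0 < q0) {qm qp : Vec2} (hqm : ‖qm‖ = q0)
    (hqp : ‖qp‖ = q0) (hnp : ‖(inner ℂ qp qm : ℂ)‖ / q0 ^ 2 < 1) :
    (inner ℂ (perp qm) qp : ℂ) ≠ 0 := by
  intro h
  have e := norm_inner_sq_add qm qp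
  rw [h, hqm, hqp, norm_inner_symm] at e
  rw [div_lt_one (by positivity)] at hnp
  have h1 : ‖(inner ℂ qp qm : ℂ)‖ ^ 2 < (q0 ^ 2) ^ 2 := by gcongr
  rw [norm_zero] at e
  nlinarith

theorem tendsto_sq_div_cobounded {q0 : ℝ} (hq0 : 0 < q0) :
    Tendsto (fun z : ℝ => q0 ^ 2 / z) (Bornology.cobounded ℝ) (𝓝[≠] 0) := by
  refine tendsto_nhdsWithin_iff.2 ⟨?_, ?_⟩
  · simpa [div_eq_mul_inv] using (tendsto_inv₀_cobounded (α := ℝ)).const_mul (q0 ^ 2)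
  · filter_upwards [Bornology.eventually_ne_cobounded (0 : ℝ)] with z hz
    exact div_ne_zero (by positivity) hz

theorem tendsto_sq_div_zero {q0 : ℝ} (hq0 : 0 < q0) :
    Tendsto (fun z : ℝ => q0 ^ 2 / z) (𝓝[≠] 0) (Bornology.cobounded ℝ) := by
  rw [← tendsto_norm_atTop_iff_cobounded]
  have h := (tendsto_norm_atTop_iff_cobounded.2 (tendsto_inv₀_nhdsNE_zero (α := ℝ))).const_mul_atTop
    (by positivity : 0 < q0 ^ 2)
  refine h.congr fun z => ?_
  rw [norm_div, norm_inv, Real.norm_of_nonneg (by positivity : 0 ≤ q0 ^ 2), div_eq_mul_inv]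

theorem isBigO_div_sub {l : Filter ℝ} {f g c : ℝ → ℂ} {u v : ℝ → ℝ}
    (h : (fun z => f z - c z * g z) =O[l] u) (hg : (fun z => (g z)⁻¹) =O[l] v)
    (h0 : ∀ᶠ z in l, g z ≠ 0) : (fun z => f z / g z - c z) =O[l] fun z => u z * v z := by
  refine (h.mul hg).congr' ?_ EventuallyEq.rfl
  filter_upwards [h0] with z hz
  field_simp

end Potential

/-! ### Reflection coefficients at infinity and at zero -/

section ReflectionCoefficients

variable {q0 σ t M : ℝ} {q : ℝ → ℝ → Vec2} {qm qp : Vec2} {p₁ p₂ : ℝ → Vec2} {l : Filter ℝ}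

theorem Setting.eventually_jp_cobounded (S : Setting q0 σ t M q qm qp p₁ p₂) :
    ∀ᶠ z in Bornology.cobounded ℝ, JostPair q0 σ q qm qp t z := by
  filter_upwards [Bornology.eventually_ne_cobounded (0 : ℝ),
    Bornology.eventually_ne_cobounded q0, Bornology.eventually_ne_cobounded (-q0)] with z h0 h1 h2
  exact S.jp z h0 h1 h2

theorem Setting.eventually_jp_zero (S : Setting q0 σ t M q qm qp p₁ p₂) :
    ∀ᶠ z in 𝓝[≠] (0 : ℝ), JostPair q0 σ q qm qp t z := by
  have hq := S.pot.q0_pos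
  filter_upwards [self_mem_nhdsWithin, eventually_nhdsWithin_of_eventually_nhds
    (eventually_ne_nhds hq.ne), eventually_nhdsWithin_of_eventually_nhds
    (eventually_ne_nhds (neg_ne_zero.2 hq.ne').symm)] with z h0 h1 h2
  exact S.jp z h0 h1 h2

theorem Setting.eventually_small (S : Setting q0 σ t M q qm qp p₁ p₂) :
    ∀ᶠ z in 𝓝[≠] (0 : ℝ), z ≠ 0 ∧ |z| ≤ q0 ^ 2 / (8 * M) := by
  have hq := S.pot.q0_pos
  have hM := S.pot.one_le
  have h : ∀ᶠ z in 𝓝 (0 : ℝ), |z| < q0 ^ 2 / (8 * M) :=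
    continuous_abs.continuousAt.eventually_lt_const (by rw [abs_zero]; positivity)
  filter_upwards [self_mem_nhdsWithin, eventually_nhdsWithin_of_eventually_nhds h] with z h0 h1
  exact ⟨h0, h1.le⟩

theorem isBigO_beta1 {u v : ℝ → ℝ} (hj : ∀ᶠ z in l, JostPair q0 σ q qm qp t z)
    (h : (fun z => matH q0 σ q qm qp t z 2 0) =O[l] u)
    (hg : (fun z => (matH q0 σ q qm qp t z 0 0)⁻¹) =O[l] v) :
    (fun z => beta1 q0 σ q qm qp t z) =O[l] fun z => u z * v z := by
  refine IsBigO.trans (IsBigO.of_bound' ?_) (h.mul hg)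
  filter_upwards [hj] with z hz
  rw [hz.norm_beta1, norm_mul, norm_inv, div_eq_mul_inv]

theorem denominatorsNonzero (S : Setting q0 σ t M q qm qp p₁ p₂)
    (h : ∀ᶠ z in Bornology.cobounded ℝ, matH q0 σ q qm qp t z 0 0 ≠ 0)
    (h' : ∀ᶠ z in 𝓝[≠] (0 : ℝ), matH q0 σ q qm qp t z 0 0 ≠ 0) :
    DenominatorsNonzero q0 σ q qm qp t := by
  refine ⟨?_, ?_⟩
  · filter_upwards [h, S.eventually_jp_cobounded] with z hz hj
    exact ⟨hz, by rw [hj.matS_zero_zero]; exact star_ne_zero.2 hz⟩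
  · filter_upwards [h', S.eventually_jp_zero] with z hz hj
    exact ⟨hz, by rw [hj.matS_zero_zero]; exact star_ne_zero.2 hz⟩

theorem eventually_le_abs_cobounded (Z : ℝ) : ∀ᶠ z in Bornology.cobounded ℝ, Z ≤ |z| :=
  tendsto_norm_cobounded_atTop.eventually_ge_atTop Z

/-- The reflection coefficients at infinity. -/
theorem Setting.beta_cobounded (S : Setting q0 σ t M q qm qp p₁ p₂) :
    (∀ᶠ z in Bornology.cobounded ℝ, matH q0 σ q qm qp t z 0 0 ≠ 0) ∧
    ((fun z => beta1 q0 σ q qm qp t z) =O[Bornology.cobounded ℝ] fun z : ℝ => 1 / z ^ 2) ∧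
    ((fun z => beta2 q0 σ q qm qp t z) =O[Bornology.cobounded ℝ] fun z : ℝ => 1 / z ^ 2) := by
  obtain ⟨C, hC, Z, hZ, h⟩ := S.scattering_large
  have hev := eventually_le_abs_cobounded Z
  have h00 : Tendsto (fun z => matH q0 σ q qm qp t z 0 0) (Bornology.cobounded ℝ) (𝓝 1) := by
    rw [tendsto_iff_norm_sub_tendsto_zero]
    have : Tendsto (fun z : ℝ => C / |z|) (Bornology.cobounded ℝ) (𝓝 0) :=
      tendsto_norm_cobounded_atTop.const_div_atTop C
    refine squeeze_zero' (Eventually.of_forall fun _ => norm_nonneg _) ?_ this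
    filter_upwards [hev] with z hz using (h z hz).1
  have hb : ∀ f : ℝ → ℂ, (∀ z, Z ≤ |z| → ‖f z‖ ≤ C / |z| ^ 2) →
      f =O[Bornology.cobounded ℝ] fun z : ℝ => 1 / z ^ 2 := fun f hf => by
    refine IsBigO.of_bound C ?_
    filter_upwards [hev] with z hz
    refine (hf z hz).trans_eq ?_
    rw [norm_div, norm_one, norm_pow, Real.norm_eq_abs]; ring
  have hinv : (fun z => (matH q0 σ q qm qp t z 0 0)⁻¹) =O[Bornology.cobounded ℝ]
      fun _ => (1 : ℝ) := (h00.inv₀ one_ne_zero).isBigO_one ℝ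
  refine ⟨h00.eventually_ne one_ne_zero, ?_, ?_⟩
  · simpa using isBigO_beta1 S.eventually_jp_cobounded (hb _ fun z hz => (h z hz).2.2) hinv
  · simpa [beta2, div_eq_mul_inv] using (hb _ fun z hz => (h z hz).2.1).mul hinv

theorem Setting.isBigO_offdiag_zero (S : Setting q0 σ t M q qm qp p₁ p₂) :
    ((fun z => matH q0 σ q qm qp t z 2 0) =O[𝓝[≠] 0] fun z : ℝ => z ^ 2) ∧
    ((fun z : ℝ => matH q0 σ q qm qp t z 1 0
      - -(Complex.I * z / q0 ^ 3) * inner ℂ (perp qm) qp) =O[𝓝[≠] 0] fun z : ℝ => z ^ 2) := by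
  obtain ⟨C, hC, h⟩ := S.scattering_small
  refine ⟨IsBigO.of_bound C ?_, IsBigO.of_bound C ?_⟩
  · filter_upwards [S.eventually_small] with z hz
    rw [norm_pow, Real.norm_eq_abs]
    exact (h z hz.1 hz.2).2.2.1
  · filter_upwards [S.eventually_small] with z hz
    rw [norm_pow, Real.norm_eq_abs]
    exact (h z hz.1 hz.2).2.2.2

/-- The reflection coefficients at zero for non-orthogonal boundary vectors. -/
theorem Setting.beta_zero (S : Setting q0 σ t M q qm qp p₁ p₂) (hne : (inner ℂ qm qp : ℂ) ≠ 0) :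
    (∀ᶠ z in 𝓝[≠] (0 : ℝ), matH q0 σ q qm qp t z 0 0 ≠ 0) ∧
    ((fun z => beta1 q0 σ q qm qp t z) =O[𝓝[≠] 0] fun z : ℝ => z ^ 2) ∧
    ((fun z : ℝ => beta2 q0 σ q qm qp t z
      - (z : ℂ) / (Complex.I * (q0 : ℂ)) * ((inner ℂ (perp qm) qp : ℂ) / (inner ℂ qm qp : ℂ)))
        =O[𝓝[≠] 0] fun z : ℝ => z ^ 2) := by
  obtain ⟨C, hC, h⟩ := S.scattering_zero
  obtain ⟨h20, h10⟩ := S.isBigO_offdiag_zero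
  have hqc : (q0 : ℂ) ≠ 0 := by exact_mod_cast S.pot.q0_pos.ne'
  have hI := Complex.I_ne_zero
  have hO : (fun z => matH q0 σ q qm qp t z 0 0 - inner ℂ qm qp / q0 ^ 2) =O[𝓝[≠] 0]
      fun z : ℝ => z := by
    refine IsBigO.of_bound C ?_
    filter_upwards [S.eventually_small] with z hz using h z hz.1 hz.2
  have hid : Tendsto (fun z : ℝ => z) (𝓝[≠] 0) (𝓝 0) :=
    tendsto_nhdsWithin_of_tendsto_nhds tendsto_id
  have h00 : Tendsto (fun z => matH q0 σ q qm qp t z 0 0) (𝓝[≠] 0)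
      (𝓝 (inner ℂ qm qp / q0 ^ 2)) := by
    have := (hO.trans_tendsto hid).add_const (inner ℂ qm qp / q0 ^ 2 : ℂ)
    simpa using this
  have hl : (inner ℂ qm qp / q0 ^ 2 : ℂ) ≠ 0 := div_ne_zero hne (pow_ne_zero 2 hqc)
  have hinv : (fun z => (matH q0 σ q qm qp t z 0 0)⁻¹) =O[𝓝[≠] 0] fun _ => (1 : ℝ) :=
    (h00.inv₀ hl).isBigO_one ℝ
  have h0 := h00.eventually_ne hl
  refine ⟨h0, by simpa using isBigO_beta1 S.eventually_jp_zero h20 hinv, ?_⟩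
  have hz : (fun z : ℝ => (z : ℂ)) =O[𝓝[≠] 0] fun z : ℝ => z :=
    IsBigO.of_bound' (Eventually.of_forall fun z => by simp)
  -- The leading terms of h₂₁ and of the claimed coefficient times h₁₁ agree because 1/i = −i; what
  -- is left is O(z²).
  have key : (fun z : ℝ => matH q0 σ q qm qp t z 1 0
      - (z : ℂ) / (Complex.I * (q0 : ℂ)) * ((inner ℂ (perp qm) qp : ℂ) / (inner ℂ qm qp : ℂ))
        * matH q0 σ q qm qp t z 0 0) =O[𝓝[≠] 0] fun z : ℝ => z ^ 2 := by
    have := h10.sub ((hz.mul hO).const_mul_left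
      ((inner ℂ (perp qm) qp : ℂ) / (Complex.I * q0 * inner ℂ qm qp)) |>.congr_right
        fun z => (sq z).symm)
    refine this.congr_left fun z => ?_
    have h2 := Complex.I_sq
    field_simp
    linear_combination (z * inner ℂ (perp qm) qp * inner ℂ qm qp : ℂ) * h2
  simpa [beta2] using isBigO_div_sub key hinv h0

/-- The reflection coefficients at zero for orthogonal boundary vectors. -/
theorem Setting.beta_zero_orthogonal (S : Setting q0 σ t M q qm qp p₁ p₂)
    (ho : (inner ℂ qm qp : ℂ) = 0)
    (hwp : IntegrableOn (fun x : ℝ => (1 + |x|) • (q x t - qp)) (Set.Ici 0))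
    (hwm : IntegrableOn (fun x : ℝ => (1 + |x|) • (q x t - qm)) (Set.Iic 0))
    (hθ : theta1 q qm qp t ≠ 0) :
    (∀ᶠ z in 𝓝[≠] (0 : ℝ), matH q0 σ q qm qp t z 0 0 ≠ 0) ∧
    ((fun z => beta1 q0 σ q qm qp t z) =O[𝓝[≠] 0] fun z : ℝ => z) ∧
    ((fun z : ℝ => beta2 q0 σ q qm qp t z
      - (q0 : ℂ) / star (theta1 q qm qp t) * (inner ℂ (perp qm) qp : ℂ))
        =O[𝓝[≠] 0] fun z : ℝ => z) := by
  obtain ⟨C, hC, h⟩ := S.scattering_zero_orthogonal ho hwp hwm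
  obtain ⟨h20, h10⟩ := S.isBigO_offdiag_zero
  have hqc : (q0 : ℂ) ≠ 0 := by exact_mod_cast S.pot.q0_pos.ne'
  have hI := Complex.I_ne_zero
  have hθs := star_ne_zero.2 hθ
  set w : ℂ := -(Complex.I / q0 ^ 4) * star (theta1 q qm qp t) with hw
  have hw0 : w ≠ 0 := mul_ne_zero (neg_ne_zero.2 (div_ne_zero hI (pow_ne_zero 4 hqc))) hθs
  have hO : (fun z : ℝ => matH q0 σ q qm qp t z 0 0 - w * z) =O[𝓝[≠] 0]
      fun z : ℝ => z ^ 2 := by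
    refine IsBigO.of_bound C ?_
    filter_upwards [S.eventually_small] with z hz
    rw [norm_pow, Real.norm_eq_abs]
    refine le_trans (le_of_eq ?_) (h z hz.1 hz.2)
    congr 2
    rw [hw]; ring
  have hid : Tendsto (fun z : ℝ => z) (𝓝[≠] 0) (𝓝 0) :=
    tendsto_nhdsWithin_of_tendsto_nhds tendsto_id
  have hz0 : ∀ᶠ z in 𝓝[≠] (0 : ℝ), z ≠ 0 := self_mem_nhdsWithin
  have hzi : (fun z : ℝ => (z : ℂ)⁻¹) =O[𝓝[≠] 0] fun z : ℝ => z⁻¹ :=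
    IsBigO.of_bound' (Eventually.of_forall fun z => by simp)
  -- h₁₁ vanishes to first order exactly, since w ≠ 0 by ϑ₁ ≠ 0. Its inverse is O(1/z), and division
  -- costs one power of z.
  have hlim : Tendsto (fun z : ℝ => matH q0 σ q qm qp t z 0 0 * (z : ℂ)⁻¹) (𝓝[≠] 0) (𝓝 w) := by
    have h1 : (fun z : ℝ => (matH q0 σ q qm qp t z 0 0 - w * z) * (z : ℂ)⁻¹) =O[𝓝[≠] 0]
        fun z : ℝ => z := by
      refine (hO.mul hzi).congr' EventuallyEq.rfl ?_
      filter_upwards [hz0] with z hz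
      field_simp
    have h2 := (h1.trans_tendsto hid).add_const w
    rw [zero_add] at h2
    refine h2.congr' ?_
    filter_upwards [hz0] with z hz
    have : (z : ℂ) ≠ 0 := by exact_mod_cast hz
    field_simp
    ring
  have h0 : ∀ᶠ z in 𝓝[≠] (0 : ℝ), matH q0 σ q qm qp t z 0 0 ≠ 0 := by
    filter_upwards [hlim.eventually_ne hw0] with z hz using left_ne_zero_of_mul hz
  have hinv : (fun z => (matH q0 σ q qm qp t z 0 0)⁻¹) =O[𝓝[≠] 0] fun z : ℝ => z⁻¹ := by
    have h1 := (((hlim.inv₀ hw0).isBigO_one ℝ).mul hzi).congr_right fun z => one_mul z⁻¹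
    refine h1.congr' ?_ EventuallyEq.rfl
    filter_upwards [hz0] with z hz
    have : (z : ℂ) ≠ 0 := by exact_mod_cast hz
    field_simp
  have hcancel : ∀ᶠ z in 𝓝[≠] (0 : ℝ), z ^ 2 * z⁻¹ = z := by
    filter_upwards [hz0] with z hz
    field_simp
  refine ⟨h0, (isBigO_beta1 S.eventually_jp_zero h20 hinv).congr' EventuallyEq.rfl hcancel, ?_⟩
  have key : (fun z : ℝ => matH q0 σ q qm qp t z 1 0
      - (q0 : ℂ) / star (theta1 q qm qp t) * (inner ℂ (perp qm) qp : ℂ)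
        * matH q0 σ q qm qp t z 0 0) =O[𝓝[≠] 0] fun z : ℝ => z ^ 2 := by
    refine (h10.sub (hO.const_mul_left
      ((q0 : ℂ) / star (theta1 q qm qp t) * (inner ℂ (perp qm) qp : ℂ)))).congr_left fun z => ?_
    rw [hw]
    field_simp
    ring
  exact (isBigO_div_sub key hinv h0).congr' EventuallyEq.rfl hcancel

end ReflectionCoefficients

end CoupledHirota

end

/-! ### Assembly of the expansions -/

theorem proposition15
    (q0 σ t : ℝ) (hq0 : 0 < q0)
    (q : ℝ → ℝ → CoupledHirota.Vec2) (qm qp : CoupledHirota.Vec2)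
    (hqm : ‖qm‖ = q0) (hqp : ‖qp‖ = q0)
    -- the boundary vectors are not parallel
    (hnp : ‖(inner ℂ qp qm : ℂ)‖ / q0 ^ 2 < 1)
    -- the potential at time `t`: boundary conditions, regularity and decay
    (hsmooth : ContDiff ℝ 2 (fun x => q x t))
    (hlimp : Tendsto (fun x => q x t) atTop (𝓝 qp))
    (hlimm : Tendsto (fun x => q x t) atBot (𝓝 qm))
    (hintp : IntegrableOn (fun x => q x t - qp) (Set.Ioi 0))
    (hintm : IntegrableOn (fun x => q x t - qm) (Set.Iio 0))
    (hint1 : Integrable (deriv (fun x => q x t)))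
    (hint2 : Integrable (deriv (deriv (fun x => q x t)))) :
    -- the Jost solutions and the scattering matrix are well defined
    (∀ z : ℝ, z ≠ 0 → z ≠ q0 → z ≠ -q0 →
      (∃! ψ : ℝ → CoupledHirota.Mat3, CoupledHirota.IsJost q0 σ q atTop qp t z ψ) ∧
      (∃! ψ : ℝ → CoupledHirota.Mat3, CoupledHirota.IsJost q0 σ q atBot qm t z ψ) ∧
      (∃! H : CoupledHirota.Mat3, CoupledHirota.IsScattering q0 σ q qm qp t z H) ∧
      (CoupledHirota.matH q0 σ q qm qp t z).det = 1) ∧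
    -- the coefficient of the leading terms does not vanish
    (inner ℂ (CoupledHirota.perp qm) qp : ℂ) ≠ 0 ∧
    -- the non-orthogonal case
    ((inner ℂ qp qm : ℂ) ≠ 0 →
      CoupledHirota.DenominatorsNonzero q0 σ q qm qp t ∧
      -- as `z → ∞`
      ((fun z : ℝ => CoupledHirota.beta1 q0 σ q qm qp t z)
        =O[Bornology.cobounded ℝ] (fun z : ℝ => 1 / z)) ∧
      ((fun z : ℝ => CoupledHirota.beta2 q0 σ q qm qp t z)
        =O[Bornology.cobounded ℝ] (fun z : ℝ => 1 / z ^ 2)) ∧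
      ((fun z : ℝ => CoupledHirota.beta1 q0 σ q qm qp t (q0 ^ 2 / z))
        =O[Bornology.cobounded ℝ] (fun z : ℝ => 1 / z ^ 2)) ∧
      ((fun z : ℝ => CoupledHirota.beta2 q0 σ q qm qp t (q0 ^ 2 / z)
          - (q0 : ℂ) / (Complex.I * (z : ℂ))
            * ((inner ℂ (CoupledHirota.perp qm) qp : ℂ) / (inner ℂ qm qp : ℂ)))
        =O[Bornology.cobounded ℝ] (fun z : ℝ => 1 / z ^ 2)) ∧
      -- as `z → 0`
      ((fun z : ℝ => CoupledHirota.beta1 q0 σ q qm qp t z)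
        =O[𝓝[≠] (0 : ℝ)] (fun z : ℝ => z)) ∧
      ((fun z : ℝ => CoupledHirota.beta1 q0 σ q qm qp t (q0 ^ 2 / z))
        =O[𝓝[≠] (0 : ℝ)] (fun z : ℝ => z)) ∧
      ((fun z : ℝ => CoupledHirota.beta2 q0 σ q qm qp t (q0 ^ 2 / z))
        =O[𝓝[≠] (0 : ℝ)] (fun z : ℝ => z)) ∧
      ((fun z : ℝ => CoupledHirota.beta2 q0 σ q qm qp t z
          - (z : ℂ) / (Complex.I * (q0 : ℂ))
            * ((inner ℂ (CoupledHirota.perp qm) qp : ℂ) / (inner ℂ qm qp : ℂ)))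
        =O[𝓝[≠] (0 : ℝ)] (fun z : ℝ => z ^ 2))) ∧
    -- the orthogonal case
    ((inner ℂ qp qm : ℂ) = 0 →
      IntegrableOn (fun x : ℝ => (1 + |x|) • (q x t - qp)) (Set.Ioi 0) →
      IntegrableOn (fun x : ℝ => (1 + |x|) • (q x t - qm)) (Set.Iio 0) →
      CoupledHirota.theta1 q qm qp t ≠ 0 →
      CoupledHirota.DenominatorsNonzero q0 σ q qm qp t ∧
      -- as `z → ∞`
      ((fun z : ℝ => CoupledHirota.beta1 q0 σ q qm qp t z)
        =O[Bornology.cobounded ℝ] (fun z : ℝ => 1 / z)) ∧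
      ((fun z : ℝ => CoupledHirota.beta1 q0 σ q qm qp t (q0 ^ 2 / z))
        =O[Bornology.cobounded ℝ] (fun z : ℝ => 1 / z)) ∧
      ((fun z : ℝ => CoupledHirota.beta2 q0 σ q qm qp t z)
        =O[Bornology.cobounded ℝ] (fun z : ℝ => 1 / z ^ 2)) ∧
      ((fun z : ℝ => CoupledHirota.beta2 q0 σ q qm qp t (q0 ^ 2 / z)
          - (q0 : ℂ) / star (CoupledHirota.theta1 q qm qp t)
            * (inner ℂ (CoupledHirota.perp qm) qp : ℂ))
        =O[Bornology.cobounded ℝ] (fun z : ℝ => 1 / z)) ∧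
      -- as `z → 0`
      ((fun z : ℝ => CoupledHirota.beta1 q0 σ q qm qp t z)
        =O[𝓝[≠] (0 : ℝ)] (fun _ : ℝ => (1 : ℝ))) ∧
      ((fun z : ℝ => CoupledHirota.beta1 q0 σ q qm qp t (q0 ^ 2 / z))
        =O[𝓝[≠] (0 : ℝ)] (fun z : ℝ => z)) ∧
      ((fun z : ℝ => CoupledHirota.beta2 q0 σ q qm qp t (q0 ^ 2 / z))
        =O[𝓝[≠] (0 : ℝ)] (fun z : ℝ => z)) ∧
      ((fun z : ℝ => CoupledHirota.beta2 q0 σ q qm qp t z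
          - (q0 : ℂ) / star (CoupledHirota.theta1 q qm qp t)
            * (inner ℂ (CoupledHirota.perp qm) qp : ℂ))
        =O[𝓝[≠] (0 : ℝ)] (fun z : ℝ => z))) := by
  obtain ⟨M, S⟩ := CoupledHirota.exists_setting (σ := σ) hq0 hqm hqp hsmooth hlimp hlimm hintp
    hintm hint1 hint2
  have hc := hsmooth.continuous
  obtain ⟨hne, b1, b2⟩ := S.beta_cobounded
  have T := CoupledHirota.tendsto_sq_div_cobounded hq0
  have T' := CoupledHirota.tendsto_sq_div_zero hq0
  have hid : Tendsto (fun z : ℝ => z) (𝓝[≠] 0) (𝓝 0) :=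
    tendsto_nhdsWithin_of_tendsto_nhds tendsto_id
  have hsq : (fun z : ℝ => z ^ 2) =O[𝓝[≠] 0] fun z : ℝ => z := by
    simpa [sq] using (hid.isBigO_one ℝ).mul (isBigO_refl (fun z : ℝ => z) (𝓝[≠] 0))
  have hsq' : (fun z : ℝ => 1 / z ^ 2) =O[Bornology.cobounded ℝ] fun z : ℝ => 1 / z := by
    refine IsBigO.of_bound' ?_
    filter_upwards [CoupledHirota.eventually_le_abs_cobounded 1] with z hz
    rw [norm_div, norm_div, norm_pow, Real.norm_eq_abs z, norm_one]
    gcongr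
    nlinarith
  -- The map z ↦ q₀²/z exchanges 0 and ∞, so every statement at q₀²/z is one at the opposite end
  -- transported by `pull`, `push` or `push_sq`.
  have pull : ∀ {f : ℝ → ℂ}, (f =O[Bornology.cobounded ℝ] fun z : ℝ => 1 / z ^ 2) →
      (fun z => f (q0 ^ 2 / z)) =O[𝓝[≠] 0] fun z : ℝ => z := fun {f} hf => by
    refine (((hf.comp_tendsto T').trans (IsBigO.of_bound (1 / (q0 ^ 2) ^ 2) ?_)).trans hsq)
    refine Eventually.of_forall fun z => le_of_eq ?_
    simp only [Function.comp_apply]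
    rw [div_pow, one_div_div, norm_div, norm_pow (q0 ^ 2), Real.norm_of_nonneg (sq_nonneg q0)]
    ring
  have push : ∀ {f : ℝ → ℂ}, (f =O[𝓝[≠] 0] fun z : ℝ => z) →
      (fun z => f (q0 ^ 2 / z)) =O[Bornology.cobounded ℝ] fun z : ℝ => 1 / z := fun {f} hf => by
    refine (hf.comp_tendsto T).trans (IsBigO.of_bound (q0 ^ 2) ?_)
    refine Eventually.of_forall fun z => le_of_eq ?_
    simp only [Function.comp_apply]
    rw [norm_div, norm_div, norm_one, Real.norm_of_nonneg (sq_nonneg q0)]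
    ring
  have push_sq : ∀ {f : ℝ → ℂ}, (f =O[𝓝[≠] 0] fun z : ℝ => z ^ 2) →
      (fun z => f (q0 ^ 2 / z)) =O[Bornology.cobounded ℝ] fun z : ℝ => 1 / z ^ 2 :=
    fun {f} hf => by
    refine (hf.comp_tendsto T).trans (IsBigO.of_bound ((q0 ^ 2) ^ 2) ?_)
    refine Eventually.of_forall fun z => le_of_eq ?_
    simp only [Function.comp_apply]
    rw [div_pow, norm_div, norm_div, norm_one, norm_pow (q0 ^ 2),
      Real.norm_of_nonneg (sq_nonneg q0)]
    ring
  refine ⟨fun z h0 h1 h2 => ?_, CoupledHirota.inner_perp_ne_zero hq0 hqm hqp hnp, fun hno => ?_,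
    fun ho hwp hwm hθ => ?_⟩
  · have J := S.jp z h0 h1 h2
    exact ⟨⟨_, J.isJost_p, fun φ hφ => J.isJost_p.unique hφ hq0 hqp h0 h1 h2⟩,
      ⟨_, J.isJost_m, fun φ hφ => J.isJost_m.unique hφ hq0 hqm h0 h1 h2⟩,
      J.existsUnique_scattering, J.det_eq_one⟩
  -- The bounds at hand for β₁ are one order better than required, O(1/z²) at infinity and O(z²) at
  -- zero, and are weakened where necessary.
  · obtain ⟨hne0, c1, c2⟩ := S.beta_zero fun h => hno (inner_eq_zero_symm.1 h)
    refine ⟨CoupledHirota.denominatorsNonzero S hne hne0, b1.trans hsq', b2, push_sq c1, ?_,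
      c1.trans hsq, pull b1, pull b2, c2⟩
    refine (push_sq c2).congr_left fun z => ?_
    have hqc : (q0 : ℂ) ≠ 0 := by exact_mod_cast hq0.ne'
    congr 2
    push_cast
    field_simp
  · have hwp' : IntegrableOn (fun x : ℝ => (1 + |x|) • (q x t - qp)) (Set.Ici 0) :=
      (integrableOn_Ici_iff_integrableOn_Ioi).2 hwp
    have hwm' : IntegrableOn (fun x : ℝ => (1 + |x|) • (q x t - qm)) (Set.Iic 0) :=
      (integrableOn_Iic_iff_integrableOn_Iio).2 hwm
    obtain ⟨hne0, c1, c2⟩ := S.beta_zero_orthogonal (inner_eq_zero_symm.1 ho) hwp' hwm' hθ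
    exact ⟨CoupledHirota.denominatorsNonzero S hne hne0, b1.trans hsq', push c1, b2, push c2,
      c1.trans (hid.isBigO_one ℝ), pull b1, pull b2, c2⟩
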